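/- **Setting.** Let $L,n_t,n_r,p_t,p_r$ be non-negative integers, $\mathbf F\in\mathbb C^{n_t\times p_t}$, $\mathbf G\in\mathbb C^{n_r\times p_r}$ (beamforming and beamcombining matrices), $\sigma_v>0$, and for each path $l=1,\dots,L$ let $K_l\ge 0$ (Rice factor) and $\Omega_l>0$ (second moment). Let $\mathbf e_t(\phi)=\frac1{\sqrt{n_t}}[1,e^{-j\pi\cos\phi},\dots,e^{-j\pi(n_t-1)\cos\phi}]^T$, and $\mathbf e_r(\psi)$ likewise with $n_r$. The parameter is $\boldsymbol\theta=(\phi_1,\dots,\phi_L,\psi_1,\dots,\psi_L,\alpha_1,\dots,\alpha_L)$ (AoDs, AoAs, path gains). With $\mathbf A=\mathbf F^T\otimes\mathbf G^\dagger$, $\mathbf K=\mathbf A^\dagger\mathbf A$ and $\mathbf m(\boldsymbol\theta)=\sum_l\alpha_l\mathbf A(\mathbf e_t^*(\phi_l)\otimes\mathbf e_r(\psi_l))$, the observation $\mathbf y\in\mathbb C^{p_tp_r}$ given $\boldsymbol\theta$ is proper complex Gaussian with mean $\mathbf m(\boldsymbol\theta)$ and covariance $\sigma_v^2\mathbf I$;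 $L(\mathbf y)=\ln p(\mathbf y|\boldsymbol\theta)$. A priori all parameters are independent, $\phi_l,\psi_l$ are uniform on $[0,\pi)$, and $\alpha_l>0$ is Rician with density $$p_l(a)=\tfrac{2(K_l+1)}{\Omega_l}\,a\,e^{-\frac{K_l+1}{\Omega_l}\left(a^2+\frac{\Omega_lK_l}{K_l+1}\right)}I_0\!\left(2a\sqrt{\tfrac{K_l(K_l+1)}{\Omega_l}}\right),\quad a>0 .$$ Put $\mathbf J_{\rm NR}(\theta_i,\theta_k)=-\mathbb E[\partial^2L/\partial\theta_i\partial\theta_k\,|\,\boldsymbol\theta]$, $\mathbf J_{\rm D}(\theta_i,\theta_k)=-\mathbb E[\partial^2L/\partial\theta_i\partial\theta_k]$ (joint law of $(\mathbf y,\boldsymbol\theta)$) and $\mathbf J_{\rm P}(\theta_i,\theta_k)=-\mathbb E[\partial^2\ln p(\boldsymbol\theta)/\partial\theta_i\partial\theta_k]$, the last expectation being taken in the extended reals. $J_\nu$ is the Bessel function of the first kind and $\sqrt{\cdot}$ the principal square root. **Claim.** (1) All expectations defining $\mathbf J_{\rm NR}$-averages and $\mathbf J_{\rm D}$ and the moments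 $\mathbb E[\alpha_l],\mathbb E[\alpha_l^2]$ exist, and $\mathbf J_{\rm D}=\mathbb E_{\boldsymbol\theta}[\mathbf J_{\rm NR}]$. It is symmetric, and for all $l$ and all $m\ne l$, with $c=1/\sigma_v^2$, $$\begin{aligned} \mathbf J_{\rm D}(\phi_l,\phi_l)&=2\pi^2c\,\mathbb E[\alpha_l^2]\,\mathrm{tr}[\mathbf K(\mathbf P\otimes\mathbf Q)], & \mathbf J_{\rm D}(\phi_l,\alpha_l)&=-2\pi c\,\mathbb E[\alpha_l]\,\mathrm{Im}\,\mathrm{tr}[\mathbf K(\mathbf P^{(2)}\otimes\mathbf Q)],\\ \mathbf J_{\rm D}(\phi_l,\psi_l)&=-2\pi^2c\,\mathbb E[\alpha_l^2]\,\mathrm{Re}\,\mathrm{tr}[\mathbf K(\mathbf P^{(3)}\otimes\mathbf Q^{(2)})], & \mathbf J_{\rm D}(\psi_l,\alpha_l)&=2\pi c\,\mathbb E[\alpha_l]\,\mathrm{Im}\,\mathrm{tr}[\mathbf K(\mathbf P^{(4)}\otimes\mathbf Q^{(2)})],\\ \mathbf J_{\rm D}(\phi_l,\alpha_m)&=-2\pi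 c\,\mathbb E[\alpha_l]\,\mathrm{Im}\,\mathrm{tr}[\mathbf K(\mathbf P^{(5)}\otimes\mathbf Q^{(3)})], & \mathbf J_{\rm D}(\psi_l,\alpha_m)&=2\pi c\,\mathbb E[\alpha_l]\,\mathrm{Im}\,\mathrm{tr}[\mathbf K(\mathbf P^{(6)}\otimes\mathbf Q^{(4)})],\\ \mathbf J_{\rm D}(\phi_l,\phi_m)&=2\pi^2c\,\mathbb E[\alpha_l]\mathbb E[\alpha_m]\,\mathrm{Re}\,\mathrm{tr}[\mathbf K(\mathbf P^{(7)}\otimes\mathbf Q^{(3)})], & \mathbf J_{\rm D}(\psi_l,\psi_m)&=2\pi^2c\,\mathbb E[\alpha_l]\mathbb E[\alpha_m]\,\mathrm{Re}\,\mathrm{tr}[\mathbf K(\mathbf P^{(8)}\otimes\mathbf Q^{(5)})],\\ \mathbf J_{\rm D}(\psi_l,\psi_l)&=2\pi^2c\,\mathbb E[\alpha_l^2]\,\mathrm{tr}[\mathbf K(\mathbf P^{(4)}\otimes\mathbf Q^{(6)})], & \mathbf J_{\rm D}(\phi_l,\psi_m)&=-2\pi^2c\,\mathbb E[\alpha_l]\mathbb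 E[\alpha_m]\,\mathrm{Re}\,\mathrm{tr}[\mathbf K(\mathbf P^{(9)}\otimes\mathbf Q^{(7)})],\\ \mathbf J_{\rm D}(\alpha_l,\alpha_l)&=2c\,\mathrm{tr}[\mathbf K(\mathbf P^{(4)}\otimes\mathbf Q)], & \mathbf J_{\rm D}(\alpha_l,\alpha_m)&=2c\,\mathrm{Re}\,\mathrm{tr}[\mathbf K(\mathbf P^{(6)}\otimes\mathbf Q^{(3)})]. \end{aligned}$$ Here, writing $S(k)=\frac1\pi\sqrt{2/k}\,J_{1/2}(\pi k)$ for integers $k\neq0$ and $\rho=r-1$, $\varsigma=s-1$ (a product with a factor $0\cdot S(0)$ is $0$), the $(r,s)$ entries are: $\mathbf P=\frac{\rho\varsigma}{2n_t}[J_0+J_2](-\pi(s-r))$; $\mathbf P^{(2)}=\frac{2\varsigma}{\pi n_t}$ if $r=s$ and $\frac{\varsigma}{n_t}S(-(s-r))$ otherwise; $\mathbf P^{(3)}=\frac{2\rho}{\pi n_t}$ if $r=s$ and $\frac{\rho}{n_t}S(-(s-r))$ otherwise; $\mathbf P^{(4)}=\frac1{n_t}J_0(\pi(r-s))$; $\mathbf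 P^{(5)}=\frac{\varsigma}{n_t}J_0(\pi\rho)S(-\varsigma)$; $\mathbf P^{(6)}=\mathbf P^{(8)}=\frac1{n_t}J_0(\pi\rho)J_0(-\pi\varsigma)$; $\mathbf P^{(7)}=\frac{\rho\varsigma}{n_t}S(\rho)S(-\varsigma)$; $\mathbf P^{(9)}=\frac{\rho}{n_t}J_0(-\pi\varsigma)S(\rho)$; $\mathbf Q=\frac1{n_r}J_0(\pi(s-r))$; $\mathbf Q^{(2)}=\frac{2\varsigma}{\pi n_r}$ if $r=s$ and $\frac{\varsigma}{n_r}S(-(r-s))$ otherwise; $\mathbf Q^{(3)}=\frac1{n_r}J_0(-\pi\rho)J_0(\pi\varsigma)$; $\mathbf Q^{(4)}=\mathbf Q^{(7)}=\frac{\varsigma}{n_r}J_0(-\pi\rho)S(\varsigma)$; $\mathbf Q^{(5)}=\frac{\rho\varsigma}{n_r}S(-\rho)S(\varsigma)$; $\mathbf Q^{(6)}=\frac{\rho\varsigma}{2n_r}[J_0+J_2](\pi(s-r))$. (2) All entries of $\mathbf J_{\rm P}$ vanish except possibly the $L$ entries $\mathbf J_{\rm P}(\alpha_l,\alpha_l)=-\mathbb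 E[D_l(\alpha_l)]\in(-\infty,+\infty]$, where almost surely, with $\kappa_l=\sqrt{K_l(K_l+1)/\Omega_l}$, $$\frac{\partial^2\ln p(\boldsymbol\theta)}{\partial\alpha_l^2}=D_l(\alpha_l)=-\frac1{\alpha_l^2}-\frac{2(K_l+1)}{\Omega_l}+\frac{2K_l(K_l+1)}{\Omega_l}\left[1-\frac{J_2(-2j\alpha_l\kappa_l)}{I_0(2\alpha_l\kappa_l)}+\frac{2J_1(-2j\alpha_l\kappa_l)^2}{I_0(2\alpha_l\kappa_l)^2}\right].$$ (3) Let $\mathbf J_{\rm B}=\mathbf J_{\rm D}+\mathbf J_{\rm P}$ be nonsingular. The Bayesian Cramér–Rao lower bound for unbiased estimators is $\mathrm{tr}(\mathbf J_{\rm B}^{-1})$: this number exists and is finite, and every measurable $\hat{\boldsymbol\theta}$ with $\mathbb E[\hat{\boldsymbol\theta}(\mathbf y)|\boldsymbol\theta]=\boldsymbol\theta$ for all $\boldsymbol\theta$ with $\phi_l,\psi_l\in[0,\pi)$, $\alpha_l>0$ satisfies $\mathbb E\|\hat{\boldsymbol\theta}(\mathbf y)-\boldsymbol\theta\|^2\ge\mathrm{tr}(\mathbf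 J_{\rm B}^{-1})$. (If an entry of $\mathbf J_{\rm P}$ is $+\infty$, then "nonsingular" and $\mathrm{tr}(\mathbf J_{\rm B}^{-1})$ refer to $\mathbf J_{\rm P}$ with its entries cut off at a level $t$, for all large $t$ and in the limit $t\to\infty$, respectively.) -/

import Mathlib

open MeasureTheory Filter Topology
open scoped Matrix Kronecker ENNReal

namespace MmWave

noncomputable section

/-! ### Bessel functions -/

/-- Bessel function of the first kind, of order `ν`, at the complex number `z` (principal branch). -/
def besselJ (ν z : ℂ) : ℂ :=
  (z / 2) ^ ν *
    ∑' k : ℕ, (-1 : ℂ) ^ k / ((k.factorial : ℂ) * Complex.Gamma (ν + k + 1)) * (z / 2) ^ (2 * k)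

/-- Modified Bessel function `I₀` on the real line. -/
def besselI0 (x : ℝ) : ℝ :=
  ∑' k : ℕ, (x / 2) ^ (2 * k) / ((k.factorial : ℝ) * (k.factorial : ℝ))

/-! ### Parameters -/

/-- The `3 L` scalar parameters: `L` angles of departure, `L` angles of arrival, `L` path gains. -/
abbrev Param (L : ℕ) : Type := Fin L ⊕ Fin L ⊕ Fin L

/-- Index of the angle of departure `φ_l`. -/
abbrev aod {L : ℕ} (l : Fin L) : Param L := Sum.inl l

/-- Index of the angle of arrival `ψ_l`. -/
abbrev aoa {L : ℕ} (l : Fin L) : Param L := Sum.inr (Sum.inl l)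

/-- Index of the path gain `α_l`. -/
abbrev gain {L : ℕ} (l : Fin L) : Param L := Sum.inr (Sum.inr l)

/-- The observation space `ℂ^(p_t p_r)`, indexed like `vec` of a `p_r × p_t` matrix. -/
abbrev Obs (pt pr : ℕ) : Type := Fin pt × Fin pr → ℂ

/-- Partial derivative of `f` with respect to the coordinate `i`. -/
def pderiv {ι : Type*} [DecidableEq ι] (i : ι) (f : (ι → ℝ) → ℝ) (θ : ι → ℝ) : ℝ :=
  deriv (fun t => f (Function.update θ i t)) (θ i)

/-- Second partial derivative `∂² f / ∂θ_i ∂θ_j`. -/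
def pderiv₂ {ι : Type*} [DecidableEq ι] (i j : ι) (f : (ι → ℝ) → ℝ) (θ : ι → ℝ) : ℝ :=
  pderiv i (pderiv j f) θ

/-! ### The observation model -/

/-- Beamsteering vector of a half-wavelength uniform linear array with `n` elements. -/
def steer (n : ℕ) (x : ℝ) : Fin n → ℂ := fun r =>
  (1 / (Real.sqrt n : ℂ)) * Complex.exp (-(Complex.I * Real.pi * (r : ℕ) * Real.cos x))

/-- The data of the model: pilot matrices, noise level, and for every path the Rice factor and
the second moment of the gain. -/
structure Model (L nt nr pt pr : ℕ) where
  /-- beamforming matrix -/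
  F : Matrix (Fin nt) (Fin pt) ℂ
  /-- beamcombining matrix -/
  G : Matrix (Fin nr) (Fin pr) ℂ
  /-- standard deviation of the noise -/
  σ : ℝ
  σ_pos : 0 < σ
  /-- Rice factors -/
  riceK : Fin L → ℝ
  riceK_nonneg : ∀ l, 0 ≤ riceK l
  /-- second moments of the gains -/
  Ω : Fin L → ℝ
  Ω_pos : ∀ l, 0 < Ω l

variable {L nt nr pt pr : ℕ}

namespace Model

/-- The channel matrix `H = ∑ α_l e_r(ψ_l) e_t(φ_l)†`. -/
def channel (_M : Model L nt nr pt pr) (θ : Param L → ℝ) : Matrix (Fin nr) (Fin nt) ℂ :=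
  ∑ l, (θ (gain l) : ℂ) •
    Matrix.vecMulVec (steer nr (θ (aoa l))) (star (steer nt (θ (aod l))))

/-- `A = Fᵀ ⊗ G†`. -/
def A (M : Model L nt nr pt pr) : Matrix (Fin pt × Fin pr) (Fin nt × Fin nr) ℂ :=
  M.Fᵀ ⊗ₖ M.Gᴴ

/-- `K = A† A`. -/
def K (M : Model L nt nr pt pr) : Matrix (Fin nt × Fin nr) (Fin nt × Fin nr) ℂ :=
  M.Aᴴ * M.A

/-- Mean of the observation: `m = ∑ α_l A (e_t*(φ_l) ⊗ e_r(ψ_l))`. -/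
def mean (M : Model L nt nr pt pr) (θ : Param L → ℝ) : Obs pt pr :=
  ∑ l, (θ (gain l) : ℂ) •
    (M.A *ᵥ fun rs => star (steer nt (θ (aod l)) rs.1) * steer nr (θ (aoa l)) rs.2)

/-- The mean is the vectorized noiseless observation `G† H F`. -/
theorem mean_eq_vec (M : Model L nt nr pt pr) (θ : Param L → ℝ) :
    M.mean θ = Matrix.vec (M.Gᴴ * M.channel θ * M.F) := by
  have h : ∀ l : Fin L,
      (fun rs : Fin nt × Fin nr =>
        star (steer nt (θ (aod l)) rs.1) * steer nr (θ (aoa l)) rs.2)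
      = Matrix.vec (Matrix.vecMulVec (steer nr (θ (aoa l))) (star (steer nt (θ (aod l))))) := by
    intro l
    funext rs
    simp [Matrix.vec, Matrix.vecMulVec_apply, mul_comm]
  unfold mean channel A
  simp only [h, Matrix.kronecker_mulVec_vec, Matrix.transpose_transpose]
  rw [Matrix.mul_sum, Matrix.sum_mul]
  funext rs
  simp [Matrix.vec, Matrix.sum_apply, Finset.sum_apply]

/-- Density `p(y | θ)` of a proper complex Gaussian vector with mean `m(θ)` and covariance `σ² I`. -/
def likelihood (M : Model L nt nr pt pr) (θ : Param L → ℝ) (y : Obs pt pr) : ℝ :=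
  1 / (Real.pi * M.σ ^ 2) ^ (pr * pt) *
    Real.exp (-(1 / M.σ ^ 2) * ∑ q, ‖y q - M.mean θ q‖ ^ 2)

/-- The log-likelihood. -/
def logLik (M : Model L nt nr pt pr) (y : Obs pt pr) (θ : Param L → ℝ) : ℝ :=
  Real.log (M.likelihood θ y)

/-- The conditional law of the observation given `θ`. -/
def obsLaw (M : Model L nt nr pt pr) (θ : Param L → ℝ) : Measure (Obs pt pr) :=
  (volume : Measure (Obs pt pr)).withDensity fun y => ENNReal.ofReal (M.likelihood θ y)

/-! ### The prior -/

end Model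

/-- Density of the uniform distribution on `[0, π)`. -/
def uniformPdf (x : ℝ) : ℝ := (Set.Ico 0 Real.pi).indicator (fun _ => 1 / Real.pi) x

/-- Density of the Rician distribution with Rice factor `K` and second moment `Ω`. -/
def ricePdf (K Ω a : ℝ) : ℝ :=
  (Set.Ioi 0).indicator (fun a => 2 * (K + 1) / Ω * a *
    Real.exp (-((K + 1) / Ω) * (a ^ 2 + Ω * K / (K + 1))) *
    besselI0 (2 * a * Real.sqrt (K * (K + 1) / Ω))) a

/-- The Rician distribution. -/
def riceLaw (K Ω : ℝ) : Measure ℝ :=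
  (volume : Measure ℝ).withDensity fun a => ENNReal.ofReal (ricePdf K Ω a)

/-- The closed form of the second derivative of the logarithm of the Rician density. -/
def riceLogDeriv₂ (K Ω a : ℝ) : ℂ :=
  -1 / (a : ℂ) ^ 2 - 2 * (K + 1) / Ω + 2 * K * (K + 1) / Ω *
    (1 + -besselJ 2 (-2 * Complex.I * a * Real.sqrt (K * (K + 1) / Ω)) /
            (besselI0 (2 * a * Real.sqrt (K * (K + 1) / Ω)) : ℂ)
       + 2 * besselJ 1 (-2 * Complex.I * a * Real.sqrt (K * (K + 1) / Ω)) ^ 2 /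
            (besselI0 (2 * a * Real.sqrt (K * (K + 1) / Ω)) : ℂ) ^ 2)

/-- Expectation of a real function in `[-∞, +∞]`: expectation of the positive part minus
expectation of the negative part (meaningful as soon as one of them is finite). -/
def extExpectation {X : Type*} [MeasurableSpace X] (μ : Measure X) (f : X → ℝ) : EReal :=
  ((∫⁻ x, ENNReal.ofReal (f x) ∂μ : ℝ≥0∞) : EReal)
    - ((∫⁻ x, ENNReal.ofReal (-f x) ∂μ : ℝ≥0∞) : EReal)

namespace Model

/-- The prior density `p(θ)`: all parameters independent, angles uniform on `[0, π)`,
gains Rician. -/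
def priorPdf (M : Model L nt nr pt pr) (θ : Param L → ℝ) : ℝ :=
  ∏ l, uniformPdf (θ (aod l)) * uniformPdf (θ (aoa l)) *
    ricePdf (M.riceK l) (M.Ω l) (θ (gain l))

/-- The prior law of `θ`. -/
def prior (M : Model L nt nr pt pr) : Measure (Param L → ℝ) :=
  (volume : Measure (Param L → ℝ)).withDensity fun θ => ENNReal.ofReal (M.priorPdf θ)

/-- The joint law of `(θ, y)`, with density `p(θ) p(y | θ)`. -/
def joint (M : Model L nt nr pt pr) : Measure ((Param L → ℝ) × Obs pt pr) :=
  (volume : Measure ((Param L → ℝ) × Obs pt pr)).withDensity fun x =>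
    ENNReal.ofReal (M.priorPdf x.1 * M.likelihood x.1 x.2)

/-! ### Fisher information matrices -/

/-- Non-random Fisher information matrix: `-E[∂² L(y) / ∂θ_i ∂θ_j]` under `p(y | θ)`. -/
def fimNR (M : Model L nt nr pt pr) (θ : Param L → ℝ) : Matrix (Param L) (Param L) ℝ :=
  Matrix.of fun i j => -∫ y, pderiv₂ i j (M.logLik y) θ ∂(M.obsLaw θ)

/-- Data part of the Bayesian Fisher information matrix: `-E[∂² L(y) / ∂θ_i ∂θ_j]` under the joint
law of `(θ, y)`. -/
def fimD (M : Model L nt nr pt pr) : Matrix (Param L) (Param L) ℝ :=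
  Matrix.of fun i j => -∫ x, pderiv₂ i j (M.logLik x.2) x.1 ∂M.joint

/-- Prior part of the Bayesian Fisher information matrix: `-E[∂² ln p(θ) / ∂θ_i ∂θ_j]` under the
prior, an extended real number. -/
def fimP (M : Model L nt nr pt pr) : Matrix (Param L) (Param L) EReal :=
  Matrix.of fun i j =>
    extExpectation M.prior fun θ => -pderiv₂ i j (fun η => Real.log (M.priorPdf η)) θ

/-- The moment `E[α_l ^ k]`. -/
def gainMoment (M : Model L nt nr pt pr) (k : ℕ) (l : Fin L) : ℝ :=
  ∫ θ, θ (gain l) ^ k ∂M.prior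

end Model

/-! ### The Bayesian Cramér-Rao bound -/

/-- `JD + JP` with the entries of `JP` cut off at the level `t`. If the entries of `JP` are
finite this is `JD + JP` for all large `t`. -/
def cappedSum {ι : Type*} (JD : Matrix ι ι ℝ) (JP : Matrix ι ι EReal) (t : ℝ) : Matrix ι ι ℝ :=
  JD + JP.map fun x => (min x (t : EReal)).toReal

/-- The matrix `JB = JD + JP` is nonsingular. -/
def IsNonsingularSum {ι : Type*} [Fintype ι] [DecidableEq ι] (JD : Matrix ι ι ℝ)
    (JP : Matrix ι ι EReal) : Prop :=
  ∀ᶠ t : ℝ in atTop, IsUnit (cappedSum JD JP t).det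

/-- `c = tr (JB⁻¹)` for `JB = JD + JP`, where infinite entries of `JP` are approached through
finite cut-offs. -/
def IsTraceInvSum {ι : Type*} [Fintype ι] [DecidableEq ι] (JD : Matrix ι ι ℝ)
    (JP : Matrix ι ι EReal) (c : ℝ) : Prop :=
  Tendsto (fun t : ℝ => ((cappedSum JD JP t)⁻¹).trace) atTop (𝓝 c)

/-- For a matrix `JP` with finite entries, cutting off has no effect in the end. -/
theorem cappedSum_eventually_eq {ι : Type*} [Fintype ι] (JD JP : Matrix ι ι ℝ) :
    ∀ᶠ t : ℝ in atTop, cappedSum JD (JP.map fun x => (x : EReal)) t = JD + JP := by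
  have h : ∀ᶠ t : ℝ in atTop, ∀ i j, JP i j ≤ t := by
    rw [eventually_all]; intro i
    rw [eventually_all]; intro j
    exact eventually_ge_atTop _
  filter_upwards [h] with t ht
  ext i j
  simp [cappedSum, min_eq_left (EReal.coe_le_coe_iff.2 (ht i j))]

/-- For a matrix `JP` with finite entries, nonsingularity is the usual one. -/
theorem isNonsingularSum_coe_iff {ι : Type*} [Fintype ι] [DecidableEq ι]
    (JD JP : Matrix ι ι ℝ) :
    IsNonsingularSum JD (JP.map fun x => (x : EReal)) ↔ IsUnit (JD + JP).det := by
  unfold IsNonsingularSum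
  have h := cappedSum_eventually_eq JD JP
  rw [eventually_congr (h.mono fun t ht => by rw [ht])]
  exact eventually_const

/-- For a matrix `JP` with finite entries, `IsTraceInvSum` is the usual `tr ((JD + JP)⁻¹)`. -/
theorem isTraceInvSum_coe_iff {ι : Type*} [Fintype ι] [DecidableEq ι]
    (JD JP : Matrix ι ι ℝ) (c : ℝ) :
    IsTraceInvSum JD (JP.map fun x => (x : EReal)) c ↔ c = ((JD + JP)⁻¹).trace := by
  unfold IsTraceInvSum
  have h := cappedSum_eventually_eq JD JP
  rw [tendsto_congr' (h.mono fun t ht => by rw [ht]), tendsto_const_nhds_iff, eq_comm]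

namespace Model

/-- The set of admissible parameter values: angles in `[0, π)`, positive gains. -/
def paramSet (L : ℕ) : Set (Param L → ℝ) :=
  {θ | ∀ l, θ (aod l) ∈ Set.Ico 0 Real.pi ∧ θ (aoa l) ∈ Set.Ico 0 Real.pi ∧ 0 < θ (gain l)}

/-- `est` is an unbiased estimator of `θ`. -/
def IsUnbiased (M : Model L nt nr pt pr) (est : Obs pt pr → Param L → ℝ) : Prop :=
  Measurable est ∧ ∀ θ ∈ paramSet L, ∀ i,
    Integrable (fun y => est y i) (M.obsLaw θ) ∧ ∫ y, est y i ∂(M.obsLaw θ) = θ i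

/-- Bayesian mean square error of an estimator. -/
def mse (M : Model L nt nr pt pr) (est : Obs pt pr → Param L → ℝ) : ℝ≥0∞ :=
  ∫⁻ x, ENNReal.ofReal (∑ i, (est x.2 i - x.1 i) ^ 2) ∂M.joint

end Model

/-! ### The averaged matrices

Indices start at `0`, so that `r`, `s` below stand for `r - 1`, `s - 1` in the usual numbering from
`1`. The entries are
written with Bessel functions at multiples of `π`. -/

/-- `(1/π) √(2/z) J_{1/2}(π z)`, the closed form of `(1/π) ∫₀^π e^{jπ z cos x} sin x dx` for `z > 0`
and for nonzero integers `z`. -/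
def sinMean (z : ℂ) : ℂ :=
  1 / (Real.pi : ℂ) * (2 / z) ^ (1 / 2 : ℂ) * besselJ (1 / 2) (Real.pi * z)

def P₁ (n : ℕ) : Matrix (Fin n) (Fin n) ℂ := Matrix.of fun r s =>
  ((r : ℕ) : ℂ) * (s : ℕ) / (2 * n) *
    (besselJ 0 (-(Real.pi : ℂ) * ((s : ℕ) - (r : ℕ)))
      + besselJ 2 (-(Real.pi : ℂ) * ((s : ℕ) - (r : ℕ))))

def P₂ (n : ℕ) : Matrix (Fin n) (Fin n) ℂ := Matrix.of fun r s =>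
  if r = s then 2 * ((s : ℕ) : ℂ) / (Real.pi * n)
  else ((s : ℕ) : ℂ) / n * sinMean (-(((s : ℕ) : ℂ) - (r : ℕ)))

def P₃ (n : ℕ) : Matrix (Fin n) (Fin n) ℂ := Matrix.of fun r s =>
  if r = s then 2 * ((r : ℕ) : ℂ) / (Real.pi * n)
  else ((r : ℕ) : ℂ) / n * sinMean (-(((s : ℕ) : ℂ) - (r : ℕ)))

def P₄ (n : ℕ) : Matrix (Fin n) (Fin n) ℂ := Matrix.of fun r s =>
  besselJ 0 ((Real.pi : ℂ) * ((r : ℕ) - (s : ℕ))) / n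

def P₅ (n : ℕ) : Matrix (Fin n) (Fin n) ℂ := Matrix.of fun r s =>
  ((s : ℕ) : ℂ) / n * besselJ 0 ((r : ℕ) * (Real.pi : ℂ)) * sinMean (-((s : ℕ) : ℂ))

def P₆ (n : ℕ) : Matrix (Fin n) (Fin n) ℂ := Matrix.of fun r s =>
  1 / (n : ℂ) * besselJ 0 ((r : ℕ) * (Real.pi : ℂ)) * besselJ 0 (-((s : ℕ) * (Real.pi : ℂ)))

def P₇ (n : ℕ) : Matrix (Fin n) (Fin n) ℂ := Matrix.of fun r s =>
  ((r : ℕ) : ℂ) * (s : ℕ) / n * sinMean ((r : ℕ) : ℂ) * sinMean (-((s : ℕ) : ℂ))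

def P₈ (n : ℕ) : Matrix (Fin n) (Fin n) ℂ := Matrix.of fun r s =>
  1 / (n : ℂ) * besselJ 0 ((Real.pi : ℂ) * (r : ℕ)) * besselJ 0 (-((Real.pi : ℂ) * (s : ℕ)))

def P₉ (n : ℕ) : Matrix (Fin n) (Fin n) ℂ := Matrix.of fun r s =>
  ((r : ℕ) : ℂ) / n * besselJ 0 (-((Real.pi : ℂ) * (s : ℕ))) * sinMean ((r : ℕ) : ℂ)

def Q₁ (n : ℕ) : Matrix (Fin n) (Fin n) ℂ := Matrix.of fun r s =>
  1 / (n : ℂ) * besselJ 0 ((Real.pi : ℂ) * ((s : ℕ) - (r : ℕ)))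

def Q₂ (n : ℕ) : Matrix (Fin n) (Fin n) ℂ := Matrix.of fun r s =>
  if r = s then 2 * ((s : ℕ) : ℂ) / (Real.pi * n)
  else ((s : ℕ) : ℂ) / n * sinMean (-(((r : ℕ) : ℂ) - (s : ℕ)))

def Q₃ (n : ℕ) : Matrix (Fin n) (Fin n) ℂ := Matrix.of fun r s =>
  1 / (n : ℂ) * besselJ 0 (-((r : ℕ) * (Real.pi : ℂ))) * besselJ 0 ((s : ℕ) * (Real.pi : ℂ))

def Q₄ (n : ℕ) : Matrix (Fin n) (Fin n) ℂ := Matrix.of fun r s =>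
  ((s : ℕ) : ℂ) / n * besselJ 0 (-((r : ℕ) * (Real.pi : ℂ))) * sinMean ((s : ℕ) : ℂ)

def Q₅ (n : ℕ) : Matrix (Fin n) (Fin n) ℂ := Matrix.of fun r s =>
  ((r : ℕ) : ℂ) * (s : ℕ) / n * sinMean (-((r : ℕ) : ℂ)) * sinMean ((s : ℕ) : ℂ)

def Q₆ (n : ℕ) : Matrix (Fin n) (Fin n) ℂ := Matrix.of fun r s =>
  ((r : ℕ) : ℂ) * (s : ℕ) / (2 * n) *
    (besselJ 0 ((Real.pi : ℂ) * ((s : ℕ) - (r : ℕ)))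
      + besselJ 2 ((Real.pi : ℂ) * ((s : ℕ) - (r : ℕ))))

def Q₇ (n : ℕ) : Matrix (Fin n) (Fin n) ℂ := Matrix.of fun r s =>
  ((s : ℕ) : ℂ) / n * besselJ 0 (-((Real.pi : ℂ) * (r : ℕ))) * sinMean ((s : ℕ) : ℂ)

/-- `tr [K (P ⊗ Q)]`. -/
def Model.trK (M : Model L nt nr pt pr) (P : Matrix (Fin nt) (Fin nt) ℂ)
    (Q : Matrix (Fin nr) (Fin nr) ℂ) : ℂ :=
  (M.K * (P ⊗ₖ Q)).trace

end

end MmWave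

namespace MmWave

noncomputable section

/-! ### Bessel functions of integer order -/

/-! Data part. Given `θ`, the observation is a deterministic mean plus centred Gaussian noise. The
second derivative of the log-likelihood is therefore a term linear in the noise minus a multiple of
Re⟨∂ᵢm, ∂ⱼm⟩, and the linear term averages to zero (`fimNR_eq`). The mean is `A` applied to a sum
over paths of products of functions of one parameter each, and the prior is a product measure
(`prior_eq_pi`), so prior averages of products of path derivatives factor into one-dimensional
integrals (`integral_star_pathTerm_mul`).

Within one path these integrals are gain moments and averages of e^{jπk cos φ}, k an integer,
against 1, sin φ and sin² φ. They give J₀, an elementary integral, and J₀ + J₂. For two different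
paths the average splits into first moments (`crossMoment_of_owner_ne`). That of an angular
derivative is zero, because e^{jπk cos φ} takes the same value at 0 and π. The stated formulas agree
with this because J_{1/2} vanishes at nonzero integer multiples of π (`besselJ_half_int_mul_pi`),
which kills every term containing S.

Prior part. The log-prior is a sum of functions of one variable, and the uniform summands are
locally constant. The Rician summand has second derivative at most -1/a² plus a constant, while the
density is of order a at 0. Hence every gain entry is +∞ (`fimP_gain_eq_top`).

Bound. The cut-off matrix is J_D + tE with E the projection to the gains. Its inverse tends to some
Z with ZᵀJ_D Z = Zᵀ, namely the inverse of the angular block padded by zeros. For every fixed vector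
u, `conditional_cramerRao` bounds the conditional error of coordinate k below by 2uₖ - uᵀJ_NR(θ)u.
This is linear in J_NR, so it can be averaged over θ (`le_mse`), and the columns of Z as choices of
u give Σ(2Zₖₖ - Zₖₖ) = tr Z. The conditional inequality is a limit of Chapman-Robbins inequalities,
so the estimator needs no regularity. -/

/-- The entire series `∑ wᵏ / (k! (n + k)!)`, from which all Bessel functions of integer order
are obtained. -/
def besselSeries (n : ℕ) (w : ℝ) : ℝ :=
  ∑' k : ℕ, w ^ k / ((k.factorial : ℝ) * ((n + k).factorial : ℝ))

theorem summable_besselSeries (n : ℕ) (w : ℝ) :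
    Summable fun k : ℕ => w ^ k / ((k.factorial : ℝ) * ((n + k).factorial : ℝ)) := by
  refine Summable.of_norm_bounded (Real.summable_pow_div_factorial |w|) fun k => ?_
  have h1 : (0 : ℝ) < k.factorial := by positivity
  have h2 : (1 : ℝ) ≤ (n + k).factorial := by exact_mod_cast Nat.succ_le_of_lt (Nat.factorial_pos _)
  rw [norm_div, norm_pow, Real.norm_eq_abs, Real.norm_of_nonneg (by positivity)]
  gcongr
  nlinarith

/-- Termwise differentiation cancels one factor of k! and shifts the index, which raises the order
by one. It is justified on a ball around 0 containing `w`, where the differentiated exponential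
series dominates. -/
theorem hasDerivAt_besselSeries (n : ℕ) (w : ℝ) :
    HasDerivAt (besselSeries n) (besselSeries (n + 1) w) w := by
  set R : ℝ := |w| + 1
  have hR : 0 ≤ R := by positivity
  have hu : Summable fun k : ℕ => (k : ℝ) * R ^ (k - 1) / (k.factorial : ℝ) := by
    rw [← summable_nat_add_iff 1]
    refine (Real.summable_pow_div_factorial R).congr fun k => ?_
    rw [Nat.factorial_succ]
    push_cast
    field_simp
  have key := hasDerivAt_tsum_of_isPreconnected (𝕜 := ℝ) (u := fun k : ℕ =>
      (k : ℝ) * R ^ (k - 1) / (k.factorial : ℝ))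
    (g := fun k (w : ℝ) => w ^ k / ((k.factorial : ℝ) * ((n + k).factorial : ℝ)))
    (g' := fun k (w : ℝ) => (k * w ^ (k - 1)) / ((k.factorial : ℝ) * ((n + k).factorial : ℝ)))
    (t := Metric.ball 0 R) hu Metric.isOpen_ball
    (convex_ball (0 : ℝ) R).isPreconnected
    (fun k y _ => (hasDerivAt_pow k y).div_const _)
    (fun k y hy => by
      have hy' : |y| ≤ R := by simpa using (mem_ball_zero_iff.1 hy).le
      have h1 : (0 : ℝ) < k.factorial := by positivity
      have h2 : (1 : ℝ) ≤ (n + k).factorial := by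
        exact_mod_cast Nat.succ_le_of_lt (Nat.factorial_pos _)
      rw [norm_div, norm_mul, norm_pow, Real.norm_eq_abs y, Real.norm_of_nonneg (by positivity),
        Real.norm_of_nonneg (by positivity)]
      gcongr
      nlinarith)
    (y₀ := 0) (by simp; positivity) (summable_besselSeries n 0)
    (y := w) (by simp [R])
  have hs : Summable fun k : ℕ =>
      (k * w ^ (k - 1)) / ((k.factorial : ℝ) * ((n + k).factorial : ℝ)) := by
    rw [← summable_nat_add_iff 1]
    refine (summable_besselSeries (n + 1) w).congr fun k => ?_
    rw [Nat.factorial_succ, show n + 1 + k = n + (k + 1) by ring]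
    push_cast
    field_simp
  have he : besselSeries (n + 1) w = ∑' k : ℕ,
      (k * w ^ (k - 1)) / ((k.factorial : ℝ) * ((n + k).factorial : ℝ)) := by
    rw [hs.tsum_eq_zero_add]
    simp only [Nat.cast_zero, zero_mul, zero_div, zero_add]
    refine tsum_congr fun k => ?_
    rw [Nat.factorial_succ, show n + 1 + k = n + (k + 1) by ring]
    push_cast
    field_simp
  rw [he]
  exact key

theorem continuous_besselSeries (n : ℕ) : Continuous (besselSeries n) :=
  continuous_iff_continuousAt.2 fun w => (hasDerivAt_besselSeries n w).continuousAt

/-- Compare coefficients: 1/(n+k)! = ((n+1) + k)/(n+1+k)!, where the part with k is the shifted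
series of order n+2. The case n = 0 serves twice, for J₀ + J₂ and for the Rician log-density. -/
theorem besselSeries_recurrence (n : ℕ) (w : ℝ) :
    besselSeries n w = (n + 1) * besselSeries (n + 1) w + w * besselSeries (n + 2) w := by
  have h2 := (summable_besselSeries (n + 2) w).mul_left w
  have h1 := (summable_besselSeries (n + 1) w).mul_left (n + 1 : ℝ)
  unfold besselSeries
  rw [← tsum_mul_left, ← tsum_mul_left]
  have h3 : Summable fun k : ℕ => (k : ℝ) * w ^ k /
      ((k.factorial : ℝ) * ((n + 1 + k).factorial : ℝ)) := by
    rw [← summable_nat_add_iff 1]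
    refine h2.congr fun k => ?_
    rw [Nat.factorial_succ k, show n + 1 + (k + 1) = n + 2 + k by ring]
    push_cast
    field_simp
    ring
  have h4 : ∑' k : ℕ, w * (w ^ k / ((k.factorial : ℝ) * ((n + 2 + k).factorial : ℝ))) =
      ∑' k : ℕ, (k : ℝ) * w ^ k / ((k.factorial : ℝ) * ((n + 1 + k).factorial : ℝ)) := by
    rw [h3.tsum_eq_zero_add]
    simp only [Nat.cast_zero, zero_mul, zero_div, zero_add]
    refine tsum_congr fun k => ?_
    rw [Nat.factorial_succ k, show n + 1 + (k + 1) = n + 2 + k by ring]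
    push_cast
    field_simp
    ring
  rw [h4, ← h1.tsum_add h3]
  refine tsum_congr fun k => ?_
  rw [show n + 1 + k = (n + k) + 1 by ring, Nat.factorial_succ (n + k)]
  push_cast
  field_simp
  ring

theorem besselSeries_nonneg (n : ℕ) {w : ℝ} (hw : 0 ≤ w) : 0 ≤ besselSeries n w :=
  tsum_nonneg fun k => by positivity

theorem one_le_besselSeries_zero {w : ℝ} (hw : 0 ≤ w) : 1 ≤ besselSeries 0 w := by
  have := (summable_besselSeries 0 w).le_tsum 0 (fun k _ => by positivity)
  simpa [besselSeries] using this

theorem besselI0_eq (x : ℝ) : besselI0 x = besselSeries 0 ((x / 2) ^ 2) := by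
  simp [besselI0, besselSeries, pow_mul]

/-- The sign (-1)ᵏ is absorbed into the argument of the series. Asking only that `-(z/2)²` be real
covers real `z` (the angular averages) and purely imaginary `z` (the Rician curvature). -/
theorem besselJ_natCast (n : ℕ) {z : ℂ} {w : ℝ} (h : -(z / 2) ^ 2 = w) :
    besselJ n z = (z / 2) ^ n * (besselSeries n w : ℂ) := by
  unfold besselJ besselSeries
  rw [Complex.cpow_natCast, Complex.ofReal_tsum]
  congr 1
  refine tsum_congr fun k => ?_
  have : ((n : ℂ) + k + 1) = ((n + k : ℕ) : ℂ) + 1 := by push_cast; ring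
  rw [this, Complex.Gamma_nat_eq_factorial]
  push_cast
  rw [← h, neg_pow ((z / 2) ^ 2), pow_mul]
  ring

theorem besselJ_zero_ofReal (x : ℝ) :
    besselJ 0 (x : ℂ) = (besselSeries 0 (-(x / 2) ^ 2) : ℂ) := by
  have := besselJ_natCast 0 (z := (x : ℂ)) (w := -(x / 2) ^ 2) (by push_cast; ring)
  simpa using this

theorem besselJ_zero_add_two_ofReal (x : ℝ) :
    besselJ 0 (x : ℂ) + besselJ 2 (x : ℂ) = (besselSeries 1 (-(x / 2) ^ 2) : ℂ) := by
  have h := besselJ_natCast 2 (z := (x : ℂ)) (w := -(x / 2) ^ 2) (by push_cast; ring)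
  rw [besselJ_zero_ofReal, show (2 : ℂ) = ((2 : ℕ) : ℂ) by norm_num, h,
    besselSeries_recurrence 0]
  push_cast
  ring

/-! ### The function `J_{1/2}` at integer multiples of `π` -/

/-- The duplication formula turns k! Γ(k + 3/2) into a multiple of (2k+1)!, so the series is 2 sin x
/(x √π), which is zero at x = πm. The power in front of it plays no role. -/
theorem besselJ_half_int_mul_pi {m : ℤ} (hm : m ≠ 0) :
    besselJ (1 / 2) (Real.pi * (m : ℂ)) = 0 := by
  unfold besselJ
  refine mul_eq_zero_of_right _ ?_
  set x : ℂ := Real.pi * (m : ℂ)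
  have hx : x ≠ 0 := mul_ne_zero (by exact_mod_cast Real.pi_ne_zero) (by exact_mod_cast hm)
  have hsin : Complex.sin x = 0 := by
    rw [show x = (m : ℂ) * Real.pi from mul_comm _ _]
    exact Complex.sin_int_mul_pi m
  have hpi : ((Real.sqrt Real.pi : ℝ) : ℂ) ≠ 0 := by
    exact_mod_cast (Real.sqrt_pos.2 Real.pi_pos).ne'
  have hterm : ∀ k : ℕ, (-1 : ℂ) ^ k / ((k.factorial : ℂ) * Complex.Gamma (1 / 2 + k + 1)) *
      (x / 2) ^ (2 * k) =
      2 / (x * (Real.sqrt Real.pi : ℝ)) * ((-1) ^ k * x ^ (2 * k + 1) / (2 * k + 1).factorial) := by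
    intro k
    have hG := Complex.Gamma_mul_Gamma_add_half ((k : ℂ) + 1)
    rw [Complex.Gamma_nat_eq_factorial, show 2 * ((k : ℂ) + 1) = ((2 * k + 1 : ℕ) : ℂ) + 1 by
      push_cast; ring, Complex.Gamma_nat_eq_factorial,
      show (1 : ℂ) - (((2 * k + 1 : ℕ) : ℂ) + 1) = ((-(2 * k + 1 : ℕ) : ℤ) : ℂ) by push_cast; ring,
      Complex.cpow_intCast, zpow_neg, zpow_natCast] at hG
    rw [show (1 / 2 + (k : ℂ) + 1) = k + 1 + 1 / 2 by ring, hG]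
    have h3 : (((2 * k + 1).factorial : ℕ) : ℂ) ≠ 0 := by exact_mod_cast (Nat.factorial_pos _).ne'
    rw [div_pow]
    field_simp
    ring
  simp_rw [hterm]
  rw [tsum_mul_left, (Complex.hasSum_sin x).tsum_eq, hsin, mul_zero]

theorem sinMean_intCast (m : ℤ) : sinMean (m : ℂ) = 0 := by
  by_cases hm : m = 0
  -- At 0 the value is zero by the conventions for division and for powers of 0. The averaged
  -- matrices use this value only with a factor 0.
  · simp [sinMean, hm, besselJ]
  · rw [sinMean, besselJ_half_int_mul_pi hm, mul_zero]

/-! ### Averages over an angle -/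

theorem integral_cos_pow_odd (k : ℕ) : ∫ x in (0 : ℝ)..Real.pi, Real.cos x ^ (2 * k + 1) = 0 := by
  induction k with
  | zero => simp
  | succ k ih =>
    rw [show 2 * (k + 1) + 1 = (2 * k + 1) + 2 by ring, integral_cos_pow, ih]
    simp

theorem integral_cos_pow_even (k : ℕ) : ∫ x in (0 : ℝ)..Real.pi, Real.cos x ^ (2 * k) =
    Real.pi * ((2 * k).factorial / (4 ^ k * (k.factorial : ℝ) ^ 2)) := by
  induction k with
  | zero => simp
  | succ k ih =>
    rw [show 2 * (k + 1) = 2 * k + 2 by ring, integral_cos_pow, ih]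
    simp only [Nat.factorial_succ, Real.sin_pi, Real.sin_zero]
    push_cast
    field_simp
    ring

/-- Expand the exponential and integrate termwise; the terms are dominated by C|x|ⁿ/n! with C a
bound of the weight. The weights needed are 1 and sin². -/
theorem hasSum_integral_mul_exp_cos (h : ℝ → ℝ) (hh : Continuous h) (x : ℝ) :
    HasSum (fun n : ℕ => ((∫ φ in (0 : ℝ)..Real.pi, h φ * Real.cos φ ^ n : ℝ) : ℂ) *
        ((x * Complex.I) ^ n / n.factorial))
      (∫ φ in (0 : ℝ)..Real.pi, (h φ : ℂ) * Complex.exp (Complex.I * x * Real.cos φ)) := by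
  obtain ⟨C, hC⟩ := (isCompact_uIcc (a := (0 : ℝ)) (b := Real.pi)).exists_bound_of_continuousOn
    hh.continuousOn
  have hC0 : 0 ≤ C := (norm_nonneg _).trans (hC 0 Set.left_mem_uIcc)
  have hmeas : ∀ n : ℕ, AEStronglyMeasurable
      (fun φ : ℝ => (h φ : ℂ) * ((Complex.I * x * Real.cos φ) ^ n / (n.factorial : ℂ)))
      (volume.restrict (Set.uIoc 0 Real.pi)) := fun n =>
    Continuous.aestronglyMeasurable (by fun_prop)
  have hbound : ∀ n : ℕ, ∀ φ ∈ Set.uIoc 0 Real.pi,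
      ‖(h φ : ℂ) * ((Complex.I * x * Real.cos φ) ^ n / (n.factorial : ℂ))‖ ≤
        C * (|x| ^ n / n.factorial) := by
    intro n φ hφ
    have h1 := hC φ (Set.uIoc_subset_uIcc hφ)
    have h2 : |Real.cos φ| ≤ 1 := Real.abs_cos_le_one φ
    rw [norm_mul, norm_div, norm_pow, norm_mul, norm_mul, Complex.norm_I, Complex.norm_real,
      Complex.norm_real, Complex.norm_real, one_mul, Complex.norm_natCast, Real.norm_eq_abs x,
      Real.norm_eq_abs (Real.cos φ)]
    refine mul_le_mul h1 ?_ (by positivity) hC0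
    gcongr
    exact mul_le_of_le_one_right (abs_nonneg x) h2
  have hlim : ∀ φ : ℝ, HasSum
      (fun n : ℕ => (h φ : ℂ) * ((Complex.I * x * Real.cos φ) ^ n / (n.factorial : ℂ)))
      ((h φ : ℂ) * Complex.exp (Complex.I * x * Real.cos φ)) := by
    intro φ
    rw [Complex.exp_eq_exp_ℂ]
    exact (NormedSpace.expSeries_div_hasSum_exp (Complex.I * x * Real.cos φ)).mul_left _
  have hsum : Summable fun n : ℕ => C * (|x| ^ n / n.factorial) :=
    (Real.summable_pow_div_factorial |x|).mul_left C
  have key : HasSum (fun n : ℕ => ∫ φ in (0 : ℝ)..Real.pi,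
      (h φ : ℂ) * ((Complex.I * x * Real.cos φ) ^ n / (n.factorial : ℂ)))
      (∫ φ in (0 : ℝ)..Real.pi, (h φ : ℂ) * Complex.exp (Complex.I * x * Real.cos φ)) :=
    intervalIntegral.hasSum_integral_of_dominated_convergence
      (bound := fun (n : ℕ) (_ : ℝ) => C * (|x| ^ n / n.factorial)) hmeas
      (fun n => Eventually.of_forall (hbound n))
      (Eventually.of_forall fun _ _ => hsum)
      intervalIntegrable_const
      (Eventually.of_forall fun φ _ => hlim φ)
  have he : ∀ n : ℕ, ((∫ φ in (0 : ℝ)..Real.pi, h φ * Real.cos φ ^ n : ℝ) : ℂ) *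
      ((x * Complex.I) ^ n / n.factorial) = ∫ φ in (0 : ℝ)..Real.pi,
      (h φ : ℂ) * ((Complex.I * x * Real.cos φ) ^ n / (n.factorial : ℂ)) := by
    intro n
    rw [← intervalIntegral.integral_ofReal, ← intervalIntegral.integral_mul_const]
    congr 1
    ext φ
    push_cast
    ring
  simp_rw [he]
  exact key

theorem integral_exp_cos (x : ℝ) :
    ∫ φ in (0 : ℝ)..Real.pi, Complex.exp (Complex.I * x * Real.cos φ) =
      Real.pi * (besselSeries 0 (-(x / 2) ^ 2) : ℂ) := by
  have h := hasSum_integral_mul_exp_cos (fun _ => 1) continuous_const x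
  simp only [one_mul, Complex.ofReal_one] at h
  -- Odd moments of the cosine vanish, so only the indices 2k remain.
  have h2 := (Function.Injective.hasSum_iff (g := fun k : ℕ => 2 * k)
    (fun a b hab => by simpa using hab) (fun n hn => ?_)).2 h
  · refine h2.unique ?_
    have h3 : HasSum (fun k : ℕ => (-(x / 2) ^ 2) ^ k / ((k.factorial : ℝ) *
        ((0 + k).factorial : ℝ))) (besselSeries 0 (-(x / 2) ^ 2)) :=
      (summable_besselSeries 0 _).hasSum
    rw [← Complex.ofReal_mul]
    have h4 := Complex.hasSum_ofReal.2 (h3.mul_left Real.pi)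
    convert h4 using 1
    ext k
    simp only [Function.comp]
    rw [integral_cos_pow_even]
    have h5 : (x * Complex.I) ^ (2 * k) = (-1) ^ k * x ^ (2 * k) := by
      rw [mul_pow, pow_mul Complex.I, Complex.I_sq]; ring
    rw [h5]
    have h9 : (-((x : ℂ) / 2) ^ 2) ^ k = (-1) ^ k * x ^ (2 * k) / 4 ^ k := by
      rw [neg_pow, ← pow_mul, div_pow, pow_mul (2 : ℂ)]
      norm_num
      ring
    push_cast
    rw [h9, zero_add]
    have : (((2 * k).factorial : ℕ) : ℂ) ≠ 0 := by exact_mod_cast (Nat.factorial_pos _).ne'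
    field_simp
  · obtain ⟨k, rfl | rfl⟩ := Nat.even_or_odd' n
    · exact absurd ⟨k, rfl⟩ hn
    · rw [integral_cos_pow_odd]; simp

/-- Since sin² cosⁿ = cosⁿ - cosⁿ⁺², the moments are differences of consecutive even cosine moments,
and these produce the coefficients of the series of order 1. -/
theorem integral_sin_sq_mul_exp_cos (x : ℝ) :
    ∫ φ in (0 : ℝ)..Real.pi, (Real.sin φ ^ 2 : ℂ) * Complex.exp (Complex.I * x * Real.cos φ) =
      Real.pi / 2 * (besselSeries 1 (-(x / 2) ^ 2) : ℂ) := by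
  have h := hasSum_integral_mul_exp_cos (fun φ => Real.sin φ ^ 2) (by fun_prop) x
  have hI : ∀ n : ℕ, ∫ φ in (0 : ℝ)..Real.pi, Real.sin φ ^ 2 * Real.cos φ ^ n =
      (∫ φ in (0 : ℝ)..Real.pi, Real.cos φ ^ n) -
        ∫ φ in (0 : ℝ)..Real.pi, Real.cos φ ^ (n + 2) := by
    intro n
    rw [← intervalIntegral.integral_sub
      ((by fun_prop : Continuous fun φ => Real.cos φ ^ n).intervalIntegrable _ _)
      ((by fun_prop : Continuous fun φ => Real.cos φ ^ (n + 2)).intervalIntegrable _ _)]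
    congr 1
    ext φ
    rw [Real.sin_sq]
    ring
  simp only [hI, Complex.ofReal_pow] at h
  have h2 := (Function.Injective.hasSum_iff (g := fun k : ℕ => 2 * k)
    (fun a b hab => by simpa using hab) (fun n hn => ?_)).2 h
  · refine h2.unique ?_
    have h3 : HasSum (fun k : ℕ => (-(x / 2) ^ 2) ^ k / ((k.factorial : ℝ) *
        ((1 + k).factorial : ℝ))) (besselSeries 1 (-(x / 2) ^ 2)) :=
      (summable_besselSeries 1 _).hasSum
    have h4 := Complex.hasSum_ofReal.2 (h3.mul_left (Real.pi / 2))
    convert h4 using 1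
    · ext k
      simp only [Function.comp]
      rw [show 2 * k + 2 = 2 * (k + 1) by ring, integral_cos_pow_even, integral_cos_pow_even]
      have h5 : (x * Complex.I) ^ (2 * k) = (-1) ^ k * x ^ (2 * k) := by
        rw [mul_pow, pow_mul Complex.I, Complex.I_sq]; ring
      rw [h5]
      have h6 : (((2 * k).factorial : ℕ) : ℂ) ≠ 0 := by exact_mod_cast (Nat.factorial_pos _).ne'
      have h7 : (k : ℂ) + 1 ≠ 0 := by exact_mod_cast k.succ_ne_zero
      have h8 : (2 * k : ℂ) + 1 + 1 ≠ 0 := by exact_mod_cast (2 * k + 1).succ_ne_zero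
      rw [show 2 * (k + 1) = 2 * k + 1 + 1 by ring, add_comm 1 k]
      simp only [Nat.factorial_succ]
      have h9 : (-((x : ℂ) / 2) ^ 2) ^ k = (-1) ^ k * x ^ (2 * k) / 4 ^ k := by
        rw [neg_pow, ← pow_mul, div_pow, pow_mul (2 : ℂ)]
        norm_num
        ring
      push_cast
      rw [h9]
      field_simp
      ring
    · push_cast; ring
  · obtain ⟨k, rfl | rfl⟩ := Nat.even_or_odd' n
    · exact absurd ⟨k, rfl⟩ hn
    · rw [show 2 * k + 1 + 2 = 2 * (k + 1) + 1 by ring, integral_cos_pow_odd, integral_cos_pow_odd]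
      simp

/-- For m ≠ 0 the integrand has the primitive -c⁻¹ e^{c cos φ} with c = jπm. Its endpoint values
involve e^{-c} and e^{c}, which coincide because 2c is a multiple of 2πj. -/
theorem integral_sin_mul_exp_cos (m : ℤ) :
    ∫ φ in (0 : ℝ)..Real.pi, (Real.sin φ : ℂ) *
      Complex.exp (Complex.I * (Real.pi * m : ℝ) * Real.cos φ) = if m = 0 then 2 else 0 := by
  split_ifs with hm
  · subst hm
    simp only [Int.cast_zero, mul_zero, Complex.ofReal_zero, zero_mul, Complex.exp_zero, mul_one]
    rw [intervalIntegral.integral_ofReal, integral_sin]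
    norm_num
  · set c : ℂ := Complex.I * (Real.pi * m : ℝ)
    have hc : c ≠ 0 := mul_ne_zero Complex.I_ne_zero (by
      exact_mod_cast mul_ne_zero Real.pi_ne_zero (by exact_mod_cast hm))
    have hd : ∀ φ ∈ Set.uIcc (0 : ℝ) Real.pi,
        HasDerivAt (fun φ : ℝ => -c⁻¹ * Complex.exp (c * Real.cos φ))
          ((Real.sin φ : ℂ) * Complex.exp (c * Real.cos φ)) φ := by
      intro φ _
      have h1 := ((((Real.hasDerivAt_cos φ).ofReal_comp).const_mul c).cexp).const_mul (-c⁻¹)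
      have h2 : c⁻¹ * c = 1 := inv_mul_cancel₀ hc
      refine h1.congr_deriv ?_
      push_cast
      linear_combination (Complex.exp (c * Complex.cos φ) * Complex.sin φ) * h2
    rw [intervalIntegral.integral_eq_sub_of_hasDerivAt hd
      ((by fun_prop : Continuous fun φ : ℝ => (Real.sin φ : ℂ) *
        Complex.exp (c * Real.cos φ)).intervalIntegrable _ _)]
    have h2 : Complex.exp (c * Real.cos Real.pi) = Complex.exp (c * Real.cos 0) := by
      rw [Complex.exp_eq_exp_iff_exists_int]
      refine ⟨-m, ?_⟩
      simp [c]
      ring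
    rw [h2, sub_self]

/-! ### The Rician distribution -/

/-- The exponent splits off the constant e^{-K}. What remains is a Gaussian weight times a power
series in a², the form in which moments can be integrated termwise. -/
theorem ricePdf_of_pos {K Ω a : ℝ} (hK : 0 ≤ K) (hΩ : 0 < Ω) (ha : 0 < a) :
    ricePdf K Ω a = 2 * (K + 1) / Ω * Real.exp (-K) * (a * Real.exp (-((K + 1) / Ω) * a ^ 2)) *
      besselSeries 0 (K * (K + 1) / Ω * a ^ 2) := by
  have h1 : (K + 1) / Ω * (Ω * K / (K + 1)) = K := by
    have : K + 1 ≠ 0 := by positivity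
    field_simp
  have h2 : -((K + 1) / Ω) * (a ^ 2 + Ω * K / (K + 1)) = -K + -((K + 1) / Ω) * a ^ 2 := by
    linear_combination -h1
  have h3 : (2 * a * Real.sqrt (K * (K + 1) / Ω) / 2) ^ 2 = K * (K + 1) / Ω * a ^ 2 := by
    rw [show 2 * a * Real.sqrt (K * (K + 1) / Ω) / 2 = a * Real.sqrt (K * (K + 1) / Ω) by ring,
      mul_pow, Real.sq_sqrt (by positivity)]
    ring
  rw [ricePdf, Set.indicator_of_mem (Set.mem_Ioi.2 ha), besselI0_eq, h2, h3, Real.exp_add]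
  ring

theorem ricePdf_of_nonpos {K Ω a : ℝ} (ha : a ≤ 0) : ricePdf K Ω a = 0 := by
  rw [ricePdf, Set.indicator_of_notMem (by simpa using ha)]

theorem ricePdf_nonneg {K Ω : ℝ} (hK : 0 ≤ K) (hΩ : 0 < Ω) (a : ℝ) : 0 ≤ ricePdf K Ω a := by
  rcases le_or_gt a 0 with ha | ha
  · rw [ricePdf_of_nonpos ha]
  · rw [ricePdf_of_pos hK hΩ ha]
    have := besselSeries_nonneg 0 (w := K * (K + 1) / Ω * a ^ 2) (by positivity)
    positivity

theorem ricePdf_pos {K Ω a : ℝ} (hK : 0 ≤ K) (hΩ : 0 < Ω) (ha : 0 < a) : 0 < ricePdf K Ω a := by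
  rw [ricePdf_of_pos hK hΩ ha]
  have : 0 < besselSeries 0 (K * (K + 1) / Ω * a ^ 2) :=
    zero_lt_one.trans_le (one_le_besselSeries_zero (by positivity))
  positivity

theorem measurable_besselI0 : Measurable besselI0 := by
  have : besselI0 = fun x => besselSeries 0 ((x / 2) ^ 2) := funext besselI0_eq
  rw [this]
  exact ((continuous_besselSeries 0).comp (by fun_prop)).measurable

theorem measurable_ricePdf (K Ω : ℝ) : Measurable (ricePdf K Ω) := by
  unfold ricePdf
  refine Measurable.indicator ?_ measurableSet_Ioi
  have := measurable_besselI0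
  fun_prop

theorem lintegral_pow_mul_exp_neg_mul_sq {b : ℝ} (hb : 0 < b) (m : ℕ) :
    ∫⁻ a in Set.Ioi (0 : ℝ), ENNReal.ofReal (a ^ (2 * m + 1) * Real.exp (-b * a ^ 2)) =
      ENNReal.ofReal (m.factorial / (2 * b ^ (m + 1))) := by
  have h := integral_rpow_mul_exp_neg_mul_rpow (p := 2) (q := (2 * m + 1 : ℕ)) (b := b)
    (by norm_num) (lt_of_lt_of_le (by norm_num) (Nat.cast_nonneg _)) hb
  have h2 : (((2 * m + 1 : ℕ) : ℝ) + 1) / 2 = m + 1 := by push_cast; ring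
  rw [neg_div, h2, Real.Gamma_nat_eq_factorial, Real.rpow_neg hb.le,
    show ((m : ℝ) + 1) = ((m + 1 : ℕ) : ℝ) by push_cast; ring, Real.rpow_natCast] at h
  simp only [Real.rpow_natCast, Real.rpow_two] at h
  have hne : (b ^ (m + 1))⁻¹ * (1 / 2) * (m.factorial : ℝ) ≠ 0 := by positivity
  have hint : IntegrableOn (fun a : ℝ => a ^ (2 * m + 1) * Real.exp (-b * a ^ 2))
      (Set.Ioi 0) := by
    -- A non-integrable function has Bochner integral 0 by convention, so a nonzero value of the
    -- integral proves integrability.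
    by_contra hcon
    exact hne (by rw [← h]; exact integral_undef hcon)
  rw [← ofReal_integral_eq_lintegral_ofReal hint, h]
  · congr 1
    field_simp
  · refine (ae_restrict_iff' measurableSet_Ioi).2 (Eventually.of_forall fun a ha => ?_)
    have : (0 : ℝ) < a := ha
    simp only [Pi.zero_apply]
    positivity

/-- All terms are nonnegative, so the power series of I₀ can be exchanged with the integral and each
term is an odd Gaussian moment. The case j = 0 gives total mass 1, the case j = 1 finiteness of the
second moment. -/
theorem lintegral_pow_mul_ricePdf {K Ω : ℝ} (hK : 0 ≤ K) (hΩ : 0 < Ω) (j : ℕ) :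
    ∫⁻ a, ENNReal.ofReal (a ^ (2 * j)) * ENNReal.ofReal (ricePdf K Ω a) =
      ∑' k : ℕ, ENNReal.ofReal (Real.exp (-K) * (Ω / (K + 1)) ^ j *
        (K ^ k * (k + j).factorial / (k.factorial : ℝ) ^ 2)) := by
  set b := (K + 1) / Ω with hbdef
  have hb : 0 < b := by positivity
  set c : ℕ → ℝ := fun k => 2 * b * Real.exp (-K) * (K * b) ^ k / (k.factorial : ℝ) ^ 2
  have hc : ∀ k, 0 ≤ c k := fun k => by positivity
  have hpt : ∀ a : ℝ, ENNReal.ofReal (a ^ (2 * j)) * ENNReal.ofReal (ricePdf K Ω a) =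
      (Set.Ioi (0 : ℝ)).indicator (fun a => ∑' k : ℕ, ENNReal.ofReal (c k) *
        ENNReal.ofReal (a ^ (2 * (k + j) + 1) * Real.exp (-b * a ^ 2))) a := by
    intro a
    rcases le_or_gt a 0 with ha | ha
    · rw [ricePdf_of_nonpos ha, Set.indicator_of_notMem (by simpa using ha)]
      simp
    · rw [Set.indicator_of_mem (Set.mem_Ioi.2 ha), ← ENNReal.ofReal_mul (by positivity)]
      have hs := (summable_besselSeries 0 (K * (K + 1) / Ω * a ^ 2)).hasSum.mul_left
        (a ^ (2 * j) * (2 * b * Real.exp (-K) * (a * Real.exp (-b * a ^ 2))))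
      have he : a ^ (2 * j) * ricePdf K Ω a = ∑' k : ℕ, c k *
          (a ^ (2 * (k + j) + 1) * Real.exp (-b * a ^ 2)) := by
        rw [ricePdf_of_pos hK hΩ ha, show 2 * (K + 1) / Ω = 2 * b by rw [hbdef]; ring, ← mul_assoc]
        refine hs.tsum_eq.symm.trans (tsum_congr fun k => ?_)
        simp only [c, zero_add]
        rw [show K * (K + 1) / Ω * a ^ 2 = K * b * a ^ 2 by rw [hbdef]; ring, mul_pow (K * b)]
        ring
      rw [he, ENNReal.ofReal_tsum_of_nonneg]
      · exact tsum_congr fun k => ENNReal.ofReal_mul (hc k)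
      · intro k
        have := hc k
        positivity
      · refine hs.summable.congr fun k => ?_
        simp only [c, zero_add]
        rw [show K * (K + 1) / Ω * a ^ 2 = K * b * a ^ 2 by rw [hbdef]; ring, mul_pow (K * b)]
        ring
  simp_rw [hpt]
  rw [lintegral_indicator measurableSet_Ioi, lintegral_tsum]
  · refine tsum_congr fun k => ?_
    rw [lintegral_const_mul _ (by fun_prop), lintegral_pow_mul_exp_neg_mul_sq hb,
      ← ENNReal.ofReal_mul (hc k)]
    congr 1
    have hΩb : Ω / (K + 1) = 1 / b := by rw [hbdef, one_div_div]
    simp only [c]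
    rw [hΩb, mul_pow, one_div, inv_pow]
    field_simp
    ring
  · intro k
    fun_prop

theorem lintegral_ricePdf {K Ω : ℝ} (hK : 0 ≤ K) (hΩ : 0 < Ω) :
    ∫⁻ a, ENNReal.ofReal (ricePdf K Ω a) = 1 := by
  have h := lintegral_pow_mul_ricePdf hK hΩ 0
  simp only [mul_zero, pow_zero, ENNReal.ofReal_one, one_mul, mul_one, add_zero] at h
  have h2 : HasSum (fun k : ℕ => Real.exp (-K) * (K ^ k * k.factorial / (k.factorial : ℝ) ^ 2))
      (Real.exp (-K) * Real.exp K) := by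
    have h3 := (NormedSpace.expSeries_div_hasSum_exp K).mul_left (Real.exp (-K))
    rw [← Real.exp_eq_exp_ℝ] at h3
    have h4 : ∀ k : ℕ, K ^ k * (k.factorial : ℝ) / (k.factorial : ℝ) ^ 2 = K ^ k / k.factorial :=
      fun k => by field_simp
    simp_rw [h4]
    exact h3
  rw [h, ← ENNReal.ofReal_tsum_of_nonneg (fun k => by positivity) h2.summable, h2.tsum_eq,
    ← Real.exp_add]
  simp

theorem isProbabilityMeasure_riceLaw {K Ω : ℝ} (hK : 0 ≤ K) (hΩ : 0 < Ω) :
    IsProbabilityMeasure (riceLaw K Ω) :=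
  ⟨by rw [riceLaw, withDensity_apply _ MeasurableSet.univ, Measure.restrict_univ,
    lintegral_ricePdf hK hΩ]⟩

theorem lintegral_riceLaw {K Ω : ℝ} {f : ℝ → ℝ≥0∞} (hf : Measurable f) :
    ∫⁻ a, f a ∂(riceLaw K Ω) = ∫⁻ a, f a * ENNReal.ofReal (ricePdf K Ω a) := by
  rw [riceLaw, lintegral_withDensity_eq_lintegral_mul _ (measurable_ricePdf K Ω).ennreal_ofReal hf]
  simp only [Pi.mul_apply, mul_comm]

theorem ae_pos_riceLaw (K Ω : ℝ) : ∀ᵐ a ∂(riceLaw K Ω), 0 < a := by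
  rw [riceLaw, ae_withDensity_iff (measurable_ricePdf K Ω).ennreal_ofReal]
  refine Eventually.of_forall fun a ha => ?_
  by_contra hcon
  exact ha (by rw [ricePdf_of_nonpos (not_lt.1 hcon), ENNReal.ofReal_zero])

theorem integrable_sq_riceLaw {K Ω : ℝ} (hK : 0 ≤ K) (hΩ : 0 < Ω) :
    Integrable (fun a : ℝ => a ^ 2) (riceLaw K Ω) := by
  refine ⟨by fun_prop, ?_⟩
  rw [hasFiniteIntegral_iff_ofReal (Eventually.of_forall fun a => sq_nonneg a),
    lintegral_riceLaw (by fun_prop)]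
  have h := lintegral_pow_mul_ricePdf hK hΩ 1
  simp only [mul_one] at h
  rw [h, ← ENNReal.ofReal_tsum_of_nonneg (fun k => by positivity)]
  · exact ENNReal.ofReal_lt_top
  · refine Summable.mul_left _ ?_
    refine Summable.of_nonneg_of_le (fun k => by positivity) (fun k => ?_)
      (Real.summable_pow_div_factorial (2 * K))
    -- The extra factor k + 1 costs only a doubling of `K` in the dominating exponential series.
    have h1 : ((k : ℝ) + 1) ≤ 2 ^ k := by exact_mod_cast Nat.lt_two_pow_self (n := k)
    rw [Nat.factorial_succ, mul_pow]
    push_cast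
    calc K ^ k * (((k : ℝ) + 1) * k.factorial) / (k.factorial : ℝ) ^ 2
        = (k + 1) * K ^ k / k.factorial := by field_simp
      _ ≤ 2 ^ k * K ^ k / k.factorial := by gcongr

theorem integrable_id_riceLaw {K Ω : ℝ} (hK : 0 ≤ K) (hΩ : 0 < Ω) :
    Integrable (fun a : ℝ => a) (riceLaw K Ω) := by
  have := isProbabilityMeasure_riceLaw hK hΩ
  refine ((integrable_const (1 : ℝ)).add (integrable_sq_riceLaw hK hΩ)).mono'
    (by fun_prop) (Eventually.of_forall fun a => ?_)
  simp only [Pi.add_apply, Real.norm_eq_abs]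
  have : a ^ 2 = |a| ^ 2 := (sq_abs a).symm
  nlinarith [sq_nonneg (|a| - 1 / 2), abs_nonneg a]

/-! ### Logarithmic derivatives of the Rician density -/

/-- The real form of `riceLogDeriv₂`. -/
def riceCurv (K Ω a : ℝ) : ℝ :=
  -1 / a ^ 2 - 2 * (K + 1) / Ω + 2 * K * (K + 1) / Ω *
    (1 + K * (K + 1) / Ω * a ^ 2 * besselSeries 2 (K * (K + 1) / Ω * a ^ 2) /
        besselSeries 0 (K * (K + 1) / Ω * a ^ 2)
      - 2 * (K * (K + 1) / Ω * a ^ 2) * besselSeries 1 (K * (K + 1) / Ω * a ^ 2) ^ 2 /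
        besselSeries 0 (K * (K + 1) / Ω * a ^ 2) ^ 2)

/-- With z = -2jaκ one has (z/2)² = -κ²a². Both J₂(z) and J₁(z)² carry exactly this factor, so the
closed form is real and the two signs change. -/
theorem riceLogDeriv₂_eq {K Ω : ℝ} (hK : 0 ≤ K) (hΩ : 0 < Ω) (a : ℝ) :
    riceLogDeriv₂ K Ω a = (riceCurv K Ω a : ℂ) := by
  have hsq : Real.sqrt (K * (K + 1) / Ω) ^ 2 = K * (K + 1) / Ω := Real.sq_sqrt (by positivity)
  set κ := Real.sqrt (K * (K + 1) / Ω) with hκ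
  have hz : -((-2 * Complex.I * a * κ) / 2) ^ 2 = ((κ ^ 2 * a ^ 2 : ℝ) : ℂ) := by
    push_cast
    linear_combination (-(a : ℂ) ^ 2 * κ ^ 2) * Complex.I_sq
  have h1 := besselJ_natCast 1 hz
  have h2 := besselJ_natCast 2 hz
  simp only [Nat.cast_one, Nat.cast_ofNat] at h1 h2
  have h0 : besselI0 (2 * a * κ) = besselSeries 0 (κ ^ 2 * a ^ 2) := by
    rw [besselI0_eq]; congr 1; ring
  have e2 : ((-2 * Complex.I * a * κ) / 2) ^ 2 = -((κ ^ 2 * a ^ 2 : ℝ) : ℂ) := by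
    rw [← hz, neg_neg]
  rw [riceLogDeriv₂, ← hκ, h1, h2, h0, riceCurv, ← hsq, pow_one, mul_pow, e2]
  push_cast
  ring

theorem measurable_riceCurv (K Ω : ℝ) : Measurable (riceCurv K Ω) := by
  have h : ∀ n, Measurable (besselSeries n) := fun n => (continuous_besselSeries n).measurable
  have h0 := h 0
  have h1 := h 1
  have h2 := h 2
  unfold riceCurv
  fun_prop

/-- Write Sₙ for the series of order n at w. The recurrence S₀ = S₁ + wS₂ with nonnegative terms
gives wS₂/S₀ ≤ 1; the other correction terms are negative and are dropped. -/
theorem riceCurv_le {K Ω : ℝ} (hK : 0 ≤ K) (hΩ : 0 < Ω) (a : ℝ) :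
    riceCurv K Ω a ≤ -1 / a ^ 2 + 4 * K * (K + 1) / Ω := by
  unfold riceCurv
  have hw : 0 ≤ K * (K + 1) / Ω * a ^ 2 := by positivity
  set w := K * (K + 1) / Ω * a ^ 2
  have h0 : 0 < besselSeries 0 w := zero_lt_one.trans_le (one_le_besselSeries_zero hw)
  have h1 := besselSeries_nonneg 1 hw
  have hr := besselSeries_recurrence 0 w
  have h3 : w * besselSeries 2 w / besselSeries 0 w ≤ 1 := by
    rw [div_le_one h0]
    simp only [Nat.cast_zero, zero_add, one_mul] at hr
    linarith
  have h4 : 0 ≤ 2 * w * besselSeries 1 w ^ 2 / besselSeries 0 w ^ 2 := by positivity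
  have h5 : 2 * K * (K + 1) / Ω * (1 + w * besselSeries 2 w / besselSeries 0 w -
      2 * w * besselSeries 1 w ^ 2 / besselSeries 0 w ^ 2) ≤ 2 * K * (K + 1) / Ω * 2 := by
    gcongr
    linarith
  have h6 : 0 ≤ 2 * (K + 1) / Ω := by positivity
  have h7 : 2 * K * (K + 1) / Ω * 2 = 4 * K * (K + 1) / Ω := by ring
  linarith

theorem hasDerivAt_besselSeries_mul_sq (n : ℕ) (q a : ℝ) :
    HasDerivAt (fun a => besselSeries n (q * a ^ 2))
      (besselSeries (n + 1) (q * a ^ 2) * (q * (2 * a))) a := by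
  have := (hasDerivAt_besselSeries n (q * a ^ 2)).comp a ((hasDerivAt_pow 2 a).const_mul q)
  refine this.congr_deriv ?_
  push_cast
  ring

theorem hasDerivAt_log_ricePdf {K Ω a : ℝ} (hK : 0 ≤ K) (hΩ : 0 < Ω) (ha : 0 < a) :
    HasDerivAt (fun a => Real.log (ricePdf K Ω a))
      (1 / a - 2 * (K + 1) / Ω * a + 2 * (K * (K + 1) / Ω) * a *
        (besselSeries 1 (K * (K + 1) / Ω * a ^ 2) / besselSeries 0 (K * (K + 1) / Ω * a ^ 2))) a := by
  set q := K * (K + 1) / Ω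
  have hq : 0 ≤ q := by positivity
  have hpos : 0 < besselSeries 0 (q * a ^ 2) :=
    zero_lt_one.trans_le (one_le_besselSeries_zero (by positivity))
  have hev : (fun a => Real.log (ricePdf K Ω a)) =ᶠ[𝓝 a] fun a =>
      Real.log (2 * (K + 1) / Ω * Real.exp (-K)) + (Real.log a + -((K + 1) / Ω) * a ^ 2) +
        Real.log (besselSeries 0 (q * a ^ 2)) := by
    filter_upwards [Ioi_mem_nhds ha] with x hx
    have hx : 0 < x := hx
    have hpos : 0 < besselSeries 0 (q * x ^ 2) :=
      zero_lt_one.trans_le (one_le_besselSeries_zero (by positivity))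
    rw [ricePdf_of_pos hK hΩ hx, Real.log_mul (by positivity) hpos.ne',
      Real.log_mul (by positivity) (by positivity), Real.log_mul hx.ne' (Real.exp_pos _).ne',
      Real.log_exp]
  refine HasDerivAt.congr_of_eventuallyEq ?_ hev
  have h1 := (Real.hasDerivAt_log ha.ne').add ((hasDerivAt_pow 2 a).const_mul (-((K + 1) / Ω)))
  have h2 := (hasDerivAt_besselSeries_mul_sq 0 q a).log hpos.ne'
  refine ((h1.const_add (Real.log (2 * (K + 1) / Ω * Real.exp (-K)))).add h2).congr_deriv ?_
  simp only [zero_add]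
  push_cast
  field_simp
  ring

theorem deriv_deriv_log_ricePdf {K Ω a : ℝ} (hK : 0 ≤ K) (hΩ : 0 < Ω) (ha : 0 < a) :
    deriv (deriv fun a => Real.log (ricePdf K Ω a)) a = riceCurv K Ω a := by
  have hev : (deriv fun a => Real.log (ricePdf K Ω a)) =ᶠ[𝓝 a] fun a =>
      1 / a - 2 * (K + 1) / Ω * a + 2 * (K * (K + 1) / Ω) * a *
        (besselSeries 1 (K * (K + 1) / Ω * a ^ 2) / besselSeries 0 (K * (K + 1) / Ω * a ^ 2)) := by
    filter_upwards [Ioi_mem_nhds ha] with x hx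
    exact (hasDerivAt_log_ricePdf hK hΩ hx).deriv
  rw [hev.deriv_eq, riceCurv, show 2 * K * (K + 1) / Ω = 2 * (K * (K + 1) / Ω) by ring]
  set q := K * (K + 1) / Ω
  have hq : 0 ≤ q := by positivity
  have hpos : 0 < besselSeries 0 (q * a ^ 2) :=
    zero_lt_one.trans_le (one_le_besselSeries_zero (by positivity))
  have hd := fun n => hasDerivAt_besselSeries_mul_sq n q a
  have h1 := ((hasDerivAt_inv ha.ne').sub ((hasDerivAt_id a).const_mul (2 * (K + 1) / Ω))).add
    (((hasDerivAt_id a).const_mul (2 * q)).mul ((hd 1).div (hd 0) hpos.ne'))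
  have h2 := h1.deriv
  have hfun : (fun a => 1 / a - 2 * (K + 1) / Ω * a + 2 * q * a *
      (besselSeries 1 (q * a ^ 2) / besselSeries 0 (q * a ^ 2))) =
      ((fun a : ℝ => a⁻¹) - fun y => 2 * (K + 1) / Ω * id y) + (fun y => 2 * q * id y) *
        ((fun a => besselSeries 1 (q * a ^ 2)) / fun a => besselSeries 0 (q * a ^ 2)) := by
    ext x
    simp
  rw [hfun, h2]
  -- The quotient rule yields S₁/S₀ + 2wS₂/S₀, with w = qa²; substituting S₁ = S₀ - wS₂ turns it
  -- into the required 1 + wS₂/S₀.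
  have hr := besselSeries_recurrence 0 (q * a ^ 2)
  simp only [Nat.cast_zero, zero_add, one_mul, id, Pi.div_apply] at hr ⊢
  have hr2 : besselSeries 1 (q * a ^ 2) =
    besselSeries 0 (q * a ^ 2) - q * a ^ 2 * besselSeries 2 (q * a ^ 2) := by linarith
  norm_num
  rw [hr2]
  have hne := hpos.ne'
  generalize besselSeries 0 (q * a ^ 2) = B at hne ⊢
  field_simp
  ring

/-- The curvature contributes 1/a² and the density is at least a constant times a on (0, 1], so the
integrand dominates a multiple of 1/a up to a bounded error, and 1/a is not integrable at 0. -/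
theorem lintegral_neg_riceCurv {K Ω : ℝ} (hK : 0 ≤ K) (hΩ : 0 < Ω) :
    ∫⁻ a, ENNReal.ofReal (-riceCurv K Ω a) ∂(riceLaw K Ω) = ⊤ := by
  have := isProbabilityMeasure_riceLaw hK hΩ
  set M : ℝ := 4 * K * (K + 1) / Ω
  have hM : 0 ≤ M := by positivity
  by_contra hcon
  have h1 : ∫⁻ a, ENNReal.ofReal (1 / a ^ 2) ∂(riceLaw K Ω) ≤
      ∫⁻ a, (ENNReal.ofReal (-riceCurv K Ω a) + ENNReal.ofReal M) ∂(riceLaw K Ω) := by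
    refine lintegral_mono fun a => ?_
    refine (ENNReal.ofReal_le_ofReal ?_).trans ENNReal.ofReal_add_le
    have := riceCurv_le hK hΩ a
    rw [neg_div] at this
    linarith
  rw [lintegral_add_right _ measurable_const, lintegral_const, measure_univ, mul_one] at h1
  have h2 : ∫⁻ a, ENNReal.ofReal (1 / a ^ 2) ∂(riceLaw K Ω) < ⊤ :=
    h1.trans_lt (ENNReal.add_lt_top.2 ⟨Ne.lt_top hcon, ENNReal.ofReal_lt_top⟩)
  rw [lintegral_riceLaw (by fun_prop)] at h2
  -- On (0, 1] the density is at least `c * a`: I₀ is at least 1 and the Gaussian factor is smallest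
  -- at a = 1.
  set c : ℝ := 2 * (K + 1) / Ω * Real.exp (-K) * Real.exp (-((K + 1) / Ω))
  have hc : 0 < c := by positivity
  have h3 : ∫⁻ a in Set.Ioc (0 : ℝ) 1, ENNReal.ofReal c * ENNReal.ofReal a⁻¹ < ⊤ := by
    refine lt_of_le_of_lt ?_ h2
    refine le_trans (setLIntegral_mono' measurableSet_Ioc fun a ha => ?_)
      (setLIntegral_le_lintegral (Set.Ioc 0 1) _)
    rw [← ENNReal.ofReal_mul hc.le, ← ENNReal.ofReal_mul (by positivity)]
    refine ENNReal.ofReal_le_ofReal ?_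
    have ha0 : 0 < a := ha.1
    rw [ricePdf_of_pos hK hΩ ha0]
    have hI := one_le_besselSeries_zero (w := K * (K + 1) / Ω * a ^ 2) (by positivity)
    have hE : Real.exp (-((K + 1) / Ω)) ≤ Real.exp (-((K + 1) / Ω) * a ^ 2) := by
      refine Real.exp_le_exp.2 ?_
      have : a ^ 2 ≤ 1 := pow_le_one₀ ha0.le ha.2
      have : 0 < (K + 1) / Ω := by positivity
      nlinarith
    calc c * a⁻¹ = 1 / a ^ 2 * (2 * (K + 1) / Ω * Real.exp (-K) *
          (a * Real.exp (-((K + 1) / Ω))) * 1) := by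
          simp only [c]
          field_simp
      _ ≤ _ := by gcongr
  rw [lintegral_const_mul _ (by fun_prop)] at h3
  have h4 : ∫⁻ a in Set.Ioc (0 : ℝ) 1, ENNReal.ofReal a⁻¹ < ⊤ := by
    refine lt_of_not_ge fun h => ?_
    rw [top_le_iff.1 h, ENNReal.mul_top (by simpa using hc)] at h3
    exact lt_irrefl _ h3
  have h5 : IntegrableOn (fun a : ℝ => a⁻¹) (Set.Ioc 0 1) := by
    refine ⟨by fun_prop, ?_⟩
    rw [hasFiniteIntegral_iff_ofReal]
    · exact h4
    · refine (ae_restrict_iff' measurableSet_Ioc).2 (Eventually.of_forall fun a ha => ?_)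
      exact inv_nonneg.2 ha.1.le
  have h6 := (intervalIntegrable_iff_integrableOn_Ioc_of_le zero_le_one).2 h5
  rw [intervalIntegrable_inv_iff] at h6
  simp at h6

theorem lintegral_riceCurv_ne_top {K Ω : ℝ} (hK : 0 ≤ K) (hΩ : 0 < Ω) :
    ∫⁻ a, ENNReal.ofReal (riceCurv K Ω a) ∂(riceLaw K Ω) ≠ ⊤ := by
  have := isProbabilityMeasure_riceLaw hK hΩ
  refine ne_top_of_le_ne_top (ENNReal.ofReal_ne_top (r := 4 * K * (K + 1) / Ω)) ?_
  calc ∫⁻ a, ENNReal.ofReal (riceCurv K Ω a) ∂(riceLaw K Ω)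
      ≤ ∫⁻ _, ENNReal.ofReal (4 * K * (K + 1) / Ω) ∂(riceLaw K Ω) := by
        refine lintegral_mono fun a => ENNReal.ofReal_le_ofReal ?_
        have h1 := riceCurv_le hK hΩ a
        have h2 : (0 : ℝ) ≤ 1 / a ^ 2 := by positivity
        rw [neg_div] at h1
        linarith
    _ = _ := by simp

variable {L nt nr pt pr : ℕ}

/-! ### Product densities -/

/-- It suffices to compare boxes, where the integral of a product of one-variable functions factors.
This converts product densities into independence, for the prior and for the noise. -/
theorem pi_withDensity_ofReal {ι E : Type*} [Fintype ι] [MeasurableSpace E] (μ : ι → Measure E)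
    [∀ i, SigmaFinite (μ i)] {g : ι → E → ℝ} (hg : ∀ i x, 0 ≤ g i x)
    (hi : ∀ i, Integrable (g i) (μ i)) :
    (Measure.pi μ).withDensity (fun x => ENNReal.ofReal (∏ i, g i (x i))) =
      Measure.pi fun i => (μ i).withDensity fun x => ENNReal.ofReal (g i x) := by
  have : ∀ i, IsFiniteMeasure ((μ i).withDensity fun x => ENNReal.ofReal (g i x)) :=
    fun i => isFiniteMeasure_withDensity_ofReal (hi i).2
  symm
  refine Measure.pi_eq fun s hs => ?_
  rw [withDensity_apply _ (MeasurableSet.univ_pi hs), Measure.restrict_pi_pi]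
  have hi' : ∀ i, Integrable (g i) ((μ i).restrict (s i)) := fun i => (hi i).integrableOn
  rw [← ofReal_integral_eq_lintegral_ofReal (Integrable.fintype_prod hi')
    (Eventually.of_forall fun x => Finset.prod_nonneg fun i _ => hg i _),
    integral_fintype_prod_eq_prod (fun i => g i),
    ENNReal.ofReal_prod_of_nonneg fun i _ => integral_nonneg (hg i)]
  refine Finset.prod_congr rfl fun i _ => ?_
  rw [withDensity_apply _ (hs i), ofReal_integral_eq_lintegral_ofReal (hi' i)
    (Eventually.of_forall (hg i))]

/-! ### The prior as a product measure -/

theorem uniformPdf_nonneg (x : ℝ) : 0 ≤ uniformPdf x :=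
  Set.indicator_nonneg (fun _ _ => by positivity) x

theorem measurable_uniformPdf : Measurable uniformPdf :=
  measurable_const.indicator measurableSet_Ico

/-- The uniform distribution on `[0, π)`. -/
def uniformLaw : Measure ℝ := volume.withDensity fun x => ENNReal.ofReal (uniformPdf x)

theorem uniformLaw_eq :
    uniformLaw = ENNReal.ofReal (1 / Real.pi) • volume.restrict (Set.Ico 0 Real.pi) := by
  have : (fun x => ENNReal.ofReal (uniformPdf x)) =
      (Set.Ico 0 Real.pi).indicator fun _ => ENNReal.ofReal (1 / Real.pi) := by
    ext x
    by_cases hx : x ∈ Set.Ico 0 Real.pi <;> simp [uniformPdf, hx]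
  rw [uniformLaw, this, withDensity_indicator measurableSet_Ico, withDensity_const]

theorem integral_uniformLaw (f : ℝ → ℂ) :
    ∫ x, f x ∂uniformLaw = 1 / Real.pi * ∫ x in (0 : ℝ)..Real.pi, f x := by
  rw [uniformLaw_eq, integral_smul_measure, ENNReal.toReal_ofReal (by positivity),
    intervalIntegral.integral_of_le Real.pi_pos.le, integral_Ico_eq_integral_Ioo,
    integral_Ioc_eq_integral_Ioo, Complex.real_smul]
  push_cast
  rfl

theorem integrable_uniformLaw {f : ℝ → ℂ} (hf : Continuous f) : Integrable f uniformLaw := by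
  rw [uniformLaw_eq]
  exact ((hf.continuousOn.integrableOn_compact isCompact_Icc).mono_set
    Set.Ico_subset_Icc_self).smul_measure ENNReal.ofReal_ne_top

instance : IsProbabilityMeasure uniformLaw := ⟨by
  rw [uniformLaw_eq, Measure.smul_apply, Measure.restrict_apply_univ, Real.volume_Ico, smul_eq_mul,
    ← ENNReal.ofReal_mul (by positivity), sub_zero, one_div_mul_cancel Real.pi_ne_zero,
    ENNReal.ofReal_one]⟩

theorem ae_mem_Ioo_uniformLaw : ∀ᵐ x ∂uniformLaw, x ∈ Set.Ioo 0 Real.pi := by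
  rw [uniformLaw_eq]
  refine Measure.ae_smul_measure ?_ _
  rw [← Measure.restrict_congr_set (Ioo_ae_eq_Ico (a := (0 : ℝ)) (b := Real.pi))]
  exact ae_restrict_mem measurableSet_Ioo

namespace Model

/-- The prior density of one parameter. -/
def paramPdf (M : Model L nt nr pt pr) : Param L → ℝ → ℝ :=
  Sum.elim (fun _ => uniformPdf) (Sum.elim (fun _ => uniformPdf) fun l => ricePdf (M.riceK l) (M.Ω l))

/-- The prior law of one parameter. -/
def paramLaw (M : Model L nt nr pt pr) : Param L → Measure ℝ :=
  Sum.elim (fun _ => uniformLaw) (Sum.elim (fun _ => uniformLaw) fun l => riceLaw (M.riceK l) (M.Ω l))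

theorem paramPdf_nonneg (M : Model L nt nr pt pr) (i : Param L) (x : ℝ) : 0 ≤ M.paramPdf i x := by
  rcases i with l | l | l
  · exact uniformPdf_nonneg x
  · exact uniformPdf_nonneg x
  · exact ricePdf_nonneg (M.riceK_nonneg l) (M.Ω_pos l) x

theorem measurable_paramPdf (M : Model L nt nr pt pr) (i : Param L) :
    Measurable (M.paramPdf i) := by
  rcases i with l | l | l
  · exact measurable_uniformPdf
  · exact measurable_uniformPdf
  · exact measurable_ricePdf _ _

theorem paramLaw_eq (M : Model L nt nr pt pr) (i : Param L) :
    M.paramLaw i = volume.withDensity fun x => ENNReal.ofReal (M.paramPdf i x) := by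
  rcases i with l | l | l <;> rfl

instance (M : Model L nt nr pt pr) (i : Param L) : IsProbabilityMeasure (M.paramLaw i) := by
  rcases i with l | l | l
  · exact inferInstanceAs (IsProbabilityMeasure uniformLaw)
  · exact inferInstanceAs (IsProbabilityMeasure uniformLaw)
  · exact isProbabilityMeasure_riceLaw (M.riceK_nonneg l) (M.Ω_pos l)

theorem priorPdf_eq (M : Model L nt nr pt pr) (θ : Param L → ℝ) :
    M.priorPdf θ = ∏ i, M.paramPdf i (θ i) := by
  simp only [Fintype.prod_sum_type, ← Finset.prod_mul_distrib]
  refine Finset.prod_congr rfl fun l _ => ?_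
  simp only [paramPdf, Sum.elim_inl, Sum.elim_inr]
  ring

theorem priorPdf_nonneg (M : Model L nt nr pt pr) (θ : Param L → ℝ) : 0 ≤ M.priorPdf θ := by
  rw [priorPdf_eq]
  exact Finset.prod_nonneg fun i _ => M.paramPdf_nonneg i _

theorem measurable_priorPdf (M : Model L nt nr pt pr) : Measurable M.priorPdf := by
  have : M.priorPdf = fun θ => ∏ i, M.paramPdf i (θ i) := funext M.priorPdf_eq
  rw [this]
  exact Finset.measurable_prod _ fun i _ => (M.measurable_paramPdf i).comp (measurable_pi_apply i)

theorem integrable_paramPdf (M : Model L nt nr pt pr) (i : Param L) :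
    Integrable (M.paramPdf i) := by
  refine ⟨(M.measurable_paramPdf i).aestronglyMeasurable, ?_⟩
  rw [hasFiniteIntegral_iff_ofReal (Eventually.of_forall (M.paramPdf_nonneg i))]
  have h : M.paramLaw i Set.univ = 1 := measure_univ
  rw [paramLaw_eq, withDensity_apply _ MeasurableSet.univ, Measure.restrict_univ] at h
  rw [h]
  exact ENNReal.one_lt_top

theorem prior_eq_pi (M : Model L nt nr pt pr) : M.prior = Measure.pi M.paramLaw := by
  unfold prior
  simp_rw [priorPdf_eq, volume_pi]
  rw [pi_withDensity_ofReal _ M.paramPdf_nonneg M.integrable_paramPdf]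
  congr 1
  ext1 i
  rw [paramLaw_eq]

instance (M : Model L nt nr pt pr) : IsProbabilityMeasure M.prior := by
  rw [prior_eq_pi]
  infer_instance

theorem measurePreserving_eval_prior (M : Model L nt nr pt pr) (i : Param L) :
    MeasurePreserving (fun θ : Param L → ℝ => θ i) M.prior (M.paramLaw i) := by
  rw [prior_eq_pi]
  exact measurePreserving_eval _ i

end Model

/-! ### Complex Gaussian noise -/

/-- Density of a centred proper complex Gaussian variable of variance `σ²`. -/
def gaussPdf (σ : ℝ) (z : ℂ) : ℝ := 1 / (Real.pi * σ ^ 2) * Real.exp (-(1 / σ ^ 2) * ‖z‖ ^ 2)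

theorem gaussPdf_pos {σ : ℝ} (hσ : 0 < σ) (z : ℂ) : 0 < gaussPdf σ z := by
  unfold gaussPdf
  positivity

theorem measurable_gaussPdf (σ : ℝ) : Measurable (gaussPdf σ) := by
  unfold gaussPdf
  fun_prop

theorem integral_gaussPdf {σ : ℝ} (hσ : 0 < σ) : ∫ z, gaussPdf σ z = 1 := by
  have h := Complex.integral_exp_neg_mul_rpow (p := 2) (b := 1 / σ ^ 2) (by norm_num)
    (by positivity)
  simp only [Real.rpow_two] at h
  unfold gaussPdf
  rw [integral_const_mul, h]
  norm_num [Real.Gamma_two]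
  rw [Real.rpow_neg_one]
  field_simp

theorem integrable_gaussPdf {σ : ℝ} (hσ : 0 < σ) : Integrable (gaussPdf σ) := by
  by_contra h
  have := integral_gaussPdf hσ
  rw [integral_undef h] at this
  exact zero_ne_one this

/-- The law of a centred proper complex Gaussian variable of variance `σ²`. -/
def gaussLaw (σ : ℝ) : Measure ℂ := volume.withDensity fun z => ENNReal.ofReal (gaussPdf σ z)

theorem isProbabilityMeasure_gaussLaw {σ : ℝ} (hσ : 0 < σ) :
    IsProbabilityMeasure (gaussLaw σ) := ⟨by
  rw [gaussLaw, withDensity_apply _ MeasurableSet.univ, Measure.restrict_univ,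
    ← ofReal_integral_eq_lintegral_ofReal (integrable_gaussPdf hσ)
      (Eventually.of_forall fun z => (gaussPdf_pos hσ z).le), integral_gaussPdf hσ,
    ENNReal.ofReal_one]⟩

theorem integrable_id_gaussLaw {σ : ℝ} (hσ : 0 < σ) : Integrable (fun z : ℂ => z) (gaussLaw σ) := by
  rw [gaussLaw, integrable_withDensity_iff_integrable_smul' (by
      have := measurable_gaussPdf σ
      fun_prop) (Eventually.of_forall fun _ => ENNReal.ofReal_lt_top)]
  have h := Complex.integral_rpow_mul_exp_neg_mul_rpow (p := 2) (q := 1) (b := 1 / σ ^ 2)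
    (by norm_num) (by norm_num) (by positivity)
  simp only [Real.rpow_two, Real.rpow_one] at h
  have hne : (2 * Real.pi / 2) * (1 / σ ^ 2) ^ (-(1 + 2) / 2 : ℝ) *
      Real.Gamma ((1 + 2) / 2) ≠ 0 := by
    have h1 : 0 < Real.Gamma ((1 + 2) / 2) := Real.Gamma_pos_of_pos (by norm_num)
    have h2 : 0 < (1 / σ ^ 2) ^ (-(1 + 2) / 2 : ℝ) := Real.rpow_pos_of_pos (by positivity) _
    positivity
  have hint : Integrable fun z : ℂ => ‖z‖ * Real.exp (-(1 / σ ^ 2) * ‖z‖ ^ 2) := by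
    by_contra hcon
    exact hne (by rw [← h]; exact integral_undef hcon)
  refine (hint.const_mul (1 / (Real.pi * σ ^ 2))).mono' ?_ (Eventually.of_forall fun z => ?_)
  · have := measurable_gaussPdf σ
    fun_prop
  · rw [ENNReal.toReal_ofReal (gaussPdf_pos hσ z).le, norm_smul,
      Real.norm_of_nonneg (gaussPdf_pos hσ z).le, gaussPdf]
    exact le_of_eq (by ring)

/-- The density is even, so z ↦ -z preserves the law and the mean equals its own negative. -/
theorem integral_id_gaussLaw (σ : ℝ) : ∫ z : ℂ, z ∂(gaussLaw σ) = 0 := by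
  have hmp : MeasurePreserving (fun z : ℂ => -z) (gaussLaw σ) (gaussLaw σ) := by
    refine ⟨measurable_neg, ?_⟩
    refine Measure.ext_of_lintegral _ fun f hf => ?_
    have hm := (measurable_gaussPdf σ).ennreal_ofReal
    rw [lintegral_map hf measurable_neg, gaussLaw, lintegral_withDensity_eq_lintegral_mul _ hm
      (by fun_prop), lintegral_withDensity_eq_lintegral_mul _ hm hf]
    rw [← lintegral_neg_eq_self (μ := (volume : Measure ℂ))]
    simp [gaussPdf]
  have h := hmp.integral_comp (Homeomorph.neg ℂ).measurableEmbedding (fun z => z)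
  rw [integral_neg] at h
  exact self_eq_neg.1 h.symm

namespace Model

/-- The law of the noise vector. -/
def noise (M : Model L nt nr pt pr) : Measure (Obs pt pr) := Measure.pi fun _ => gaussLaw M.σ

instance (M : Model L nt nr pt pr) : IsProbabilityMeasure M.noise := by
  have := isProbabilityMeasure_gaussLaw M.σ_pos
  unfold noise
  infer_instance

theorem measurePreserving_eval_noise (M : Model L nt nr pt pr) (q : Fin pt × Fin pr) :
    MeasurePreserving (fun n : Obs pt pr => n q) M.noise (gaussLaw M.σ) := by
  have := isProbabilityMeasure_gaussLaw M.σ_pos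
  exact measurePreserving_eval (fun _ : Fin pt × Fin pr => gaussLaw M.σ) q

theorem integrable_noise (M : Model L nt nr pt pr) (q : Fin pt × Fin pr) :
    Integrable (fun n : Obs pt pr => n q) M.noise :=
  (M.measurePreserving_eval_noise q).integrable_comp_of_integrable
    (integrable_id_gaussLaw M.σ_pos)

theorem integral_noise (M : Model L nt nr pt pr) (q : Fin pt × Fin pr) :
    ∫ n : Obs pt pr, n q ∂M.noise = 0 := by
  have h := M.measurePreserving_eval_noise q
  rw [← integral_id_gaussLaw M.σ, ← h.map_eq,
    integral_map h.measurable.aemeasurable (by fun_prop)]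

/-- Density of a proper complex Gaussian vector with mean `μ` and covariance `σ² I`. -/
def gaussDensity (M : Model L nt nr pt pr) (μ y : Obs pt pr) : ℝ := ∏ q, gaussPdf M.σ (y q - μ q)

theorem gaussDensity_pos (M : Model L nt nr pt pr) (μ y : Obs pt pr) : 0 < M.gaussDensity μ y :=
  Finset.prod_pos fun _ _ => gaussPdf_pos M.σ_pos _

theorem measurable_gaussDensity (M : Model L nt nr pt pr) :
    Measurable (Function.uncurry M.gaussDensity) := by
  have := measurable_gaussPdf M.σ
  simp only [Function.uncurry_def, gaussDensity]
  fun_prop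

theorem measurable_gaussDensity_right (M : Model L nt nr pt pr) (μ : Obs pt pr) :
    Measurable (M.gaussDensity μ) :=
  M.measurable_gaussDensity.of_uncurry_left

theorem gaussDensity_eq (M : Model L nt nr pt pr) (μ y : Obs pt pr) :
    M.gaussDensity μ y = 1 / (Real.pi * M.σ ^ 2) ^ (pr * pt) *
      Real.exp (-(1 / M.σ ^ 2) * ∑ q, ‖y q - μ q‖ ^ 2) := by
  unfold gaussDensity gaussPdf
  rw [Finset.prod_mul_distrib, Finset.prod_const, ← Real.exp_sum, Finset.mul_sum, Finset.card_univ,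
    Fintype.card_prod, Fintype.card_fin, Fintype.card_fin, one_div_pow, mul_comm pt pr]

theorem likelihood_eq (M : Model L nt nr pt pr) (θ : Param L → ℝ) (y : Obs pt pr) :
    M.likelihood θ y = M.gaussDensity (M.mean θ) y := by
  rw [gaussDensity_eq, likelihood]

theorem noise_eq_withDensity (M : Model L nt nr pt pr) :
    M.noise = volume.withDensity fun n => ENNReal.ofReal (M.gaussDensity 0 n) := by
  have h := pi_withDensity_ofReal (fun _ : Fin pt × Fin pr => (volume : Measure ℂ))
    (g := fun _ => gaussPdf M.σ) (fun _ z => (gaussPdf_pos M.σ_pos z).le)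
    (fun _ => integrable_gaussPdf M.σ_pos)
  simp only [gaussDensity, Pi.zero_apply, sub_zero]
  exact h.symm

/-- Translation invariance of Lebesgue measure: the law with mean `μ` is the noise law shifted by
`μ`. -/
theorem lintegral_gaussDensity_mul (M : Model L nt nr pt pr) (μ : Obs pt pr)
    {f : Obs pt pr → ℝ≥0∞} (hf : Measurable f) :
    ∫⁻ y, ENNReal.ofReal (M.gaussDensity μ y) * f y = ∫⁻ n, f (μ + n) ∂M.noise := by
  have hm : Measurable fun n => ENNReal.ofReal (M.gaussDensity 0 n) :=
    (M.measurable_gaussDensity_right 0).ennreal_ofReal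
  rw [noise_eq_withDensity, lintegral_withDensity_eq_lintegral_mul _ hm (by fun_prop),
    ← lintegral_add_left_eq_self _ μ]
  simp [gaussDensity]

theorem integrable_gaussDensity (M : Model L nt nr pt pr) (μ : Obs pt pr) :
    Integrable (M.gaussDensity μ) ∧ ∫ y, M.gaussDensity μ y = 1 := by
  have hm := M.measurable_gaussDensity_right μ
  have h := M.lintegral_gaussDensity_mul μ (f := fun _ => 1) measurable_const
  simp only [mul_one, lintegral_const, measure_univ] at h
  have hnn : 0 ≤ᵐ[volume] M.gaussDensity μ :=
    Eventually.of_forall fun y => (M.gaussDensity_pos μ y).le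
  refine ⟨⟨hm.aestronglyMeasurable, ?_⟩, ?_⟩
  · rw [hasFiniteIntegral_iff_ofReal hnn, h]
    exact ENNReal.one_lt_top
  · rw [integral_eq_lintegral_of_nonneg_ae hnn hm.aestronglyMeasurable, h, ENNReal.toReal_one]

theorem continuous_steer (n : ℕ) (r : Fin n) : Continuous fun x => steer n x r := by
  unfold steer
  fun_prop

theorem continuous_mean (M : Model L nt nr pt pr) : Continuous M.mean := by
  have h1 := continuous_steer nt
  have h2 := continuous_steer nr
  refine continuous_pi fun q => ?_
  simp only [mean, Finset.sum_apply, Pi.smul_apply, smul_eq_mul, Matrix.mulVec, dotProduct]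
  have h3 : ∀ (l : Fin L) r, Continuous fun θ : Param L → ℝ => steer nt (θ (aod l)) r :=
    fun l r => (h1 r).comp (continuous_apply _)
  have h4 : ∀ (l : Fin L) r, Continuous fun θ : Param L → ℝ => steer nr (θ (aoa l)) r :=
    fun l r => (h2 r).comp (continuous_apply _)
  fun_prop

theorem measurable_likelihood (M : Model L nt nr pt pr) :
    Measurable (Function.uncurry M.likelihood) := by
  have h1 := M.continuous_mean.measurable
  have h2 := measurable_gaussPdf M.σ
  simp only [Function.uncurry_def, likelihood_eq, gaussDensity]
  fun_prop

theorem measurable_likelihood_right (M : Model L nt nr pt pr) (θ : Param L → ℝ) :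
    Measurable (M.likelihood θ) :=
  M.measurable_likelihood.of_uncurry_left

theorem lintegral_obsLaw (M : Model L nt nr pt pr) (θ : Param L → ℝ) {f : Obs pt pr → ℝ≥0∞}
    (hf : Measurable f) : ∫⁻ y, f y ∂(M.obsLaw θ) = ∫⁻ n, f (M.mean θ + n) ∂M.noise := by
  have hm : Measurable fun y => ENNReal.ofReal (M.likelihood θ y) :=
    (M.measurable_likelihood_right θ).ennreal_ofReal
  rw [obsLaw, lintegral_withDensity_eq_lintegral_mul _ hm hf, ← lintegral_gaussDensity_mul _ _ hf]
  simp [likelihood_eq]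

theorem obsLaw_eq_map (M : Model L nt nr pt pr) (θ : Param L → ℝ) :
    M.obsLaw θ = M.noise.map fun n => M.mean θ + n := by
  refine Measure.ext_of_lintegral _ fun f hf => ?_
  rw [lintegral_obsLaw _ _ hf, lintegral_map hf (by fun_prop)]

theorem lintegral_joint (M : Model L nt nr pt pr) {f : (Param L → ℝ) × Obs pt pr → ℝ≥0∞}
    (hf : Measurable f) :
    ∫⁻ x, f x ∂M.joint = ∫⁻ θ, ∫⁻ y, f (θ, y) ∂(M.obsLaw θ) ∂M.prior := by
  have hl : Measurable fun x : (Param L → ℝ) × Obs pt pr => ENNReal.ofReal (M.likelihood x.1 x.2) :=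
    M.measurable_likelihood.ennreal_ofReal
  have hp : Measurable fun θ => ENNReal.ofReal (M.priorPdf θ) := M.measurable_priorPdf.ennreal_ofReal
  have hj : Measurable fun x : (Param L → ℝ) × Obs pt pr =>
      ENNReal.ofReal (M.priorPdf x.1 * M.likelihood x.1 x.2) :=
    ((M.measurable_priorPdf.comp measurable_fst).mul M.measurable_likelihood).ennreal_ofReal
  have hlθ : ∀ θ, Measurable fun y => ENNReal.ofReal (M.likelihood θ y) := fun θ =>
    (M.measurable_likelihood_right θ).ennreal_ofReal
  have hobs : ∀ θ, ∫⁻ y, f (θ, y) ∂(M.obsLaw θ) =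
      ∫⁻ y, ENNReal.ofReal (M.likelihood θ y) * f (θ, y) := by
    intro θ
    rw [obsLaw, lintegral_withDensity_eq_lintegral_mul _ (hlθ θ) (by fun_prop)]
    rfl
  have hin : Measurable fun θ => ∫⁻ y, ENNReal.ofReal (M.likelihood θ y) * f (θ, y) :=
    (hl.mul hf).lintegral_prod_right'
  simp_rw [hobs]
  rw [joint, lintegral_withDensity_eq_lintegral_mul _ hj hf, Measure.volume_eq_prod,
    lintegral_prod _ (hj.mul hf).aemeasurable, prior,
    lintegral_withDensity_eq_lintegral_mul _ hp hin]
  refine lintegral_congr fun θ => ?_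
  simp only [Pi.mul_apply]
  have hlf : Measurable fun y => ENNReal.ofReal (M.likelihood θ y) * f (θ, y) :=
    (hlθ θ).mul (by fun_prop)
  rw [← lintegral_const_mul _ hlf]
  refine lintegral_congr fun y => ?_
  rw [ENNReal.ofReal_mul (M.priorPdf_nonneg θ), mul_assoc]

/-- The joint law is the law of `(θ, m(θ) + n)` with independent noise `n`. -/
theorem measurePreserving_joint (M : Model L nt nr pt pr) :
    MeasurePreserving (fun x : (Param L → ℝ) × Obs pt pr => (x.1, M.mean x.1 + x.2))
      (M.prior.prod M.noise) M.joint := by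
  have hm := M.continuous_mean.measurable
  have hT : Measurable fun x : (Param L → ℝ) × Obs pt pr => (x.1, M.mean x.1 + x.2) := by fun_prop
  refine ⟨hT, Measure.ext_of_lintegral _ fun f hf => ?_⟩
  rw [lintegral_map hf hT, lintegral_prod _ (Measurable.aemeasurable (by fun_prop)), M.lintegral_joint hf]
  refine lintegral_congr fun θ => ?_
  rw [lintegral_obsLaw _ _ (by fun_prop)]

end Model

/-! ### Derivatives of the mean -/

/-- The factor of the `rs` entry of `α_l (e_t*(φ_l) ⊗ e_r(ψ_l))` that depends on the parameter `i`. -/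
def factor (rs : Fin nt × Fin nr) (l : Fin L) : Param L → ℝ → ℂ :=
  Sum.elim (fun l' x => if l' = l then star (steer nt x rs.1) else 1)
    (Sum.elim (fun l' x => if l' = l then steer nr x rs.2 else 1)
      fun l' x => if l' = l then (x : ℂ) else 1)

theorem star_steer (n : ℕ) (x : ℝ) (r : Fin n) : star (steer n x r) =
    (1 / (Real.sqrt n : ℂ)) * Complex.exp (Complex.I * Real.pi * (r : ℕ) * Real.cos x) := by
  have h : (starRingEnd ℂ) (Complex.cos x) = Complex.cos x := by
    rw [← Complex.cos_conj, Complex.conj_ofReal]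
  simp [steer, ← Complex.exp_conj, h]

theorem contDiff_steer (n : ℕ) (r : Fin n) {k : WithTop ℕ∞} :
    ContDiff ℝ k fun x => steer n x r := by
  have h : ContDiff ℝ k fun x : ℝ => ((Real.cos x : ℝ) : ℂ) :=
    Complex.ofRealCLM.contDiff.comp Real.contDiff_cos
  unfold steer
  fun_prop

theorem contDiff_star_steer (n : ℕ) (r : Fin n) {k : WithTop ℕ∞} :
    ContDiff ℝ k fun x => star (steer n x r) := by
  have h : ContDiff ℝ k fun x : ℝ => ((Real.cos x : ℝ) : ℂ) :=
    Complex.ofRealCLM.contDiff.comp Real.contDiff_cos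
  simp_rw [star_steer]
  fun_prop

theorem contDiff_factor (rs : Fin nt × Fin nr) (l : Fin L) (i : Param L) {k : WithTop ℕ∞} :
    ContDiff ℝ k (factor rs l i) := by
  rcases i with l' | l' | l' <;> by_cases h : l' = l <;>
    simp only [factor, Sum.elim_inl, Sum.elim_inr, h, if_true, if_false]
  · exact contDiff_star_steer _ _
  · exact contDiff_const
  · exact contDiff_steer _ _
  · exact contDiff_const
  · exact Complex.ofRealCLM.contDiff
  · exact contDiff_const

/-- The derivative of order `k` of a factor. -/
def factorD (rs : Fin nt × Fin nr) (l : Fin L) (i : Param L) (k : ℕ) : ℝ → ℂ :=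
  iteratedDeriv k (factor rs l i)

theorem continuous_factorD (rs : Fin nt × Fin nr) (l : Fin L) (i : Param L) (k : ℕ) :
    Continuous (factorD rs l i k) :=
  (contDiff_factor rs l i (k := k)).continuous_iteratedDeriv k le_rfl

theorem hasDerivAt_factorD (rs : Fin nt × Fin nr) (l : Fin L) (i : Param L) (k : ℕ) (x : ℝ) :
    HasDerivAt (factorD rs l i k) (factorD rs l i (k + 1) x) x := by
  have h : DifferentiableAt ℝ (iteratedDeriv k (factor rs l i)) x :=
    ((contDiff_factor rs l i (k := k + 1)).differentiable_iteratedDeriv k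
      (by exact_mod_cast Nat.lt_succ_self k)) x
  unfold factorD
  rw [iteratedDeriv_succ]
  exact h.hasDerivAt

/-- The derivative of multi-order `k` of the `rs` entry of `α_l (e_t*(φ_l) ⊗ e_r(ψ_l))`. -/
def pathTerm (k : Param L → ℕ) (l : Fin L) (θ : Param L → ℝ) (rs : Fin nt × Fin nr) : ℂ :=
  ∏ i, factorD rs l i (k i) (θ i)

theorem continuous_pathTerm (k : Param L → ℕ) (l : Fin L) (rs : Fin nt × Fin nr) :
    Continuous fun θ : Param L → ℝ => pathTerm k l θ rs :=
  continuous_finsetProd _ fun i _ => (continuous_factorD rs l i (k i)).comp (continuous_apply i)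

/-- The product rule raises one entry of the multi-order at a time. A general curve is allowed
because coordinate lines serve the partial derivatives and the lines θ + tu the Cramér-Rao
inequality. -/
theorem hasDerivAt_pathTerm (k : Param L → ℕ) (l : Fin L) (rs : Fin nt × Fin nr)
    {γ : ℝ → Param L → ℝ} {γ' : Param L → ℝ} {t : ℝ}
    (hγ : ∀ i, HasDerivAt (fun s => γ s i) (γ' i) t) :
    HasDerivAt (fun s => pathTerm k l (γ s) rs)
      (∑ i, (γ' i : ℂ) * pathTerm (k + Pi.single i 1) l (γ t) rs) t := by
  unfold pathTerm
  have h := HasDerivAt.fun_finsetProd (u := Finset.univ)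
    (f := fun (i : Param L) s => factorD rs l i (k i) (γ s i))
    (f' := fun i => γ' i • factorD rs l i (k i + 1) (γ t i)) (x := t)
    (fun i _ => (hasDerivAt_factorD rs l i (k i) (γ t i)).scomp t (hγ i))
  refine h.congr_deriv (Finset.sum_congr rfl fun i _ => ?_)
  rw [← Finset.prod_erase_mul _ _ (Finset.mem_univ i)]
  have he : ∀ j ∈ Finset.univ.erase i, factorD rs l j ((k + Pi.single i 1 : Param L → ℕ) j) (γ t j) =
      factorD rs l j (k j) (γ t j) := by
    intro j hj
    rw [Pi.add_apply, Pi.single_eq_of_ne (Finset.ne_of_mem_erase hj), add_zero]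
  rw [Finset.prod_congr rfl he, Pi.add_apply, Pi.single_eq_same, smul_eq_mul, Complex.real_smul]
  ring

theorem pathTerm_zero (l : Fin L) (θ : Param L → ℝ) (rs : Fin nt × Fin nr) :
    pathTerm 0 l θ rs =
      θ (gain l) * (star (steer nt (θ (aod l)) rs.1) * steer nr (θ (aoa l)) rs.2) := by
  simp only [pathTerm, factorD, Pi.zero_apply, iteratedDeriv_zero, Fintype.prod_sum_type, factor,
    Sum.elim_inl, Sum.elim_inr, Finset.prod_ite_eq', Finset.mem_univ, if_true]
  ring

namespace Model

/-- The partial derivative of multi-order `k` of the mean. -/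
def meanD (M : Model L nt nr pt pr) (k : Param L → ℕ) (θ : Param L → ℝ) : Obs pt pr := fun q =>
  ∑ l, ∑ rs, M.A q rs * pathTerm k l θ rs

theorem mean_eq_meanD (M : Model L nt nr pt pr) (θ : Param L → ℝ) : M.mean θ = M.meanD 0 θ := by
  ext q
  simp only [mean, meanD, Finset.sum_apply, Pi.smul_apply, smul_eq_mul, Matrix.mulVec, dotProduct,
    pathTerm_zero, Finset.mul_sum]
  refine Finset.sum_congr rfl fun l _ => Finset.sum_congr rfl fun rs _ => ?_
  ring

theorem continuous_meanD (M : Model L nt nr pt pr) (k : Param L → ℕ) : Continuous (M.meanD k) := by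
  refine continuous_pi fun q => continuous_finsetSum _ fun l _ => continuous_finsetSum _ fun rs _ =>
    continuous_const.mul (continuous_pathTerm k l rs)

theorem hasDerivAt_meanD (M : Model L nt nr pt pr) (k : Param L → ℕ) (q : Fin pt × Fin pr)
    {γ : ℝ → Param L → ℝ} {γ' : Param L → ℝ} {t : ℝ}
    (hγ : ∀ i, HasDerivAt (fun s => γ s i) (γ' i) t) :
    HasDerivAt (fun s => M.meanD k (γ s) q)
      (∑ i, (γ' i : ℂ) * M.meanD (k + Pi.single i 1) (γ t) q) t := by
  unfold meanD
  have h := HasDerivAt.fun_sum (u := Finset.univ) fun l _ =>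
    HasDerivAt.fun_sum (u := Finset.univ) fun rs _ =>
      (hasDerivAt_pathTerm k l rs hγ).const_mul (M.A q rs)
  refine h.congr_deriv ?_
  simp_rw [Finset.mul_sum]
  symm
  rw [Finset.sum_comm]
  refine Finset.sum_congr rfl fun l _ => ?_
  rw [Finset.sum_comm]
  refine Finset.sum_congr rfl fun rs _ => Finset.sum_congr rfl fun i _ => ?_
  ring

theorem hasDerivAt_meanD_update (M : Model L nt nr pt pr) (k : Param L → ℕ) (q : Fin pt × Fin pr)
    (θ : Param L → ℝ) (i : Param L) (t : ℝ) :
    HasDerivAt (fun s => M.meanD k (Function.update θ i s) q)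
      (M.meanD (k + Pi.single i 1) (Function.update θ i t) q) t := by
  have h := M.hasDerivAt_meanD k q (γ := fun s => Function.update θ i s)
    (γ' := Pi.single i 1) (t := t) fun j => by
      rcases eq_or_ne j i with rfl | hj
      · simpa using hasDerivAt_id' t
      · simpa [hj] using hasDerivAt_const t (θ j)
  refine h.congr_deriv ?_
  rw [Finset.sum_eq_single i (fun j _ hj => by simp [hj]) (by simp)]
  simp

/-! ### Derivatives of the log-likelihood -/

theorem logLik_eq (M : Model L nt nr pt pr) (y : Obs pt pr) (θ : Param L → ℝ) :
    M.logLik y θ = Real.log (1 / (Real.pi * M.σ ^ 2) ^ (pr * pt)) +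
      -(1 / M.σ ^ 2) * ∑ q, ‖y q - M.meanD 0 θ q‖ ^ 2 := by
  have := M.σ_pos
  rw [logLik, likelihood, Real.log_mul (by positivity) (Real.exp_pos _).ne', Real.log_exp,
    mean_eq_meanD]

theorem pderiv_logLik (M : Model L nt nr pt pr) (y : Obs pt pr) (j : Param L) (θ : Param L → ℝ) :
    pderiv j (M.logLik y) θ =
      2 / M.σ ^ 2 * ∑ q, inner ℝ (y q - M.meanD 0 θ q) (M.meanD (Pi.single j 1) θ q) := by
  have hq : ∀ q, HasDerivAt (fun s => ‖y q - M.meanD 0 (Function.update θ j s) q‖ ^ 2)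
      (2 * inner ℝ (y q - M.meanD 0 θ q) (-M.meanD (Pi.single j 1) θ q)) (θ j) := by
    intro q
    have h := ((M.hasDerivAt_meanD_update 0 q θ j (θ j)).const_sub (y q)).norm_sq
    simpa using h
  have h := ((HasDerivAt.fun_sum (u := Finset.univ) fun q _ => hq q).const_mul
    (-(1 / M.σ ^ 2))).const_add (Real.log (1 / (Real.pi * M.σ ^ 2) ^ (pr * pt)))
  unfold pderiv
  simp_rw [logLik_eq]
  rw [h.deriv, Finset.mul_sum, Finset.mul_sum]
  refine Finset.sum_congr rfl fun q _ => ?_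
  rw [inner_neg_right]
  ring

theorem pderiv₂_logLik (M : Model L nt nr pt pr) (y : Obs pt pr) (i j : Param L)
    (θ : Param L → ℝ) :
    pderiv₂ i j (M.logLik y) θ = 2 / M.σ ^ 2 * ∑ q,
      (inner ℝ (y q - M.meanD 0 θ q) (M.meanD (Pi.single j 1 + Pi.single i 1) θ q) -
        inner ℝ (M.meanD (Pi.single i 1) θ q) (M.meanD (Pi.single j 1) θ q)) := by
  have hq : ∀ q, HasDerivAt (fun s => (inner ℝ (y q - M.meanD 0 (Function.update θ i s) q)
      (M.meanD (Pi.single j 1) (Function.update θ i s) q) : ℝ))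
      (inner ℝ (y q - M.meanD 0 θ q) (M.meanD (Pi.single j 1 + Pi.single i 1) θ q) -
        inner ℝ (M.meanD (Pi.single i 1) θ q) (M.meanD (Pi.single j 1) θ q)) (θ i) := by
    intro q
    have h := ((M.hasDerivAt_meanD_update 0 q θ i (θ i)).const_sub (y q)).inner ℝ
      (M.hasDerivAt_meanD_update (Pi.single j 1) q θ i (θ i))
    refine h.congr_deriv ?_
    simp [sub_eq_add_neg]
  have h := (HasDerivAt.fun_sum (u := Finset.univ) fun q _ => hq q).const_mul (2 / M.σ ^ 2)
  unfold pderiv₂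
  rw [show pderiv j (M.logLik y) = _ from funext (M.pderiv_logLik y j)]
  unfold pderiv
  rw [h.deriv]

end Model

/-! ### Moments of the factors -/

theorem iteratedDeriv_ofReal (k : ℕ) (x : ℝ) :
    iteratedDeriv k (fun x : ℝ => (x : ℂ)) x = if k = 0 then (x : ℂ) else if k = 1 then 1 else 0 := by
  have hd : deriv (fun x : ℝ => (x : ℂ)) = fun _ => 1 := by
    ext y
    exact (Complex.ofRealCLM.hasDerivAt (x := y)).deriv
  rcases k with _ | k
  · simp
  · rw [iteratedDeriv_succ', hd, iteratedDeriv_const]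
    simp

theorem factorD_gain_self (rs : Fin nt × Fin nr) (l : Fin L) (k : ℕ) (x : ℝ) :
    factorD rs l (gain l) k x = if k = 0 then (x : ℂ) else if k = 1 then 1 else 0 := by
  rw [← iteratedDeriv_ofReal]
  simp [factorD, factor]

theorem factorD_aod_self (rs : Fin nt × Fin nr) (l : Fin L) (k : ℕ) (x : ℝ) :
    factorD rs l (aod l) k x = iteratedDeriv k (fun x => star (steer nt x rs.1)) x := by
  simp [factorD, factor]

theorem factorD_aoa_self (rs : Fin nt × Fin nr) (l : Fin L) (k : ℕ) (x : ℝ) :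
    factorD rs l (aoa l) k x = iteratedDeriv k (fun x => steer nr x rs.2) x := by
  simp [factorD, factor]

/-- The path to which a parameter belongs. -/
def owner : Param L → Fin L := Sum.elim id (Sum.elim id id)

theorem factorD_of_ne (rs : Fin nt × Fin nr) {l : Fin L} {i : Param L} (h : owner i ≠ l) (k : ℕ)
    (x : ℝ) : factorD rs l i k x = if k = 0 then 1 else 0 := by
  rcases i with l' | l' | l' <;>
    simp only [owner, Sum.elim_inl, Sum.elim_inr, id] at h <;>
    simp [factorD, factor, h, iteratedDeriv_const]

theorem norm_factorD_gain_le (rs : Fin nt × Fin nr) (l l' : Fin L) (k : ℕ) (x : ℝ) :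
    ‖factorD rs l (gain l') k x‖ ≤ 1 + |x| := by
  rcases eq_or_ne l' l with rfl | h
  · rw [factorD_gain_self]
    split_ifs <;> simp [abs_nonneg, add_nonneg]
  · rw [factorD_of_ne rs (by simpa [owner] using h)]
    split_ifs <;> simp [abs_nonneg, add_nonneg]

theorem pathTerm_single_of_ne {i : Param L} {l : Fin L} (h : owner i ≠ l) (θ : Param L → ℝ)
    (rs : Fin nt × Fin nr) : pathTerm (Pi.single i 1) l θ rs = 0 := by
  refine Finset.prod_eq_zero (Finset.mem_univ i) ?_
  rw [factorD_of_ne rs h, Pi.single_eq_same, if_neg one_ne_zero]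

namespace Model

theorem integrable_factorD (M : Model L nt nr pt pr) (rs : Fin nt × Fin nr) (l : Fin L)
    (i : Param L) (k : ℕ) : Integrable (factorD rs l i k) (M.paramLaw i) := by
  rcases i with l' | l' | l'
  · exact integrable_uniformLaw (continuous_factorD _ _ _ _)
  · exact integrable_uniformLaw (continuous_factorD _ _ _ _)
  · have := isProbabilityMeasure_riceLaw (M.riceK_nonneg l') (M.Ω_pos l')
    have h := (integrable_const (1 : ℝ)).add
      (integrable_id_riceLaw (M.riceK_nonneg l') (M.Ω_pos l')).abs
    exact h.mono' (continuous_factorD _ _ _ _).aestronglyMeasurable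
      (Eventually.of_forall fun x => norm_factorD_gain_le rs l l' k x)

/-- Angular factors are continuous on a compact interval. Gain factors grow at most linearly, so a
product of two is controlled by the Rician second moment. -/
theorem integrable_star_factorD_mul (M : Model L nt nr pt pr) (rs rs' : Fin nt × Fin nr)
    (l l' : Fin L) (i : Param L) (k k' : ℕ) :
    Integrable (fun x => star (factorD rs l i k x) * factorD rs' l' i k' x) (M.paramLaw i) := by
  have hc : Continuous fun x => star (factorD rs l i k x) * factorD rs' l' i k' x :=
    (continuous_factorD _ _ _ _).star.mul (continuous_factorD _ _ _ _)
  rcases i with m | m | m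
  · exact integrable_uniformLaw hc
  · exact integrable_uniformLaw hc
  · have := isProbabilityMeasure_riceLaw (M.riceK_nonneg m) (M.Ω_pos m)
    have h := (integrable_const (2 : ℝ)).add
      ((integrable_sq_riceLaw (M.riceK_nonneg m) (M.Ω_pos m)).const_mul 2)
    refine h.mono' hc.aestronglyMeasurable (Eventually.of_forall fun x => ?_)
    have h1 := norm_factorD_gain_le rs l m k x
    have h2 := norm_factorD_gain_le rs' l' m k' x
    rw [norm_mul, norm_star]
    calc ‖factorD rs l (gain m) k x‖ * ‖factorD rs' l' (gain m) k' x‖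
        ≤ (1 + |x|) * (1 + |x|) := by gcongr
      _ ≤ 2 + 2 * x ^ 2 := by nlinarith [sq_abs x, sq_nonneg (|x| - 1)]

theorem integrable_pathTerm (M : Model L nt nr pt pr) (k : Param L → ℕ) (l : Fin L)
    (rs : Fin nt × Fin nr) : Integrable (fun θ => pathTerm k l θ rs) M.prior := by
  rw [prior_eq_pi]
  exact Integrable.fintype_prod fun i => M.integrable_factorD rs l i (k i)

theorem star_pathTerm_mul (k k' : Param L → ℕ) (l l' : Fin L) (rs rs' : Fin nt × Fin nr)
    (θ : Param L → ℝ) : star (pathTerm k l θ rs) * pathTerm k' l' θ rs' =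
      ∏ i, star (factorD rs l i (k i) (θ i)) * factorD rs' l' i (k' i) (θ i) := by
  rw [pathTerm, pathTerm, star_prod, Finset.prod_mul_distrib]

theorem integrable_star_pathTerm_mul (M : Model L nt nr pt pr) (k k' : Param L → ℕ) (l l' : Fin L)
    (rs rs' : Fin nt × Fin nr) :
    Integrable (fun θ => star (pathTerm k l θ rs) * pathTerm k' l' θ rs') M.prior := by
  simp_rw [star_pathTerm_mul]
  rw [prior_eq_pi]
  exact Integrable.fintype_prod (f := fun i x => star (factorD rs l i (k i) x) *
    factorD rs' l' i (k' i) x) fun i => M.integrable_star_factorD_mul rs rs' l l' i (k i) (k' i)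

theorem integral_star_pathTerm_mul (M : Model L nt nr pt pr) (k k' : Param L → ℕ) (l l' : Fin L)
    (rs rs' : Fin nt × Fin nr) :
    ∫ θ, star (pathTerm k l θ rs) * pathTerm k' l' θ rs' ∂M.prior =
      ∏ i, ∫ x, star (factorD rs l i (k i) x) * factorD rs' l' i (k' i) x ∂M.paramLaw i := by
  simp_rw [star_pathTerm_mul]
  rw [prior_eq_pi]
  exact integral_fintype_prod_eq_prod (fun i x => star (factorD rs l i (k i) x) *
    factorD rs' l' i (k' i) x)

theorem integrable_meanD (M : Model L nt nr pt pr) (k : Param L → ℕ) (q : Fin pt × Fin pr) :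
    Integrable (fun θ => M.meanD k θ q) M.prior :=
  integrable_finsetSum _ fun l _ => integrable_finsetSum _ fun rs _ =>
    (M.integrable_pathTerm k l rs).const_mul _

/-! ### The non-random Fisher information matrix -/

/-- Translation by the mean is a measurable equivalence, so `f` need not be measurable. -/
theorem integral_obsLaw (M : Model L nt nr pt pr) (θ : Param L → ℝ) (f : Obs pt pr → ℝ) :
    ∫ y, f y ∂(M.obsLaw θ) = ∫ n, f (M.mean θ + n) ∂M.noise := by
  rw [obsLaw_eq_map]
  exact integral_map_equiv (MeasurableEquiv.addLeft (M.mean θ)) f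

theorem pderiv₂_logLik_mean_add (M : Model L nt nr pt pr) (n : Obs pt pr) (i j : Param L)
    (θ : Param L → ℝ) :
    pderiv₂ i j (M.logLik (M.mean θ + n)) θ = 2 / M.σ ^ 2 * ∑ q,
      (inner ℝ (n q) (M.meanD (Pi.single j 1 + Pi.single i 1) θ q) -
        inner ℝ (M.meanD (Pi.single i 1) θ q) (M.meanD (Pi.single j 1) θ q)) := by
  rw [pderiv₂_logLik, mean_eq_meanD]
  simp

/-- The second derivative of the mean enters only paired with the noise, which is centred; only the
product of first derivatives survives. -/
theorem fimNR_eq (M : Model L nt nr pt pr) (θ : Param L → ℝ) (i j : Param L) :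
    M.fimNR θ i j = 2 / M.σ ^ 2 * ∑ q,
      inner ℝ (M.meanD (Pi.single i 1) θ q) (M.meanD (Pi.single j 1) θ q) := by
  have hi : ∀ q, Integrable (fun n : Obs pt pr =>
      (inner ℝ (n q) (M.meanD (Pi.single j 1 + Pi.single i 1) θ q) : ℝ)) M.noise := fun q =>
    (M.integrable_noise q).inner_const _
  have h0 : ∀ q, ∫ n : Obs pt pr,
      (inner ℝ (n q) (M.meanD (Pi.single j 1 + Pi.single i 1) θ q) : ℝ) ∂M.noise = 0 := by
    intro q
    simp_rw [fun n : Obs pt pr => real_inner_comm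
      (M.meanD (Pi.single j 1 + Pi.single i 1) θ q) (n q)]
    rw [integral_inner (M.integrable_noise q), M.integral_noise, inner_zero_right]
  rw [fimNR, Matrix.of_apply, integral_obsLaw]
  simp_rw [pderiv₂_logLik_mean_add]
  have hs : ∀ q ∈ Finset.univ, Integrable (fun n : Obs pt pr =>
      (inner ℝ (n q) (M.meanD (Pi.single j 1 + Pi.single i 1) θ q) : ℝ) -
        inner ℝ (M.meanD (Pi.single i 1) θ q) (M.meanD (Pi.single j 1) θ q)) M.noise :=
    fun q _ => (hi q).sub (integrable_const _)
  rw [integral_const_mul, integral_finsetSum _ hs]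
  simp_rw [integral_sub (hi _) (integrable_const _), h0]
  simp only [zero_sub, Finset.sum_neg_distrib, integral_const, probReal_univ, one_smul, mul_neg,
    neg_neg]

theorem K_apply (M : Model L nt nr pt pr) (p p' : Fin nt × Fin nr) :
    M.K p p' = ∑ q, star (M.A q p) * M.A q p' := by
  simp [K, Matrix.mul_apply, Matrix.conjTranspose_apply]

theorem meanD_single (M : Model L nt nr pt pr) (i : Param L) (θ : Param L → ℝ)
    (q : Fin pt × Fin pr) : M.meanD (Pi.single i 1) θ q =
      ∑ rs, M.A q rs * pathTerm (Pi.single i 1) (owner i) θ rs := by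
  rw [meanD, Finset.sum_eq_single (owner i) (fun l _ hl => by
    simp [pathTerm_single_of_ne (Ne.symm hl)]) (by simp)]

theorem inner_meanD_single (M : Model L nt nr pt pr) (i j : Param L) (θ : Param L → ℝ)
    (q : Fin pt × Fin pr) :
    (inner ℝ (M.meanD (Pi.single i 1) θ q) (M.meanD (Pi.single j 1) θ q) : ℝ) =
      (∑ p, ∑ p', star (M.A q p) * M.A q p' *
        (star (pathTerm (Pi.single i 1) (owner i) θ p) *
          pathTerm (Pi.single j 1) (owner j) θ p')).re := by
  rw [Complex.inner, mul_comm]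
  simp_rw [meanD_single, map_sum, map_mul, Finset.sum_mul_sum]
  congr 1
  refine Finset.sum_congr rfl fun p _ => Finset.sum_congr rfl fun p' _ => ?_
  simp only [starRingEnd_apply]
  ring

theorem fimNR_eq_re (M : Model L nt nr pt pr) (θ : Param L → ℝ) (i j : Param L) :
    M.fimNR θ i j = 2 / M.σ ^ 2 * (∑ p, ∑ p', M.K p p' *
      (star (pathTerm (Pi.single i 1) (owner i) θ p) *
        pathTerm (Pi.single j 1) (owner j) θ p')).re := by
  rw [fimNR_eq]
  congr 1
  simp_rw [inner_meanD_single]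
  rw [← Complex.re_sum]
  congr 1
  simp_rw [K_apply, Finset.sum_mul]
  rw [Finset.sum_comm]
  exact Finset.sum_congr rfl fun p _ => Finset.sum_comm

/-! ### The data part of the Bayesian information matrix -/

/-- In the coordinates (θ, noise), one term is bilinear in an integrable function of `θ` and an
integrable function of the noise; the other depends on `θ` alone and is quadratic in path terms. -/
theorem integrable_pderiv₂_logLik (M : Model L nt nr pt pr) (i j : Param L) :
    Integrable (fun x : (Param L → ℝ) × Obs pt pr => pderiv₂ i j (M.logLik x.2) x.1) M.joint := by
  have hc : Continuous fun x : (Param L → ℝ) × Obs pt pr => pderiv₂ i j (M.logLik x.2) x.1 := by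
    simp_rw [pderiv₂_logLik]
    have h := M.continuous_meanD
    refine continuous_const.mul (continuous_finsetSum _ fun q _ => ?_)
    have h1 : ∀ k, Continuous fun x : (Param L → ℝ) × Obs pt pr => M.meanD k x.1 q :=
      fun k => (continuous_apply q).comp ((h k).comp continuous_fst)
    have h2 : Continuous fun x : (Param L → ℝ) × Obs pt pr => x.2 q :=
      (continuous_apply q).comp continuous_snd
    exact ((h2.sub (h1 _)).inner (h1 _)).sub ((h1 _).inner (h1 _))
  rw [← M.measurePreserving_joint.integrable_comp hc.aestronglyMeasurable]
  simp only [Function.comp_def, pderiv₂_logLik_mean_add]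
  refine Integrable.const_mul (integrable_finsetSum _ fun q _ => Integrable.sub ?_ ?_) _
  · have hn : Integrable (fun n : Obs pt pr => star (n q)) M.noise :=
      Complex.conjCLE.toContinuousLinearMap.integrable_comp (M.integrable_noise q)
    have h := ((M.integrable_meanD (Pi.single j 1 + Pi.single i 1) q).mul_prod hn).re
    refine h.congr (Eventually.of_forall fun x => ?_)
    simp [Complex.inner]
  · have h : Integrable (fun θ => (inner ℝ (M.meanD (Pi.single i 1) θ q)
        (M.meanD (Pi.single j 1) θ q) : ℝ)) M.prior := by
      have h2 : Integrable (fun θ => ∑ p, ∑ p', star (M.A q p) * M.A q p' *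
          (star (pathTerm (Pi.single i 1) (owner i) θ p) *
            pathTerm (Pi.single j 1) (owner j) θ p')) M.prior :=
        integrable_finsetSum _ fun p _ => integrable_finsetSum _ fun p' _ =>
          (M.integrable_star_pathTerm_mul _ _ _ _ p p').const_mul _
      refine h2.re.congr (Eventually.of_forall fun θ => ?_)
      exact (M.inner_meanD_single i j θ q).symm
    exact h.comp_fst M.noise

theorem integrable_fimNR (M : Model L nt nr pt pr) (i j : Param L) :
    Integrable (fun θ => M.fimNR θ i j) M.prior := by
  simp_rw [fimNR_eq_re]
  have h2 : Integrable (fun θ => ∑ p, ∑ p', M.K p p' *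
      (star (pathTerm (Pi.single i 1) (owner i) θ p) *
        pathTerm (Pi.single j 1) (owner j) θ p')) M.prior :=
    integrable_finsetSum _ fun p _ => integrable_finsetSum _ fun p' _ =>
      (M.integrable_star_pathTerm_mul _ _ _ _ p p').const_mul _
  exact h2.re.const_mul _

theorem fimD_eq_integral (M : Model L nt nr pt pr) (i j : Param L) :
    M.fimD i j = ∫ θ, M.fimNR θ i j ∂M.prior := by
  have hi := M.integrable_pderiv₂_logLik i j
  have hT := M.measurePreserving_joint
  have h1 := integral_map hT.measurable.aemeasurable (hT.map_eq.symm ▸ hi.aestronglyMeasurable)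
  rw [hT.map_eq] at h1
  have h2 : Integrable (fun x : (Param L → ℝ) × Obs pt pr =>
      pderiv₂ i j (M.logLik (M.mean x.1 + x.2)) x.1) (M.prior.prod M.noise) :=
    hT.integrable_comp_of_integrable hi
  rw [fimD, Matrix.of_apply, h1, integral_prod _ h2, ← integral_neg]
  refine integral_congr_ae (Eventually.of_forall fun θ => ?_)
  simp only [fimNR, Matrix.of_apply, integral_obsLaw]

/-- The matrix `E[∂_j u (∂_i u)†]`, where `u = ∑ α_l e_t*(φ_l) ⊗ e_r(ψ_l)`. -/
def crossMoment (M : Model L nt nr pt pr) (i j : Param L) :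
    Matrix (Fin nt × Fin nr) (Fin nt × Fin nr) ℂ := Matrix.of fun p' p =>
  ∫ θ, star (pathTerm (Pi.single i 1) (owner i) θ p) * pathTerm (Pi.single j 1) (owner j) θ p'
    ∂M.prior

theorem fimD_eq_re_trace (M : Model L nt nr pt pr) (i j : Param L) :
    M.fimD i j = 2 / M.σ ^ 2 * (M.K * M.crossMoment i j).trace.re := by
  rw [fimD_eq_integral]
  simp_rw [fimNR_eq_re]
  have hi : ∀ p p', Integrable (fun θ => M.K p p' *
      (star (pathTerm (Pi.single i 1) (owner i) θ p) *
        pathTerm (Pi.single j 1) (owner j) θ p')) M.prior := fun p p' =>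
    (M.integrable_star_pathTerm_mul _ _ _ _ p p').const_mul _
  have hs : ∀ p, Integrable (fun θ => ∑ p', M.K p p' *
      (star (pathTerm (Pi.single i 1) (owner i) θ p) *
        pathTerm (Pi.single j 1) (owner j) θ p')) M.prior := fun p =>
    integrable_finsetSum _ fun p' _ => hi p p'
  have hre := integral_re (𝕜 := ℂ) (integrable_finsetSum Finset.univ fun p _ => hs p)
  simp only [RCLike.re_eq_complex_re] at hre
  rw [integral_const_mul, hre, integral_finsetSum _ fun p _ => hs p]
  simp_rw [integral_finsetSum _ fun p' _ => hi _ p', integral_const_mul]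
  rfl

theorem isHermitian_K (M : Model L nt nr pt pr) : M.K.IsHermitian :=
  Matrix.isHermitian_conjTranspose_mul_self _

theorem crossMoment_conjTranspose (M : Model L nt nr pt pr) (i j : Param L) :
    (M.crossMoment i j)ᴴ = M.crossMoment j i := by
  ext p p'
  simp only [crossMoment, Matrix.conjTranspose_apply, Matrix.of_apply]
  rw [RCLike.star_def, ← integral_conj]
  congr 1
  ext θ
  simp [mul_comm]

/-- Since `K` is Hermitian and conjugate transposition swaps the indices of the cross moment, the
two traces are complex conjugates and have the same real part. -/
theorem fimD_isSymm (M : Model L nt nr pt pr) : M.fimD.IsSymm := by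
  ext i j
  rw [Matrix.transpose_apply, fimD_eq_re_trace, fimD_eq_re_trace, ← crossMoment_conjTranspose,
    ← M.isHermitian_K.eq, ← Matrix.conjTranspose_mul, Matrix.trace_conjTranspose,
    Matrix.trace_mul_comm]
  simp [M.isHermitian_K.eq]

theorem fimD_self_eq_trace (M : Model L nt nr pt pr) (i : Param L) :
    (M.fimD i i : ℂ) = 2 / M.σ ^ 2 * (M.K * M.crossMoment i i).trace := by
  have h : star (M.K * M.crossMoment i i).trace = (M.K * M.crossMoment i i).trace := by
    rw [← Matrix.trace_conjTranspose, Matrix.conjTranspose_mul, M.isHermitian_K.eq,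
      crossMoment_conjTranspose, Matrix.trace_mul_comm]
  rw [fimD_eq_re_trace]
  push_cast
  rw [Complex.conj_eq_iff_re.1 h]

end Model

/-! ### Averages of steering vectors -/

/-- Entries of a steering vector (`ε = -1`) or of its conjugate (`ε = 1`). -/
def wave (ε : ℤ) (n : ℕ) (r : Fin n) (x : ℝ) : ℂ :=
  (1 / (Real.sqrt n : ℂ)) * Complex.exp (Complex.I * (Real.pi * (ε * (r : ℕ) : ℤ) : ℝ) * Real.cos x)

theorem star_steer_eq_wave (n : ℕ) (r : Fin n) : (fun x => star (steer n x r)) = wave 1 n r := by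
  ext x
  rw [star_steer, wave]
  congr 2
  push_cast
  ring

theorem steer_eq_wave (n : ℕ) (r : Fin n) : (fun x => steer n x r) = wave (-1) n r := by
  ext x
  rw [steer, wave]
  congr 2
  push_cast
  ring

theorem hasDerivAt_wave (ε : ℤ) (n : ℕ) (r : Fin n) (x : ℝ) :
    HasDerivAt (wave ε n r)
      (-(Complex.I * Real.pi * ε * (r : ℕ) * Real.sin x) * wave ε n r x) x := by
  have h := ((((Real.hasDerivAt_cos x).ofReal_comp).const_mul
    (Complex.I * (Real.pi * (ε * (r : ℕ) : ℤ) : ℝ))).cexp).const_mul (1 / (Real.sqrt n : ℂ))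
  refine h.congr_deriv ?_
  rw [wave]
  push_cast
  ring

theorem deriv_wave (ε : ℤ) (n : ℕ) (r : Fin n) (x : ℝ) : deriv (wave ε n r) x =
    -(Complex.I * Real.pi * ε * (r : ℕ) * Real.sin x) * wave ε n r x :=
  (hasDerivAt_wave ε n r x).deriv

/-- The phases subtract, so every quadratic average depends on an integer frequency ε(s - r), and
departure and arrival angles are treated together. -/
theorem star_wave_mul_wave (ε : ℤ) (n : ℕ) (r s : Fin n) (x : ℝ) :
    star (wave ε n r x) * wave ε n s x = 1 / (n : ℂ) *
      Complex.exp (Complex.I * (Real.pi * (ε * ((s : ℕ) - (r : ℕ)) : ℤ) : ℝ) * Real.cos x) := by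
  have h1 : (1 / (Real.sqrt n : ℂ)) * (1 / (Real.sqrt n : ℂ)) = 1 / (n : ℂ) := by
    rw [div_mul_div_comm, one_mul, ← Complex.ofReal_mul, Real.mul_self_sqrt (Nat.cast_nonneg n),
      Complex.ofReal_natCast]
  have h2 : star (wave ε n r x) = (1 / (Real.sqrt n : ℂ)) *
      Complex.exp (-(Complex.I * (Real.pi * (ε * (r : ℕ) : ℤ) : ℝ) * Real.cos x)) := by
    rw [wave, RCLike.star_def, map_mul, ← Complex.exp_conj]
    congr 1
    · rw [← Complex.ofReal_one, ← Complex.ofReal_div, Complex.conj_ofReal]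
    · rw [map_mul, map_mul, Complex.conj_I, Complex.conj_ofReal, Complex.conj_ofReal]
      ring_nf
  rw [h2, wave, mul_mul_mul_comm, h1, ← Complex.exp_add]
  congr 2
  push_cast
  ring

theorem integral_wave (ε : ℤ) (hε : ε ^ 2 = 1) (n : ℕ) (r : Fin n) :
    ∫ x, wave ε n r x ∂uniformLaw =
      1 / (Real.sqrt n : ℂ) * besselJ 0 ((r : ℕ) * (Real.pi : ℂ)) := by
  have hε' : (ε : ℝ) ^ 2 = 1 := by exact_mod_cast hε
  have hpi : (Real.pi : ℂ) ≠ 0 := by exact_mod_cast Real.pi_ne_zero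
  simp_rw [wave]
  rw [integral_uniformLaw, intervalIntegral.integral_const_mul, integral_exp_cos,
    show ((r : ℕ) * (Real.pi : ℂ)) = (((r : ℕ) * Real.pi : ℝ) : ℂ) by push_cast; ring,
    besselJ_zero_ofReal]
  rw [show -((Real.pi * (ε * (r : ℕ) : ℤ) : ℝ) / 2) ^ 2 = -(((r : ℕ) * Real.pi : ℝ) / 2) ^ 2 by
    push_cast; linear_combination (-((r : ℕ) * Real.pi / 2 : ℝ) ^ 2) * hε']
  field_simp

/-- For nonzero frequency the sine integral vanishes; for zero frequency the prefactor does. This is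
why different paths decouple in all entries that involve an angle. -/
theorem integral_deriv_wave (ε : ℤ) (n : ℕ) (r : Fin n) :
    ∫ x, deriv (wave ε n r) x ∂uniformLaw = 0 := by
  simp_rw [deriv_wave, wave]
  rw [integral_uniformLaw]
  have h := integral_sin_mul_exp_cos (ε * (r : ℕ))
  have h2 : ∀ x : ℝ, -(Complex.I * Real.pi * ε * (r : ℕ) * Real.sin x) *
      (1 / (Real.sqrt n : ℂ) *
        Complex.exp (Complex.I * (Real.pi * (ε * (r : ℕ) : ℤ) : ℝ) * Real.cos x)) =
      -(Complex.I * Real.pi * (ε * (r : ℕ) : ℤ)) * (1 / (Real.sqrt n : ℂ)) * ((Real.sin x : ℂ) *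
        Complex.exp (Complex.I * (Real.pi * (ε * (r : ℕ) : ℤ) : ℝ) * Real.cos x)) := by
    intro x
    push_cast
    ring
  simp_rw [h2]
  rw [intervalIntegral.integral_const_mul, h]
  split_ifs with h0
  · rw [h0]; simp
  · simp

theorem integral_star_wave_mul_wave (ε : ℤ) (hε : ε ^ 2 = 1) (n : ℕ) (r s : Fin n) :
    ∫ x, star (wave ε n r x) * wave ε n s x ∂uniformLaw =
      besselJ 0 ((Real.pi : ℂ) * ((s : ℕ) - (r : ℕ))) / n := by
  have hε' : (ε : ℝ) ^ 2 = 1 := by exact_mod_cast hε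
  have hpi : (Real.pi : ℂ) ≠ 0 := by exact_mod_cast Real.pi_ne_zero
  simp_rw [star_wave_mul_wave]
  rw [integral_uniformLaw, intervalIntegral.integral_const_mul, integral_exp_cos,
    show (Real.pi : ℂ) * ((s : ℕ) - (r : ℕ)) = ((Real.pi * ((s : ℕ) - (r : ℕ)) : ℝ) : ℂ) by
      push_cast; ring, besselJ_zero_ofReal]
  rw [show -((Real.pi * (ε * ((s : ℕ) - (r : ℕ)) : ℤ) : ℝ) / 2) ^ 2 =
      -((Real.pi * ((s : ℕ) - (r : ℕ)) : ℝ) / 2) ^ 2 by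
    push_cast; linear_combination (-(Real.pi * ((s : ℕ) - (r : ℕ)) / 2 : ℝ) ^ 2) * hε']
  field_simp

/-- Each derivative brings down a factor -jπε(index) sin x. The product of one with the conjugate of
the other is π²rs sin² x, the sign disappearing by `hε`, and the sin² average is half of J₀ + J₂. -/
theorem integral_star_deriv_wave_mul_deriv_wave (ε : ℤ) (hε : ε ^ 2 = 1) (n : ℕ) (r s : Fin n) :
    ∫ x, star (deriv (wave ε n r) x) * deriv (wave ε n s) x ∂uniformLaw =
      Real.pi ^ 2 * (((r : ℕ) : ℂ) * (s : ℕ) / (2 * n) *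
        (besselJ 0 ((Real.pi : ℂ) * ((s : ℕ) - (r : ℕ))) +
          besselJ 2 ((Real.pi : ℂ) * ((s : ℕ) - (r : ℕ))))) := by
  have hε' : (ε : ℝ) ^ 2 = 1 := by exact_mod_cast hε
  have hε'' : (ε : ℂ) ^ 2 = 1 := by exact_mod_cast hε
  have hpi : (Real.pi : ℂ) ≠ 0 := by exact_mod_cast Real.pi_ne_zero
  have h : ∀ x : ℝ, star (deriv (wave ε n r) x) * deriv (wave ε n s) x =
      (Real.pi ^ 2 * (r : ℕ) * (s : ℕ) / n : ℂ) * ((Real.sin x ^ 2 : ℂ) *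
      Complex.exp (Complex.I * (Real.pi * (ε * ((s : ℕ) - (r : ℕ)) : ℤ) : ℝ) * Real.cos x)) := by
    intro x
    have h1 := star_wave_mul_wave ε n r s x
    rw [deriv_wave, deriv_wave, star_mul', star_neg]
    have h2 : star (Complex.I * Real.pi * ε * (r : ℕ) * Real.sin x) =
        -(Complex.I * Real.pi * ε * (r : ℕ) * Real.sin x) := by
      simp [← Complex.sin_conj]
    rw [h2]
    linear_combination (Real.pi ^ 2 * (r : ℕ) * (s : ℕ) * Real.sin x ^ 2 : ℂ) * h1 +
      (-Complex.I ^ 2 * Real.pi ^ 2 * (r : ℕ) * (s : ℕ) * Real.sin x ^ 2 *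
        (star (wave ε n r x) * wave ε n s x) : ℂ) * hε'' -
      (Real.pi ^ 2 * (r : ℕ) * (s : ℕ) * Real.sin x ^ 2 *
        (star (wave ε n r x) * wave ε n s x) : ℂ) * Complex.I_sq
  simp_rw [h]
  rw [integral_uniformLaw, intervalIntegral.integral_const_mul, integral_sin_sq_mul_exp_cos,
    show (Real.pi : ℂ) * ((s : ℕ) - (r : ℕ)) = ((Real.pi * ((s : ℕ) - (r : ℕ)) : ℝ) : ℂ) by
      push_cast; ring, besselJ_zero_add_two_ofReal]
  rw [show -((Real.pi * (ε * ((s : ℕ) - (r : ℕ)) : ℤ) : ℝ) / 2) ^ 2 =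
      -((Real.pi * ((s : ℕ) - (r : ℕ)) : ℝ) / 2) ^ 2 by
    push_cast; linear_combination (-(Real.pi * ((s : ℕ) - (r : ℕ)) / 2 : ℝ) ^ 2) * hε']
  field_simp

theorem integral_sin_mul_star_wave_mul_wave (ε : ℤ) (hε : ε ^ 2 = 1) (n : ℕ) (r s : Fin n) :
    ∫ x, (Real.sin x : ℂ) * (star (wave ε n r x) * wave ε n s x) ∂uniformLaw =
      if r = s then 2 / (Real.pi * n : ℂ) else 0 := by
  have hε0 : ε ≠ 0 := by rintro rfl; simp at hε
  have h : ∀ x : ℝ, (Real.sin x : ℂ) * (star (wave ε n r x) * wave ε n s x) = 1 / (n : ℂ) *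
      ((Real.sin x : ℂ) *
      Complex.exp (Complex.I * (Real.pi * (ε * ((s : ℕ) - (r : ℕ)) : ℤ) : ℝ) * Real.cos x)) := by
    intro x
    rw [star_wave_mul_wave]
    ring
  simp_rw [h]
  rw [integral_uniformLaw, intervalIntegral.integral_const_mul, integral_sin_mul_exp_cos]
  have hiff : ε * (((s : ℕ) : ℤ) - ((r : ℕ) : ℤ)) = 0 ↔ r = s := by
    rw [mul_eq_zero, or_iff_right hε0, sub_eq_zero, Nat.cast_inj, Fin.val_inj, eq_comm]
  simp only [hiff]
  split_ifs
  · field_simp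
  · simp

theorem integral_star_deriv_wave_mul_wave (ε : ℤ) (hε : ε ^ 2 = 1) (n : ℕ) (r s : Fin n) :
    ∫ x, star (deriv (wave ε n r) x) * wave ε n s x ∂uniformLaw =
      Complex.I * Real.pi * ε * (r : ℕ) * if r = s then 2 / (Real.pi * n : ℂ) else 0 := by
  rw [← integral_sin_mul_star_wave_mul_wave ε hε, ← integral_const_mul]
  congr 1
  ext x
  have h2 : star (Complex.I * Real.pi * ε * (r : ℕ) * Real.sin x) =
      -(Complex.I * Real.pi * ε * (r : ℕ) * Real.sin x) := by
    simp [← Complex.sin_conj]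
  rw [deriv_wave, star_mul', star_neg, h2]
  ring

theorem integral_star_wave_mul_deriv_wave (ε : ℤ) (hε : ε ^ 2 = 1) (n : ℕ) (r s : Fin n) :
    ∫ x, star (wave ε n r x) * deriv (wave ε n s) x ∂uniformLaw =
      -(Complex.I * Real.pi * ε * (s : ℕ)) * if r = s then 2 / (Real.pi * n : ℂ) else 0 := by
  rw [← integral_sin_mul_star_wave_mul_wave ε hε, ← integral_const_mul]
  congr 1
  ext x
  rw [deriv_wave]
  ring

/-! ### The averaged matrices -/

theorem sinMean_natCast (m : ℕ) : sinMean (m : ℂ) = 0 := by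
  exact_mod_cast sinMean_intCast m

theorem sinMean_neg_natCast (m : ℕ) : sinMean (-(m : ℂ)) = 0 := by
  have := sinMean_intCast (-m)
  push_cast at this
  exact this

theorem sinMean_neg_sub (r s : ℕ) : sinMean (-((s : ℂ) - (r : ℂ))) = 0 := by
  have := sinMean_intCast (-(s - r))
  push_cast at this
  exact this

theorem besselJ_zero_neg (x : ℝ) : besselJ 0 (-(x : ℂ)) = besselJ 0 (x : ℂ) := by
  rw [← Complex.ofReal_neg, besselJ_zero_ofReal, besselJ_zero_ofReal, neg_div, neg_sq]

theorem besselJ_zero_add_two_neg (x : ℝ) :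
    besselJ 0 (-(x : ℂ)) + besselJ 2 (-(x : ℂ)) = besselJ 0 (x : ℂ) + besselJ 2 (x : ℂ) := by
  rw [← Complex.ofReal_neg, besselJ_zero_add_two_ofReal, besselJ_zero_add_two_ofReal, neg_div,
    neg_sq]

theorem P₂_apply (n : ℕ) (r s : Fin n) :
    P₂ n r s = (s : ℕ) * if r = s then 2 / (Real.pi * n : ℂ) else 0 := by
  simp only [P₂, Matrix.of_apply, sinMean_neg_sub]
  split_ifs <;> ring

/-- The matrix is diagonal, so the row index in its definition may be replaced by the column index;
it therefore coincides with `P₂`. -/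
theorem P₃_apply (n : ℕ) (r s : Fin n) :
    P₃ n r s = (s : ℕ) * if r = s then 2 / (Real.pi * n : ℂ) else 0 := by
  simp only [P₃, Matrix.of_apply, sinMean_neg_sub]
  split_ifs with h
  · rw [h]; ring
  · ring

theorem Q₂_apply (n : ℕ) (r s : Fin n) :
    Q₂ n r s = (s : ℕ) * if r = s then 2 / (Real.pi * n : ℂ) else 0 := by
  simp only [Q₂, Matrix.of_apply, sinMean_neg_sub]
  split_ifs <;> ring

theorem P₅_eq_zero (n : ℕ) : P₅ n = 0 := by
  ext r s
  simp [P₅, sinMean_neg_natCast]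

theorem P₇_eq_zero (n : ℕ) : P₇ n = 0 := by
  ext r s
  simp [P₇, sinMean_neg_natCast]

theorem P₉_eq_zero (n : ℕ) : P₉ n = 0 := by
  ext r s
  simp [P₉, sinMean_natCast]

theorem Q₄_eq_zero (n : ℕ) : Q₄ n = 0 := by
  ext r s
  simp [Q₄, sinMean_natCast]

theorem Q₅_eq_zero (n : ℕ) : Q₅ n = 0 := by
  ext r s
  simp [Q₅, sinMean_natCast]

/-- Indices are transposed here and below because the row index of a cross moment belongs to the
unconjugated factor. -/
theorem P₄_apply (n : ℕ) (r s : Fin n) :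
    P₄ n s r = besselJ 0 ((Real.pi : ℂ) * ((s : ℕ) - (r : ℕ))) / n := rfl

theorem Q₁_apply (n : ℕ) (r s : Fin n) :
    Q₁ n s r = besselJ 0 ((Real.pi : ℂ) * ((s : ℕ) - (r : ℕ))) / n := by
  have := besselJ_zero_neg (Real.pi * ((s : ℕ) - (r : ℕ)))
  push_cast at this
  rw [Q₁, Matrix.of_apply, ← this, ← mul_neg, neg_sub]
  ring

theorem P₁_apply (n : ℕ) (r s : Fin n) : P₁ n s r = ((r : ℕ) : ℂ) * (s : ℕ) / (2 * n) *
    (besselJ 0 ((Real.pi : ℂ) * ((s : ℕ) - (r : ℕ))) +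
      besselJ 2 ((Real.pi : ℂ) * ((s : ℕ) - (r : ℕ)))) := by
  rw [P₁, Matrix.of_apply, show -(Real.pi : ℂ) * ((r : ℕ) - (s : ℕ)) =
    Real.pi * ((s : ℕ) - (r : ℕ)) by ring]
  ring

theorem Q₆_apply (n : ℕ) (r s : Fin n) : Q₆ n s r = ((r : ℕ) : ℂ) * (s : ℕ) / (2 * n) *
    (besselJ 0 ((Real.pi : ℂ) * ((s : ℕ) - (r : ℕ))) +
      besselJ 2 ((Real.pi : ℂ) * ((s : ℕ) - (r : ℕ)))) := by
  have := besselJ_zero_add_two_neg (Real.pi * ((s : ℕ) - (r : ℕ)))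
  push_cast at this
  rw [Q₆, Matrix.of_apply, ← this, ← mul_neg, neg_sub]
  ring

theorem P₆_apply (n : ℕ) (r s : Fin n) : P₆ n s r = 1 / (n : ℂ) *
    (besselJ 0 ((s : ℕ) * (Real.pi : ℂ)) * besselJ 0 ((r : ℕ) * (Real.pi : ℂ))) := by
  have := besselJ_zero_neg ((r : ℕ) * Real.pi)
  push_cast at this
  rw [P₆, Matrix.of_apply, this]
  ring

theorem Q₃_apply (n : ℕ) (r s : Fin n) : Q₃ n s r = 1 / (n : ℂ) *
    (besselJ 0 ((s : ℕ) * (Real.pi : ℂ)) * besselJ 0 ((r : ℕ) * (Real.pi : ℂ))) := by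
  have := besselJ_zero_neg ((s : ℕ) * Real.pi)
  push_cast at this
  rw [Q₃, Matrix.of_apply, this]
  ring

theorem star_besselJ_zero_ofReal (x : ℝ) : star (besselJ 0 (x : ℂ)) = besselJ 0 (x : ℂ) := by
  rw [besselJ_zero_ofReal, RCLike.star_def, Complex.conj_ofReal]

/-! ### Entries of the data part -/

theorem factorD_single_of_ne (p : Fin nt × Fin nr) {i n : Param L} (h : owner n ≠ owner i) (x : ℝ) :
    factorD p (owner i) n ((Pi.single i 1 : Param L → ℕ) n) x = 1 := by
  rw [factorD_of_ne p h, Pi.single_eq_of_ne (fun hn => h (by rw [hn])), if_pos rfl]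

theorem factorD_aod_zero (p : Fin nt × Fin nr) (l : Fin L) :
    factorD p l (aod l) 0 = wave 1 nt p.1 := by
  ext x
  rw [factorD_aod_self, star_steer_eq_wave, iteratedDeriv_zero]

theorem factorD_aod_one (p : Fin nt × Fin nr) (l : Fin L) :
    factorD p l (aod l) 1 = deriv (wave 1 nt p.1) := by
  ext x
  rw [factorD_aod_self, star_steer_eq_wave, iteratedDeriv_one]

theorem factorD_aoa_zero (p : Fin nt × Fin nr) (l : Fin L) :
    factorD p l (aoa l) 0 = wave (-1) nr p.2 := by
  ext x
  rw [factorD_aoa_self, steer_eq_wave, iteratedDeriv_zero]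

theorem factorD_aoa_one (p : Fin nt × Fin nr) (l : Fin L) :
    factorD p l (aoa l) 1 = deriv (wave (-1) nr p.2) := by
  ext x
  rw [factorD_aoa_self, steer_eq_wave, iteratedDeriv_one]

theorem factorD_gain_zero (p : Fin nt × Fin nr) (l : Fin L) :
    factorD p l (gain l) 0 = fun x : ℝ => (x : ℂ) := by
  ext x
  simp [factorD_gain_self]

theorem factorD_gain_one (p : Fin nt × Fin nr) (l : Fin L) :
    factorD p l (gain l) 1 = fun _ => 1 := by
  ext x
  simp [factorD_gain_self]

theorem prod_eq_of_owner {f : Param L → ℂ} (l : Fin L) (h : ∀ n, owner n ≠ l → f n = 1) :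
    ∏ n, f n = f (aod l) * f (aoa l) * f (gain l) := by
  rw [Fintype.prod_sum_type, Fintype.prod_sum_type,
    Fintype.prod_eq_single l fun m hm => h (aod m) hm,
    Fintype.prod_eq_single l fun m hm => h (aoa m) hm,
    Fintype.prod_eq_single l fun m hm => h (gain m) hm, mul_assoc]

namespace Model

/-- Factors of foreign parameters are identically 1 and integrate to 1, so only the three parameters
of the common path remain. -/
theorem crossMoment_of_owner_eq (M : Model L nt nr pt pr) {i j : Param L} {l : Fin L}
    (hi : owner i = l) (hj : owner j = l) (p' p : Fin nt × Fin nr) :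
    M.crossMoment i j p' p =
      (∫ x, star (factorD p l (aod l) ((Pi.single i 1 : Param L → ℕ) (aod l)) x) *
        factorD p' l (aod l) ((Pi.single j 1 : Param L → ℕ) (aod l)) x ∂uniformLaw) *
      (∫ x, star (factorD p l (aoa l) ((Pi.single i 1 : Param L → ℕ) (aoa l)) x) *
        factorD p' l (aoa l) ((Pi.single j 1 : Param L → ℕ) (aoa l)) x ∂uniformLaw) *
      (∫ x, star (factorD p l (gain l) ((Pi.single i 1 : Param L → ℕ) (gain l)) x) *
        factorD p' l (gain l) ((Pi.single j 1 : Param L → ℕ) (gain l)) x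
          ∂riceLaw (M.riceK l) (M.Ω l)) := by
  rw [crossMoment, Matrix.of_apply, integral_star_pathTerm_mul, hi, hj, prod_eq_of_owner l]
  · rfl
  · intro n hn
    have h1 := factorD_single_of_ne p (i := i) (n := n) (hi ▸ hn)
    have h2 := factorD_single_of_ne p' (i := j) (n := n) (hj ▸ hn)
    rw [hi] at h1
    rw [hj] at h2
    simp [h1, h2]

theorem integral_gain (M : Model L nt nr pt pr) (k : ℕ) (l : Fin L) :
    ∫ a, (a : ℂ) ^ k ∂riceLaw (M.riceK l) (M.Ω l) = M.gainMoment k l := by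
  have h := M.measurePreserving_eval_prior (gain l)
  have h2 : M.gainMoment k l = ∫ a, a ^ k ∂riceLaw (M.riceK l) (M.Ω l) := by
    rw [gainMoment, show riceLaw (M.riceK l) (M.Ω l) = M.paramLaw (gain l) from rfl, ← h.map_eq,
      integral_map h.measurable.aemeasurable (by fun_prop)]
  rw [h2, ← integral_complex_ofReal]
  simp

theorem integral_one_riceLaw (M : Model L nt nr pt pr) (l : Fin L) :
    ∫ _, (1 : ℂ) ∂riceLaw (M.riceK l) (M.Ω l) = 1 := by
  simpa [gainMoment] using M.integral_gain 0 l

/-- The expectation of `∂_i u`, where `u = ∑ α_l e_t*(φ_l) ⊗ e_r(ψ_l)`. -/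
def firstMoment (M : Model L nt nr pt pr) (i : Param L) (p : Fin nt × Fin nr) : ℂ :=
  ∏ n, ∫ x, factorD p (owner i) n ((Pi.single i 1 : Param L → ℕ) n) x ∂M.paramLaw n

theorem firstMoment_eq (M : Model L nt nr pt pr) {i : Param L} {l : Fin L} (hi : owner i = l)
    (p : Fin nt × Fin nr) : M.firstMoment i p =
      (∫ x, factorD p l (aod l) ((Pi.single i 1 : Param L → ℕ) (aod l)) x ∂uniformLaw) *
      (∫ x, factorD p l (aoa l) ((Pi.single i 1 : Param L → ℕ) (aoa l)) x ∂uniformLaw) *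
      (∫ x, factorD p l (gain l) ((Pi.single i 1 : Param L → ℕ) (gain l)) x
          ∂riceLaw (M.riceK l) (M.Ω l)) := by
  rw [firstMoment, hi, prod_eq_of_owner l]
  · rfl
  · intro n hn
    have h1 := factorD_single_of_ne p (i := i) (n := n) (hi ▸ hn)
    rw [hi] at h1
    simp [h1]

/-- Every parameter belongs to at most one of the two paths, so in each one-dimensional integral at
least one of the two factors is identically 1. -/
theorem crossMoment_of_owner_ne (M : Model L nt nr pt pr) {i j : Param L} (h : owner i ≠ owner j)
    (p' p : Fin nt × Fin nr) :
    M.crossMoment i j p' p = star (M.firstMoment i p) * M.firstMoment j p' := by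
  rw [crossMoment, Matrix.of_apply, integral_star_pathTerm_mul, firstMoment, firstMoment, star_prod,
    ← Finset.prod_mul_distrib]
  refine Finset.prod_congr rfl fun n _ => ?_
  simp_rw [RCLike.star_def]
  rw [← integral_conj]
  rcases eq_or_ne (owner n) (owner i) with hn | hn
  · have h2 := factorD_single_of_ne p' (i := j) (n := n) (hn ▸ h)
    simp [h2]
  · have h2 := factorD_single_of_ne p (i := i) (n := n) hn
    simp [h2]

theorem firstMoment_aod (M : Model L nt nr pt pr) (l : Fin L) (p : Fin nt × Fin nr) :
    M.firstMoment (aod l) p = 0 := by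
  rw [firstMoment_eq M (l := l) rfl, Pi.single_eq_same, factorD_aod_one, integral_deriv_wave]
  simp

theorem firstMoment_aoa (M : Model L nt nr pt pr) (l : Fin L) (p : Fin nt × Fin nr) :
    M.firstMoment (aoa l) p = 0 := by
  rw [firstMoment_eq M (l := l) rfl, Pi.single_eq_same, factorD_aoa_one, integral_deriv_wave]
  simp

theorem firstMoment_gain (M : Model L nt nr pt pr) (l : Fin L) (p : Fin nt × Fin nr) :
    M.firstMoment (gain l) p =
      (1 / (Real.sqrt nt : ℂ) * besselJ 0 ((p.1 : ℕ) * (Real.pi : ℂ))) *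
        (1 / (Real.sqrt nr : ℂ) * besselJ 0 ((p.2 : ℕ) * (Real.pi : ℂ))) := by
  rw [firstMoment_eq M (l := l) rfl, Pi.single_eq_same, Pi.single_eq_of_ne (by simp),
    Pi.single_eq_of_ne (by simp), factorD_aod_zero, factorD_aoa_zero, factorD_gain_one,
    integral_wave 1 (by norm_num), integral_wave (-1) (by norm_num), integral_one_riceLaw, mul_one]

/-- Reduces an entry to recognising its cross moment as a scalar times a Kronecker product. An
imaginary scalar is what turns the real part of the trace into an imaginary part. -/
theorem fimD_of_crossMoment (M : Model L nt nr pt pr) {i j : Param L} {c : ℂ}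
    {P : Matrix (Fin nt) (Fin nt) ℂ} {Q : Matrix (Fin nr) (Fin nr) ℂ}
    (h : ∀ p' p, M.crossMoment i j p' p = c * (P p'.1 p.1 * Q p'.2 p.2)) :
    M.fimD i j = 2 / M.σ ^ 2 * (c * M.trK P Q).re := by
  have h2 : M.crossMoment i j = c • (P ⊗ₖ Q) := by
    ext p' p
    rw [h, Matrix.smul_apply, Matrix.kroneckerMap_apply, smul_eq_mul]
  rw [fimD_eq_re_trace, h2, Matrix.mul_smul, Matrix.trace_smul, smul_eq_mul, trK]

theorem fimD_self_of_crossMoment (M : Model L nt nr pt pr) {i : Param L} {c : ℂ}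
    {P : Matrix (Fin nt) (Fin nt) ℂ} {Q : Matrix (Fin nr) (Fin nr) ℂ}
    (h : ∀ p' p, M.crossMoment i i p' p = c * (P p'.1 p.1 * Q p'.2 p.2)) :
    (M.fimD i i : ℂ) = 2 / M.σ ^ 2 * (c * M.trK P Q) := by
  have h2 : M.crossMoment i i = c • (P ⊗ₖ Q) := by
    ext p' p
    rw [h, Matrix.smul_apply, Matrix.kroneckerMap_apply, smul_eq_mul]
  rw [fimD_self_eq_trace, h2, Matrix.mul_smul, Matrix.trace_smul, smul_eq_mul, trK]

theorem fimD_eq_zero_of_firstMoment (M : Model L nt nr pt pr) {i j : Param L}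
    (h : owner i ≠ owner j) (h0 : ∀ p, M.firstMoment i p = 0) : M.fimD i j = 0 := by
  have := M.fimD_of_crossMoment (i := i) (j := j) (c := 0) (P := 0) (Q := 0) fun p' p => by
    rw [crossMoment_of_owner_ne M h, h0]
    simp
  simpa using this

theorem trK_zero_left (M : Model L nt nr pt pr) (Q : Matrix (Fin nr) (Fin nr) ℂ) :
    M.trK 0 Q = 0 := by
  simp [trK]

theorem trK_zero_right (M : Model L nt nr pt pr) (P : Matrix (Fin nt) (Fin nt) ℂ) :
    M.trK P 0 = 0 := by
  simp [trK]

theorem fimD_aod_aod_self (M : Model L nt nr pt pr) (l : Fin L) :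
    (M.fimD (aod l) (aod l) : ℂ) =
      2 * Real.pi ^ 2 * M.gainMoment 2 l / M.σ ^ 2 * M.trK (P₁ nt) (Q₁ nr) := by
  rw [M.fimD_self_of_crossMoment (c := Real.pi ^ 2 * M.gainMoment 2 l) (P := P₁ nt) (Q := Q₁ nr)]
  · ring
  intro p' p
  rw [crossMoment_of_owner_eq M (l := l) rfl rfl, Pi.single_eq_same, Pi.single_eq_of_ne (by simp),
    Pi.single_eq_of_ne (by simp), factorD_aod_one, factorD_aod_one, factorD_aoa_zero,
    factorD_aoa_zero, factorD_gain_zero, factorD_gain_zero,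
    integral_star_deriv_wave_mul_deriv_wave 1 (by norm_num),
    integral_star_wave_mul_wave (-1) (by norm_num), ← P₁_apply, ← Q₁_apply nr, ← integral_gain]
  simp only [RCLike.star_def, Complex.conj_ofReal, ← pow_two]
  ring

theorem fimD_aoa_aoa_self (M : Model L nt nr pt pr) (l : Fin L) :
    (M.fimD (aoa l) (aoa l) : ℂ) =
      2 * Real.pi ^ 2 * M.gainMoment 2 l / M.σ ^ 2 * M.trK (P₄ nt) (Q₆ nr) := by
  rw [M.fimD_self_of_crossMoment (c := Real.pi ^ 2 * M.gainMoment 2 l) (P := P₄ nt) (Q := Q₆ nr)]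
  · ring
  intro p' p
  rw [crossMoment_of_owner_eq M (l := l) rfl rfl, Pi.single_eq_same, Pi.single_eq_of_ne (by simp),
    Pi.single_eq_of_ne (by simp), factorD_aod_zero, factorD_aod_zero, factorD_aoa_one,
    factorD_aoa_one, factorD_gain_zero, factorD_gain_zero,
    integral_star_deriv_wave_mul_deriv_wave (-1) (by norm_num),
    integral_star_wave_mul_wave 1 (by norm_num), ← Q₆_apply, ← P₄_apply nt, ← integral_gain]
  simp only [RCLike.star_def, Complex.conj_ofReal, ← pow_two]
  ring

theorem fimD_gain_gain_self (M : Model L nt nr pt pr) (l : Fin L) :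
    (M.fimD (gain l) (gain l) : ℂ) = 2 / M.σ ^ 2 * M.trK (P₄ nt) (Q₁ nr) := by
  rw [M.fimD_self_of_crossMoment (c := 1) (P := P₄ nt) (Q := Q₁ nr), one_mul]
  intro p' p
  rw [crossMoment_of_owner_eq M (l := l) rfl rfl, Pi.single_eq_same, Pi.single_eq_of_ne (by simp),
    Pi.single_eq_of_ne (by simp), factorD_aod_zero, factorD_aod_zero, factorD_aoa_zero,
    factorD_aoa_zero, factorD_gain_one, factorD_gain_one,
    integral_star_wave_mul_wave (-1) (by norm_num),
    integral_star_wave_mul_wave 1 (by norm_num), ← Q₁_apply nr, ← P₄_apply nt]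
  simp only [star_one, one_mul, integral_one_riceLaw, mul_one]

theorem fimD_aod_gain_self (M : Model L nt nr pt pr) (l : Fin L) :
    M.fimD (aod l) (gain l) =
      -2 * Real.pi * M.gainMoment 1 l / M.σ ^ 2 * (M.trK (P₂ nt) (Q₁ nr)).im := by
  rw [M.fimD_of_crossMoment (c := (Real.pi * M.gainMoment 1 l : ℝ) * Complex.I)
    (P := P₂ nt) (Q := Q₁ nr)]
  · rw [mul_assoc, Complex.re_ofReal_mul, Complex.I_mul_re]
    ring
  intro p' p
  rw [crossMoment_of_owner_eq M (l := l) rfl rfl]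
  simp only [Pi.single_apply, reduceCtorEq, Sum.inr.injEq, if_true, if_false, factorD_aod_zero,
    factorD_aod_one,
    factorD_aoa_zero, factorD_gain_zero, factorD_gain_one]
  rw [integral_star_deriv_wave_mul_wave 1 (by norm_num),
    integral_star_wave_mul_wave (-1) (by norm_num), P₂_apply, ← Q₁_apply nr]
  have hg := M.integral_gain 1 l
  simp only [pow_one] at hg
  simp only [RCLike.star_def, Complex.conj_ofReal, mul_one, hg, eq_comm (a := p.1)]
  push_cast
  ring

theorem fimD_aoa_gain_self (M : Model L nt nr pt pr) (l : Fin L) :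
    M.fimD (aoa l) (gain l) =
      2 * Real.pi * M.gainMoment 1 l / M.σ ^ 2 * (M.trK (P₄ nt) (Q₂ nr)).im := by
  -- The sign is opposite to that of the departure angle because the arrival vector enters
  -- unconjugated (ε = -1).
  rw [M.fimD_of_crossMoment (c := (-(Real.pi * M.gainMoment 1 l) : ℝ) * Complex.I)
    (P := P₄ nt) (Q := Q₂ nr)]
  · rw [mul_assoc, Complex.re_ofReal_mul, Complex.I_mul_re]
    ring
  intro p' p
  rw [crossMoment_of_owner_eq M (l := l) rfl rfl]
  simp only [Pi.single_apply, reduceCtorEq, Sum.inr.injEq, if_true, if_false, factorD_aod_zero,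
    factorD_aoa_one, factorD_aoa_zero, factorD_gain_zero, factorD_gain_one]
  rw [integral_star_deriv_wave_mul_wave (-1) (by norm_num),
    integral_star_wave_mul_wave 1 (by norm_num), Q₂_apply, ← P₄_apply nt]
  have hg := M.integral_gain 1 l
  simp only [pow_one] at hg
  simp only [RCLike.star_def, Complex.conj_ofReal, mul_one, hg, eq_comm (a := p.2)]
  push_cast
  ring

theorem fimD_aod_aoa_self (M : Model L nt nr pt pr) (l : Fin L) :
    M.fimD (aod l) (aoa l) =
      -2 * Real.pi ^ 2 * M.gainMoment 2 l / M.σ ^ 2 * (M.trK (P₃ nt) (Q₂ nr)).re := by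
  rw [M.fimD_of_crossMoment (c := (-(Real.pi ^ 2 * M.gainMoment 2 l) : ℝ))
    (P := P₃ nt) (Q := Q₂ nr)]
  · rw [Complex.re_ofReal_mul]
    ring
  intro p' p
  rw [crossMoment_of_owner_eq M (l := l) rfl rfl]
  simp only [Pi.single_apply, reduceCtorEq, Sum.inr.injEq, if_true, if_false, factorD_aod_zero,
    factorD_aod_one, factorD_aoa_one, factorD_aoa_zero, factorD_gain_zero]
  rw [integral_star_deriv_wave_mul_wave 1 (by norm_num),
    integral_star_wave_mul_deriv_wave (-1) (by norm_num), P₃_apply, Q₂_apply]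
  simp only [RCLike.star_def, Complex.conj_ofReal, ← pow_two, integral_gain, eq_comm (a := p.1),
    eq_comm (a := p.2)]
  -- Here the derivative falls on the unconjugated arrival factor, so the other index appears; on
  -- the diagonal the two agree.
  have h : ((p'.2 : ℕ) : ℂ) * (if p'.2 = p.2 then 2 / (Real.pi * nr : ℂ) else 0) =
      (p.2 : ℕ) * if p'.2 = p.2 then 2 / (Real.pi * nr : ℂ) else 0 := by
    split_ifs with h
    · rw [h]
    · simp
  have hI := Complex.I_sq
  push_cast
  linear_combination (-Complex.I ^ 2 * Real.pi * Real.pi * M.gainMoment 2 l * -1 * (p.1 : ℕ) *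
    (if p'.1 = p.1 then 2 / (Real.pi * nt : ℂ) else 0)) * h +
    (Real.pi * Real.pi * M.gainMoment 2 l * (p.1 : ℕ) *
    (if p'.1 = p.1 then 2 / (Real.pi * nt : ℂ) else 0) * ((p.2 : ℕ) *
    if p'.2 = p.2 then 2 / (Real.pi * nr : ℂ) else 0)) * hI

theorem fimD_gain_gain_of_ne (M : Model L nt nr pt pr) {l m : Fin L} (h : l ≠ m) :
    M.fimD (gain l) (gain m) = 2 / M.σ ^ 2 * (M.trK (P₆ nt) (Q₃ nr)).re := by
  rw [M.fimD_of_crossMoment (c := 1) (P := P₆ nt) (Q := Q₃ nr), one_mul]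
  intro p' p
  have hs : ∀ n : ℕ, (1 / (Real.sqrt n : ℂ)) * (1 / (Real.sqrt n : ℂ)) = 1 / (n : ℂ) := by
    intro n
    rw [div_mul_div_comm, one_mul, ← Complex.ofReal_mul, Real.mul_self_sqrt (Nat.cast_nonneg n),
      Complex.ofReal_natCast]
  have hb : ∀ n : ℕ, (starRingEnd ℂ) (besselJ 0 ((n : ℂ) * Real.pi)) =
      besselJ 0 ((n : ℂ) * Real.pi) := fun n => by
    have := star_besselJ_zero_ofReal ((n : ℝ) * Real.pi)
    push_cast at this
    exact this
  rw [crossMoment_of_owner_ne M (by simpa [owner] using h), firstMoment_gain, firstMoment_gain,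
    P₆_apply, Q₃_apply, ← hs nt, ← hs nr]
  simp only [RCLike.star_def, map_mul, map_div₀, map_one, Complex.conj_ofReal, hb]
  ring

end Model

/-! ### The prior part of the information matrix -/

/-- Openness of `U` makes the decomposition hold near the point, so all summands but one are
constant in the varied coordinate. -/
theorem pderiv_of_eqOn_sum {ι : Type*} [Fintype ι] [DecidableEq ι] {f : (ι → ℝ) → ℝ}
    {g : ι → ℝ → ℝ} {U : Set (ι → ℝ)} (hU : IsOpen U) (h : ∀ θ ∈ U, f θ = ∑ i, g i (θ i))
    {θ : ι → ℝ} (hθ : θ ∈ U) (j : ι) : pderiv j f θ = deriv (g j) (θ j) := by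
  have hc : ContinuousAt (fun t => Function.update θ j t) (θ j) := by fun_prop
  have hev : (fun t => f (Function.update θ j t)) =ᶠ[𝓝 (θ j)]
      fun t => (∑ i ∈ Finset.univ.erase j, g i (θ i)) + g j t := by
    have hmem : ∀ᶠ t in 𝓝 (θ j), Function.update θ j t ∈ U :=
      hc.eventually (by simpa using hU.mem_nhds hθ)
    filter_upwards [hmem] with t ht
    rw [h _ ht, ← Finset.sum_erase_add _ _ (Finset.mem_univ j), Function.update_self]
    congr 1
    refine Finset.sum_congr rfl fun i hi => ?_
    rw [Function.update_of_ne (Finset.ne_of_mem_erase hi)]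
  rw [pderiv, hev.deriv_eq, deriv_const_add]

theorem pderiv₂_of_eqOn_sum {ι : Type*} [Fintype ι] [DecidableEq ι] {f : (ι → ℝ) → ℝ}
    {g : ι → ℝ → ℝ} {U : Set (ι → ℝ)} (hU : IsOpen U) (h : ∀ θ ∈ U, f θ = ∑ i, g i (θ i))
    {θ : ι → ℝ} (hθ : θ ∈ U) (i j : ι) :
    pderiv₂ i j f θ = if i = j then deriv (deriv (g j)) (θ j) else 0 := by
  have hc : ContinuousAt (fun t => Function.update θ i t) (θ i) := by fun_prop
  have hmem : ∀ᶠ t in 𝓝 (θ i), Function.update θ i t ∈ U :=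
    hc.eventually (by simpa using hU.mem_nhds hθ)
  have hev : (fun t => pderiv j f (Function.update θ i t)) =ᶠ[𝓝 (θ i)]
      fun t => deriv (g j) (Function.update θ i t j) := by
    filter_upwards [hmem] with t ht
    exact pderiv_of_eqOn_sum hU h ht j
  rw [pderiv₂, pderiv, hev.deriv_eq]
  split_ifs with hij
  · subst hij
    simp only [Function.update_self]
  · simp only [Function.update_of_ne (Ne.symm hij), deriv_const]

theorem extExpectation_congr {X : Type*} [MeasurableSpace X] {μ : Measure X} {f g : X → ℝ}
    (h : f =ᵐ[μ] g) : extExpectation μ f = extExpectation μ g := by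
  have h1 : (fun x => ENNReal.ofReal (f x)) =ᵐ[μ] fun x => ENNReal.ofReal (g x) :=
    h.mono fun x hx => by simp only [hx]
  have h2 : (fun x => ENNReal.ofReal (-f x)) =ᵐ[μ] fun x => ENNReal.ofReal (-g x) :=
    h.mono fun x hx => by simp only [hx]
  rw [extExpectation, extExpectation, lintegral_congr_ae h1, lintegral_congr_ae h2]

theorem extExpectation_zero {X : Type*} [MeasurableSpace X] (μ : Measure X) :
    extExpectation μ (fun _ => 0) = 0 := by
  simp [extExpectation]

theorem deriv_deriv_log_uniformPdf {x : ℝ} (hx : x ∈ Set.Ioo 0 Real.pi) :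
    deriv (deriv fun x => Real.log (uniformPdf x)) x = 0 := by
  have hev : ∀ x ∈ Set.Ioo 0 Real.pi, (fun x => Real.log (uniformPdf x)) =ᶠ[𝓝 x]
      fun _ => Real.log (1 / Real.pi) := by
    intro x hx
    filter_upwards [Ioo_mem_nhds hx.1 hx.2] with y hy
    rw [uniformPdf, Set.indicator_of_mem (Set.Ioo_subset_Ico_self hy)]
  have hev2 : (deriv fun x => Real.log (uniformPdf x)) =ᶠ[𝓝 x] fun _ => 0 := by
    filter_upwards [Ioo_mem_nhds hx.1 hx.2] with y hy
    rw [(hev y hy).deriv_eq, deriv_const]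
  rw [hev2.deriv_eq, deriv_const]

/-- The interior of the support of the prior. -/
def paramInterior (L : ℕ) : Set (Param L → ℝ) :=
  {θ | ∀ l, θ (aod l) ∈ Set.Ioo 0 Real.pi ∧ θ (aoa l) ∈ Set.Ioo 0 Real.pi ∧ 0 < θ (gain l)}

theorem isOpen_paramInterior (L : ℕ) : IsOpen (paramInterior L) := by
  unfold paramInterior
  simp only [Set.mem_Ioo, Set.ofPred_forall, Set.ofPred_and]
  refine isOpen_iInter_of_finite fun l => ?_
  refine IsOpen.inter (IsOpen.inter ?_ ?_) (IsOpen.inter (IsOpen.inter ?_ ?_) ?_)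
  all_goals first
    | exact isOpen_lt continuous_const (continuous_apply _)
    | exact isOpen_lt (continuous_apply _) continuous_const

theorem paramInterior_subset (L : ℕ) : paramInterior L ⊆ Model.paramSet L := fun _ hθ l =>
  ⟨Set.Ioo_subset_Ico_self (hθ l).1, Set.Ioo_subset_Ico_self (hθ l).2.1, (hθ l).2.2⟩

namespace Model

/-- The endpoint angle 0 has prior probability zero, so derivatives of the log-prior matter only in
the open set where it is smooth. -/
theorem ae_mem_paramInterior (M : Model L nt nr pt pr) : ∀ᵐ θ ∂M.prior, θ ∈ paramInterior L := by
  refine ae_all_iff.2 fun l => ?_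
  have h1 := (M.measurePreserving_eval_prior (aod l)).quasiMeasurePreserving.ae
    ae_mem_Ioo_uniformLaw
  have h2 := (M.measurePreserving_eval_prior (aoa l)).quasiMeasurePreserving.ae
    ae_mem_Ioo_uniformLaw
  have h3 := (M.measurePreserving_eval_prior (gain l)).quasiMeasurePreserving.ae
    (ae_pos_riceLaw (M.riceK l) (M.Ω l))
  filter_upwards [h1, h2, h3] with θ h1 h2 h3
  exact ⟨h1, h2, h3⟩

theorem paramPdf_pos_of_mem (M : Model L nt nr pt pr) {θ : Param L → ℝ} (hθ : θ ∈ paramInterior L)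
    (i : Param L) : 0 < M.paramPdf i (θ i) := by
  have hu : ∀ x ∈ Set.Ioo 0 Real.pi, 0 < uniformPdf x := fun x hx => by
    rw [uniformPdf, Set.indicator_of_mem (Set.Ioo_subset_Ico_self hx)]
    positivity
  rcases i with l | l | l
  · exact hu _ (hθ l).1
  · exact hu _ (hθ l).2.1
  · exact ricePdf_pos (M.riceK_nonneg l) (M.Ω_pos l) (hθ l).2.2

theorem pderiv₂_log_priorPdf (M : Model L nt nr pt pr) {θ : Param L → ℝ}
    (hθ : θ ∈ paramInterior L) (i j : Param L) :
    pderiv₂ i j (fun η => Real.log (M.priorPdf η)) θ =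
      if i = j then deriv (deriv fun x => Real.log (M.paramPdf j x)) (θ j) else 0 := by
  refine pderiv₂_of_eqOn_sum (g := fun i x => Real.log (M.paramPdf i x)) (isOpen_paramInterior L)
    (fun η hη => ?_) hθ i j
  rw [priorPdf_eq, Real.log_prod fun i _ => (M.paramPdf_pos_of_mem hη i).ne']

theorem pderiv₂_log_priorPdf_gain (M : Model L nt nr pt pr) {θ : Param L → ℝ}
    (hθ : θ ∈ paramInterior L) (l : Fin L) :
    pderiv₂ (gain l) (gain l) (fun η => Real.log (M.priorPdf η)) θ =
      riceCurv (M.riceK l) (M.Ω l) (θ (gain l)) := by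
  rw [pderiv₂_log_priorPdf M hθ, if_pos rfl]
  exact deriv_deriv_log_ricePdf (M.riceK_nonneg l) (M.Ω_pos l) (hθ l).2.2

theorem fimP_eq_zero (M : Model L nt nr pt pr) {i j : Param L}
    (h : ¬∃ l, i = gain l ∧ j = gain l) : M.fimP i j = 0 := by
  rw [fimP, Matrix.of_apply, ← extExpectation_zero M.prior]
  refine extExpectation_congr ?_
  filter_upwards [M.ae_mem_paramInterior] with θ hθ
  rw [pderiv₂_log_priorPdf M hθ, neg_eq_zero]
  split_ifs with hij
  · subst hij
    rcases i with l | l | l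
    · exact deriv_deriv_log_uniformPdf (hθ l).1
    · exact deriv_deriv_log_uniformPdf (hθ l).2.1
    · exact absurd ⟨l, rfl, rfl⟩ h
  · rfl

theorem fimP_gain (M : Model L nt nr pt pr) (l : Fin L) : M.fimP (gain l) (gain l) =
    extExpectation (riceLaw (M.riceK l) (M.Ω l)) fun a => -riceCurv (M.riceK l) (M.Ω l) a := by
  have hmp : MeasurePreserving (fun θ : Param L → ℝ => θ (gain l)) M.prior
    (riceLaw (M.riceK l) (M.Ω l)) := M.measurePreserving_eval_prior (gain l)
  have hm := measurable_riceCurv (M.riceK l) (M.Ω l)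
  have h : M.fimP (gain l) (gain l) =
      extExpectation M.prior fun θ => -riceCurv (M.riceK l) (M.Ω l) (θ (gain l)) := by
    rw [fimP, Matrix.of_apply]
    refine extExpectation_congr ?_
    filter_upwards [M.ae_mem_paramInterior] with θ hθ
    rw [pderiv₂_log_priorPdf_gain M hθ]
  rw [h, extExpectation, extExpectation,
    hmp.lintegral_comp (f := fun a => ENNReal.ofReal (-riceCurv (M.riceK l) (M.Ω l) a))
      (by fun_prop),
    hmp.lintegral_comp (f := fun a => ENNReal.ofReal (- -riceCurv (M.riceK l) (M.Ω l) a))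
      (by fun_prop)]

/-- The part of the integrand from 1/a² diverges while the part of opposite sign is bounded. The
bound thus always lives in the regime of infinite prior entries. -/
theorem fimP_gain_eq_top (M : Model L nt nr pt pr) (l : Fin L) :
    M.fimP (gain l) (gain l) = ⊤ := by
  have hK := M.riceK_nonneg l
  have hΩ := M.Ω_pos l
  rw [fimP_gain, extExpectation, lintegral_neg_riceCurv hK hΩ]
  simp only [neg_neg, EReal.coe_ennreal_top]
  exact EReal.top_sub (by simpa using lintegral_riceCurv_ne_top hK hΩ)

end Model

/-! ### A conditional Cramér-Rao inequality -/

/-- Complete the square: 2|y-a|² - |y-b|² = |y-(2a-b)|² - 2|a-b|². The χ²-divergence between two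
shifted Gaussians is thereby explicit. -/
theorem gaussPdf_sq_div {σ : ℝ} (hσ : 0 < σ) (y a b : ℂ) :
    gaussPdf σ (y - a) ^ 2 / gaussPdf σ (y - b) =
      Real.exp (2 / σ ^ 2 * ‖a - b‖ ^ 2) * gaussPdf σ (y - (2 * a - b)) := by
  have h : -(1 / σ ^ 2) * ‖y - a‖ ^ 2 + -(1 / σ ^ 2) * ‖y - a‖ ^ 2 =
      2 / σ ^ 2 * ‖a - b‖ ^ 2 + -(1 / σ ^ 2) * ‖y - (2 * a - b)‖ ^ 2 +
        -(1 / σ ^ 2) * ‖y - b‖ ^ 2 := by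
    simp only [Complex.sq_norm, Complex.normSq_apply, Complex.sub_re, Complex.sub_im,
      Complex.mul_re, Complex.mul_im, Complex.re_ofNat, Complex.im_ofNat]
    ring
  rw [div_eq_iff (gaussPdf_pos hσ _).ne']
  unfold gaussPdf
  rw [mul_pow, pow_two (Real.exp _), ← Real.exp_add, h, Real.exp_add, Real.exp_add]
  ring

theorem ofReal_integral_le_lintegral {X : Type*} [MeasurableSpace X] {μ : Measure X} {f : X → ℝ}
    (hf : Integrable f μ) : ENNReal.ofReal (∫ x, f x ∂μ) ≤ ∫⁻ x, ENNReal.ofReal (f x) ∂μ := by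
  refine ENNReal.ofReal_le_of_le_toReal ?_
  rw [integral_eq_lintegral_pos_part_sub_lintegral_neg_part hf]
  exact sub_le_self _ ENNReal.toReal_nonneg

namespace Model

theorem gaussDensity_sq_div (M : Model L nt nr pt pr) (a b y : Obs pt pr) :
    M.gaussDensity a y ^ 2 / M.gaussDensity b y =
      Real.exp (2 / M.σ ^ 2 * ∑ q, ‖a q - b q‖ ^ 2) * M.gaussDensity (2 * a - b) y := by
  unfold gaussDensity
  rw [← Finset.prod_pow, ← Finset.prod_div_distrib, Finset.mul_sum, Real.exp_sum,
    ← Finset.prod_mul_distrib]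
  exact Finset.prod_congr rfl fun q _ => gaussPdf_sq_div M.σ_pos _ _ _

theorem integrable_obsLaw_iff (M : Model L nt nr pt pr) (θ : Param L → ℝ) (f : Obs pt pr → ℝ) :
    Integrable f (M.obsLaw θ) ↔ Integrable fun y => M.gaussDensity (M.mean θ) y * f y := by
  have hm : Measurable fun y => ENNReal.ofReal (M.likelihood θ y) :=
    (M.measurable_likelihood_right θ).ennreal_ofReal
  rw [obsLaw, integrable_withDensity_iff_integrable_smul' hm
    (Eventually.of_forall fun _ => ENNReal.ofReal_lt_top)]
  simp only [likelihood_eq, ENNReal.toReal_ofReal (M.gaussDensity_pos _ _).le, smul_eq_mul]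

theorem integral_obsLaw_eq (M : Model L nt nr pt pr) (θ : Param L → ℝ) (f : Obs pt pr → ℝ) :
    ∫ y, f y ∂(M.obsLaw θ) = ∫ y, M.gaussDensity (M.mean θ) y * f y := by
  have hm : Measurable fun y => ENNReal.ofReal (M.likelihood θ y) :=
    (M.measurable_likelihood_right θ).ennreal_ofReal
  rw [obsLaw, integral_withDensity_eq_integral_toReal_smul hm
    (Eventually.of_forall fun _ => ENNReal.ofReal_lt_top)]
  simp only [likelihood_eq, ENNReal.toReal_ofReal (M.gaussDensity_pos _ _).le, smul_eq_mul]

instance (M : Model L nt nr pt pr) (θ : Param L → ℝ) : IsProbabilityMeasure (M.obsLaw θ) := by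
  rw [obsLaw_eq_map]
  exact Measure.isProbabilityMeasure_map (by fun_prop)

/-- The Hammersley-Chapman-Robbins inequality for the Gaussian shift. -/
theorem chapmanRobbins (M : Model L nt nr pt pr) {θ η : Param L → ℝ} {X : Obs pt pr → ℝ}
    {s d h : ℝ} (hh : 0 < h)
    (hXθ : Integrable X (M.obsLaw θ)) (hXη : Integrable X (M.obsLaw η))
    (hX2 : Integrable (fun y => X y ^ 2) (M.obsLaw θ))
    (h0 : ∫ y, X y ∂(M.obsLaw θ) = s) (h1 : ∫ y, X y ∂(M.obsLaw η) = s + h * d) :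
    2 * d ≤ ∫ y, X y ^ 2 ∂(M.obsLaw θ) +
      (Real.exp (2 / M.σ ^ 2 * ∑ q, ‖M.mean η q - M.mean θ q‖ ^ 2) - 1) / h ^ 2 := by
  rw [integrable_obsLaw_iff] at hXθ hXη hX2
  rw [integral_obsLaw_eq] at h0 h1 ⊢
  set p := M.gaussDensity (M.mean θ)
  set r := M.gaussDensity (M.mean η)
  set w := M.gaussDensity (2 * M.mean η - M.mean θ)
  set c := Real.exp (2 / M.σ ^ 2 * ∑ q, ‖M.mean η q - M.mean θ q‖ ^ 2)
  obtain ⟨hp, hp1⟩ := M.integrable_gaussDensity (M.mean θ)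
  obtain ⟨hr, hr1⟩ := M.integrable_gaussDensity (M.mean η)
  obtain ⟨hw, hw1⟩ := M.integrable_gaussDensity (2 * M.mean η - M.mean θ)
  -- Expand the nonnegative p(X - (r - p)/(hp))². This linearised Cauchy-Schwarz needs no division
  -- by the χ²-divergence.
  have hpt : ∀ y, 2 / h * (r y * X y - p y * X y) ≤
      p y * X y ^ 2 + 1 / h ^ 2 * (c * w y - 2 * r y + p y) := by
    intro y
    have hpy : 0 < p y := M.gaussDensity_pos _ y
    have hq : r y ^ 2 / p y = c * w y := M.gaussDensity_sq_div _ _ _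
    rw [← hq]
    have hsq : 0 ≤ p y * (X y - (r y - p y) / (h * p y)) ^ 2 := by positivity
    have he : p y * (X y - (r y - p y) / (h * p y)) ^ 2 = p y * X y ^ 2 +
        1 / h ^ 2 * (r y ^ 2 / p y - 2 * r y + p y) - 2 / h * (r y * X y - p y * X y) := by
      field_simp
      ring
    linarith
  have hi1 : Integrable fun y => 2 / h * (r y * X y - p y * X y) := (hXη.sub hXθ).const_mul _
  have hi2 : Integrable fun y => c * w y - 2 * r y + p y :=
    ((hw.const_mul c).sub (hr.const_mul 2)).add hp
  have key := integral_mono hi1 (hX2.add (hi2.const_mul (1 / h ^ 2))) hpt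
  simp only [Pi.add_apply] at key
  have e1 : ∫ y, 2 / h * (r y * X y - p y * X y) = 2 * d := by
    rw [integral_const_mul, integral_sub hXη hXθ, h0, h1]
    field_simp
    ring
  have e2 : ∫ y, c * w y - 2 * r y + p y = c - 1 := by
    have hs : Integrable fun y => c * w y - 2 * r y := (hw.const_mul c).sub (hr.const_mul 2)
    have hp' : Integrable p := hp
    have hw2 : ∫ y, w y = 1 := hw1
    have hr2 : ∫ y, r y = 1 := hr1
    have hp2 : ∫ y, p y = 1 := hp1
    rw [integral_add hs hp', integral_sub (hw.const_mul c) (hr.const_mul 2), integral_const_mul,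
      integral_const_mul, hw2, hr2, hp2]
    ring
  rw [e1, integral_add hX2 (hi2.const_mul _), integral_const_mul, e2] at key
  rw [div_eq_mul_one_div, mul_comm (c - 1)]
  exact key

theorem dotProduct_fimNR_mulVec (M : Model L nt nr pt pr) (θ u : Param L → ℝ) :
    u ⬝ᵥ M.fimNR θ *ᵥ u =
      2 / M.σ ^ 2 * ∑ q, ‖∑ i, (u i : ℂ) * M.meanD (Pi.single i 1) θ q‖ ^ 2 := by
  have hn : ∀ q, ‖∑ i, (u i : ℂ) * M.meanD (Pi.single i 1) θ q‖ ^ 2 = ∑ i, ∑ j, u i * u j *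
      (inner ℝ (M.meanD (Pi.single i 1) θ q) (M.meanD (Pi.single j 1) θ q) : ℝ) := by
    intro q
    simp_rw [← Complex.real_smul]
    rw [← real_inner_self_eq_norm_sq, sum_inner]
    refine Finset.sum_congr rfl fun i _ => ?_
    rw [inner_sum]
    refine Finset.sum_congr rfl fun j _ => ?_
    rw [real_inner_smul_left, real_inner_smul_right]
    ring
  simp_rw [hn, dotProduct, Matrix.mulVec, dotProduct, fimNR_eq]
  rw [Finset.sum_comm, Finset.mul_sum]
  refine Finset.sum_congr rfl fun i _ => ?_
  rw [Finset.mul_sum, Finset.sum_comm, Finset.mul_sum]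
  refine Finset.sum_congr rfl fun j _ => ?_
  rw [← Finset.mul_sum]
  ring

theorem integral_dotProduct_fimNR_mulVec (M : Model L nt nr pt pr) (u : Param L → ℝ) :
    Integrable (fun θ => u ⬝ᵥ M.fimNR θ *ᵥ u) M.prior ∧
      ∫ θ, u ⬝ᵥ M.fimNR θ *ᵥ u ∂M.prior = u ⬝ᵥ M.fimD *ᵥ u := by
  have hi : ∀ i j, Integrable (fun θ => M.fimNR θ i j * u j) M.prior := fun i j =>
    (M.integrable_fimNR i j).mul_const _
  have hs : ∀ i, Integrable (fun θ => u i * ∑ j, M.fimNR θ i j * u j) M.prior := fun i =>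
    (integrable_finsetSum _ fun j _ => hi i j).const_mul _
  simp only [dotProduct, Matrix.mulVec]
  refine ⟨integrable_finsetSum _ fun i _ => hs i, ?_⟩
  rw [integral_finsetSum _ fun i _ => hs i]
  refine Finset.sum_congr rfl fun i _ => ?_
  rw [integral_const_mul, integral_finsetSum _ fun j _ => hi i j]
  congr 1
  refine Finset.sum_congr rfl fun j _ => ?_
  rw [integral_mul_const, fimD_eq_integral]

theorem posSemidef_fimD (M : Model L nt nr pt pr) : M.fimD.PosSemidef := by
  refine Matrix.PosSemidef.of_dotProduct_mulVec_nonneg ?_ fun u => ?_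
  · rw [Matrix.IsHermitian, Matrix.conjTranspose_eq_transpose_of_trivial]
    exact M.fimD_isSymm
  · rw [star_trivial, ← (M.integral_dotProduct_fimNR_mulVec u).2]
    refine integral_nonneg fun θ => ?_
    simp only [Pi.zero_apply]
    rw [dotProduct_fimNR_mulVec]
    positivity

/-- Chapman-Robbins between θ and θ + tu, with t ↓ 0. Leaving `u` free, instead of optimising it for
each θ, avoids inverting the non-random information and keeps the bound linear in it. -/
theorem conditional_cramerRao (M : Model L nt nr pt pr) {est : Obs pt pr → Param L → ℝ}
    (hest : M.IsUnbiased est) {θ : Param L → ℝ} (hθ : θ ∈ paramInterior L) (u : Param L → ℝ)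
    (k : Param L) :
    ENNReal.ofReal (2 * u k - u ⬝ᵥ M.fimNR θ *ᵥ u) ≤
      ∫⁻ y, ENNReal.ofReal ((est y k - θ k) ^ 2) ∂(M.obsLaw θ) := by
  by_cases hfin : ∫⁻ y, ENNReal.ofReal ((est y k - θ k) ^ 2) ∂(M.obsLaw θ) = ⊤
  · rw [hfin]
    exact le_top
  have hmeas : Measurable fun y => est y k := (measurable_pi_apply k).comp hest.1
  have hnn : 0 ≤ᵐ[M.obsLaw θ] fun y => (est y k - θ k) ^ 2 :=
    Eventually.of_forall fun y => sq_nonneg _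
  have hX2 : Integrable (fun y => (est y k - θ k) ^ 2) (M.obsLaw θ) :=
    ⟨by fun_prop, by rw [hasFiniteIntegral_iff_ofReal hnn]; exact Ne.lt_top hfin⟩
  rw [← ofReal_integral_eq_lintegral_ofReal hX2 hnn]
  refine ENNReal.ofReal_le_ofReal ?_
  set S := ∫ y, (est y k - θ k) ^ 2 ∂(M.obsLaw θ)
  have hX : ∀ η ∈ paramInterior L, Integrable (fun y => est y k - θ k) (M.obsLaw η) ∧
      ∫ y, (est y k - θ k) ∂(M.obsLaw η) = η k - θ k := by
    intro η hη
    obtain ⟨h1, h2⟩ := hest.2 η (paramInterior_subset L hη) k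
    refine ⟨h1.sub (integrable_const _), ?_⟩
    rw [integral_sub h1 (integrable_const _), h2]
    simp
  set v : Obs pt pr := fun q => ∑ i, (u i : ℂ) * M.meanD (Pi.single i 1) θ q
  have hderiv : ∀ q, HasDerivAt (fun t : ℝ => M.mean (θ + t • u) q) (v q) 0 := by
    intro q
    have h := M.hasDerivAt_meanD 0 q (γ := fun t : ℝ => θ + t • u) (γ' := u) (t := 0) fun i => by
      simpa using ((hasDerivAt_id' (0 : ℝ)).mul_const (u i)).const_add (θ i)
    simp only [zero_add, zero_smul, add_zero] at h
    simp_rw [mean_eq_meanD]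
    exact h
  -- The squared difference quotient of the mean; the exponent in Chapman-Robbins is 2/σ² times t²
  -- z(t).
  set z : ℝ → ℝ := fun t => ∑ q, ‖t⁻¹ • (M.mean (θ + t • u) q - M.mean θ q)‖ ^ 2
  have hz : Tendsto z (𝓝[>] 0) (𝓝 (∑ q, ‖v q‖ ^ 2)) := by
    refine tendsto_finsetSum _ fun q _ => ?_
    have h := (hderiv q).tendsto_slope_zero_right
    simp only [zero_add, zero_smul, add_zero] at h
    exact h.norm.pow 2
  have hlim : Tendsto (fun t => S + 2 / M.σ ^ 2 * z t * Real.exp (2 / M.σ ^ 2 * (t ^ 2 * z t)))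
      (𝓝[>] 0) (𝓝 (S + 2 / M.σ ^ 2 * (∑ q, ‖v q‖ ^ 2) *
        Real.exp (2 / M.σ ^ 2 * (0 ^ 2 * ∑ q, ‖v q‖ ^ 2)))) := by
    have ht : Tendsto (fun t : ℝ => t) (𝓝[>] 0) (𝓝 0) := tendsto_nhdsWithin_of_tendsto_nhds tendsto_id
    exact ((hz.const_mul _).mul ((Real.continuous_exp.tendsto _).comp
      (((ht.pow 2).mul hz).const_mul _))).const_add S
  have hmem : ∀ᶠ t : ℝ in 𝓝[>] 0, θ + t • u ∈ paramInterior L := by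
    have hc : ContinuousAt (fun t : ℝ => θ + t • u) 0 := by fun_prop
    exact (hc.eventually (by simpa using (isOpen_paramInterior L).mem_nhds hθ)).filter_mono
      nhdsWithin_le_nhds
  have hle : 2 * u k ≤ S + 2 / M.σ ^ 2 * (∑ q, ‖v q‖ ^ 2) *
      Real.exp (2 / M.σ ^ 2 * (0 ^ 2 * ∑ q, ‖v q‖ ^ 2)) := by
    refine ge_of_tendsto hlim ?_
    filter_upwards [hmem, self_mem_nhdsWithin] with t ht ht0
    have ht0 : 0 < t := ht0
    have h := M.chapmanRobbins (X := fun y => est y k - θ k) (s := 0) (d := u k) ht0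
      (hX θ hθ).1 (hX _ ht).1 hX2 (by rw [(hX θ hθ).2, sub_self]) (by
        rw [(hX _ ht).2]
        simp)
    refine h.trans (add_le_add le_rfl ?_)
    have hzt : ∑ q, ‖M.mean (θ + t • u) q - M.mean θ q‖ ^ 2 = t ^ 2 * z t := by
      simp only [z, Finset.mul_sum, norm_smul, mul_pow, norm_inv, Real.norm_of_nonneg ht0.le]
      refine Finset.sum_congr rfl fun q _ => ?_
      field_simp
    rw [hzt, div_le_iff₀ (by positivity)]
    set x := 2 / M.σ ^ 2 * (t ^ 2 * z t) with hx
    -- This bound, from 1 - x ≤ e^{-x}, cancels the t² in the denominator and leaves a quantity with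
    -- an evident limit.
    have h1 : Real.exp x - 1 ≤ x * Real.exp x := by
      have h2 := Real.add_one_le_exp (-x)
      have h3 : Real.exp (-x) * Real.exp x = 1 := by rw [← Real.exp_add]; simp
      nlinarith [Real.exp_pos x]
    calc Real.exp x - 1 ≤ x * Real.exp x := h1
      _ = 2 / M.σ ^ 2 * z t * Real.exp x * t ^ 2 := by rw [hx]; ring
  have hQ := M.dotProduct_fimNR_mulVec θ u
  norm_num at hle
  linarith

/-- Average the conditional inequality over the prior, coordinate k using column k of one fixed
matrix; J_NR is then replaced by its mean J_D. The integrand may be negative, which is harmless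
because truncation at zero only increases it. -/
theorem le_mse (M : Model L nt nr pt pr) {est : Obs pt pr → Param L → ℝ}
    (hest : M.IsUnbiased est) (Z : Matrix (Param L) (Param L) ℝ) :
    ∑ k, ENNReal.ofReal (2 * Z k k - (fun i => Z i k) ⬝ᵥ M.fimD *ᵥ fun i => Z i k) ≤ M.mse est := by
  have hmeas : ∀ k, Measurable fun y => est y k := fun k => (measurable_pi_apply k).comp hest.1
  have hm : ∀ k, Measurable fun x : (Param L → ℝ) × Obs pt pr =>
      ENNReal.ofReal ((est x.2 k - x.1 k) ^ 2) := fun k => by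
    have := hmeas k
    fun_prop
  have hmse : M.mse est = ∑ k, ∫⁻ x, ENNReal.ofReal ((est x.2 k - x.1 k) ^ 2) ∂M.joint := by
    rw [mse, ← lintegral_finsetSum _ fun k _ => hm k]
    simp_rw [ENNReal.ofReal_sum_of_nonneg fun i _ => sq_nonneg _]
  rw [hmse]
  refine Finset.sum_le_sum fun k _ => ?_
  obtain ⟨hi, hI⟩ := M.integral_dotProduct_fimNR_mulVec fun i => Z i k
  rw [M.lintegral_joint (hm k)]
  have h1 : Integrable (fun θ => 2 * Z k k -
      (fun i => Z i k) ⬝ᵥ M.fimNR θ *ᵥ fun i => Z i k) M.prior := (integrable_const _).sub hi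
  calc ENNReal.ofReal (2 * Z k k - (fun i => Z i k) ⬝ᵥ M.fimD *ᵥ fun i => Z i k)
      = ENNReal.ofReal (∫ θ, (2 * Z k k -
          (fun i => Z i k) ⬝ᵥ M.fimNR θ *ᵥ fun i => Z i k) ∂M.prior) := by
        rw [integral_sub (integrable_const _) hi, hI]
        simp
    _ ≤ ∫⁻ θ, ENNReal.ofReal (2 * Z k k -
          (fun i => Z i k) ⬝ᵥ M.fimNR θ *ᵥ fun i => Z i k) ∂M.prior :=
        ofReal_integral_le_lintegral h1
    _ ≤ _ := by
        refine lintegral_mono_ae ?_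
        filter_upwards [M.ae_mem_paramInterior] with θ hθ
        exact M.conditional_cramerRao hest hθ (fun i => Z i k) k

end Model

/-! ### Inverses of matrices with large diagonal entries -/

/-- If `J` is positive semidefinite and `E` is a coordinate projection, then the inverse of `J + t E`
converges as `t → ∞`. -/
theorem exists_tendsto_trace_inv {ι : Type*} [Fintype ι] [DecidableEq ι] {J : Matrix ι ι ℝ}
    (hJ : J.PosSemidef) {e : ι → ℝ} (he : ∀ i, e i * e i = e i)
    (hns : ∀ᶠ t : ℝ in atTop, IsUnit (J + t • Matrix.diagonal e).det) :
    ∃ Z : Matrix ι ι ℝ,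
      Tendsto (fun t : ℝ => ((J + t • Matrix.diagonal e)⁻¹).trace) atTop (𝓝 Z.trace) ∧
      Zᵀ * J * Z = Zᵀ := by
  set E := Matrix.diagonal e
  set N : Matrix ι ι ℝ := 1 - E
  have hEE : E * E = E := by
    simp only [E, Matrix.diagonal_mul_diagonal]
    congr 1
    ext i
    exact he i
  have hET : Eᵀ = E := Matrix.diagonal_transpose e
  have hNT : Nᵀ = N := by simp [N, hET]
  have hEN : E * N = 0 := by simp only [N, mul_sub, mul_one, hEE, sub_self]
  have hNE : N * E = 0 := by simp only [N, sub_mul, one_mul, hEE, sub_self]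
  have hNN : N * N = N := by simp only [N, mul_sub, mul_one, sub_mul, one_mul, hEE]; abel
  have hN1 : N + E = 1 := by simp [N]
  -- (J + tE)(N + t⁻¹E) = JN + t⁻¹JE + E tends to `Y`, so the inverse should tend to N Y⁻¹.
  set Y := J * N + E
  -- If Yx = 0, pairing JNx + Ex = 0 with Nx gives (Nx)ᵀJ(Nx) = 0. Semidefiniteness forces JNx = 0,
  -- hence Ex = 0 and Jx = 0, and x lies in the kernel of every J + tE.
  have hY : Y.det ≠ 0 := by
    intro hdet
    obtain ⟨x, hx0, hx⟩ := Matrix.exists_mulVec_eq_zero_iff.2 hdet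
    have h1 : J *ᵥ (N *ᵥ x) + E *ᵥ x = 0 := by
      rw [Matrix.mulVec_mulVec, ← Matrix.add_mulVec, hx]
    have h2 : (N *ᵥ x) ⬝ᵥ (E *ᵥ x) = 0 := by
      rw [Matrix.dotProduct_mulVec, Matrix.vecMul_mulVec, hNT, hNE]
      simp
    have h3 : (N *ᵥ x) ⬝ᵥ J *ᵥ (N *ᵥ x) = 0 := by
      have := congrArg (fun w => (N *ᵥ x) ⬝ᵥ w) h1
      simpa [dotProduct_add, h2] using this
    have h4 : J *ᵥ (N *ᵥ x) = 0 := (hJ.dotProduct_mulVec_zero_iff _).1 (by simpa using h3)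
    have h5 : E *ᵥ x = 0 := by simpa [h4] using h1
    have h6 : N *ᵥ x = x := by
      rw [show N = 1 - E from rfl, Matrix.sub_mulVec, h5, Matrix.one_mulVec, sub_zero]
    obtain ⟨t, ht⟩ := hns.exists
    refine ht.ne_zero (Matrix.exists_mulVec_eq_zero_iff.1 ⟨x, hx0, ?_⟩)
    rw [Matrix.add_mulVec, Matrix.smul_mulVec, h5, ← h6, h4]
    simp
  have hYu : IsUnit Y.det := isUnit_iff_ne_zero.2 hY
  refine ⟨N * Y⁻¹, ?_, ?_⟩
  · set B : ℝ → Matrix ι ι ℝ := fun s => N + s • E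
    set C : ℝ → Matrix ι ι ℝ := fun s => J * N + s • (J * E) + E
    have hC0 : C 0 = Y := by simp [C, Y]
    have hB0 : B 0 = N := by simp [B]
    have hcC : Continuous C := by fun_prop
    have hcB : Continuous B := by fun_prop
    -- With s = t⁻¹ the limit becomes continuity at s = 0; writing the inverse as adjugate over
    -- determinant makes this polynomial.
    have hF : ContinuousAt (fun s => (C s).det⁻¹ * (B s * (C s).adjugate).trace) 0 := by
      refine ContinuousAt.mul (ContinuousAt.inv₀ hcC.matrix_det.continuousAt (by rwa [hC0])) ?_
      exact (hcB.mul hcC.matrix_adjugate).matrix_trace.continuousAt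
    have hF0 : (C 0).det⁻¹ * (B 0 * (C 0).adjugate).trace = (N * Y⁻¹).trace := by
      rw [hC0, hB0, Matrix.inv_def, Ring.inverse_eq_inv', Matrix.mul_smul, Matrix.trace_smul,
        smul_eq_mul]
    have ht := hF.tendsto.comp (tendsto_inv_atTop_zero (𝕜 := ℝ))
    rw [hF0] at ht
    refine ht.congr' ?_
    filter_upwards [hns, eventually_gt_atTop 0] with t hu ht0
    have hprod : (J + t • E) * B t⁻¹ = C t⁻¹ := by
      simp only [B, C, mul_add, add_mul, Matrix.mul_smul, Matrix.smul_mul, hEN, hEE, smul_zero,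
        add_zero, smul_smul, inv_mul_cancel₀ ht0.ne', one_smul]
      abel
    have hBB : B t⁻¹ * B t = 1 := by
      simp only [B, mul_add, add_mul, Matrix.mul_smul, Matrix.smul_mul, hEN, hEE, hNE, hNN,
        smul_zero, add_zero, zero_add, smul_smul, mul_inv_cancel₀ ht0.ne',
        one_smul, hN1]
    have hBu : IsUnit (B t⁻¹).det := by
      have := congrArg Matrix.det hBB
      rw [Matrix.det_mul, Matrix.det_one] at this
      exact IsUnit.of_mul_eq_one _ this
    have hinv : (J + t • E)⁻¹ = B t⁻¹ * (C t⁻¹)⁻¹ := by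
      rw [← hprod, Matrix.mul_inv_rev, ← mul_assoc, Matrix.mul_nonsing_inv _ hBu, one_mul]
    simp only [Function.comp]
    rw [hinv, Matrix.inv_def (C t⁻¹), Ring.inverse_eq_inv', Matrix.mul_smul, Matrix.trace_smul,
      smul_eq_mul]
  -- Because JN = Y - E; the remaining term with `E` is annihilated on the left by Zᵀ, which ends in
  -- `N`.
  · have h1 : J * (N * Y⁻¹) = 1 - E * Y⁻¹ := by
      rw [← mul_assoc, show J * N = Y - E by simp [Y], sub_mul, Matrix.mul_nonsing_inv _ hYu]
    rw [mul_assoc, h1, mul_sub, mul_one, Matrix.transpose_mul, hNT, mul_assoc, ← mul_assoc N, hNE]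
    simp

/-! ### The cut-off information matrix and the Bayesian bound -/

namespace Model

/-- The diagonal of the projection to the path gains. -/
def gainIndicator (L : ℕ) : Param L → ℝ := Sum.elim (fun _ => 0) (Sum.elim (fun _ => 0) fun _ => 1)

/-- The infinite gain entries become t; `ht` keeps the zero entries from being cut off. -/
theorem cappedSum_fim (M : Model L nt nr pt pr) {t : ℝ} (ht : 0 ≤ t) :
    cappedSum M.fimD M.fimP t = M.fimD + t • Matrix.diagonal (gainIndicator L) := by
  have ht' : (0 : EReal) ≤ (t : EReal) := by exact_mod_cast ht
  rw [cappedSum]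
  congr 1
  ext i j
  rw [Matrix.map_apply, Matrix.smul_apply, smul_eq_mul]
  by_cases h : ∃ l, i = gain l ∧ j = gain l
  · obtain ⟨l, rfl, rfl⟩ := h
    rw [fimP_gain_eq_top]
    simp [gainIndicator]
  · rw [fimP_eq_zero M h, min_eq_left ht', EReal.toReal_zero]
    rcases eq_or_ne i j with rfl | hij
    · rcases i with l | l | l
      · simp [gainIndicator]
      · simp [gainIndicator]
      · exact absurd ⟨l, rfl, rfl⟩ h
    · rw [Matrix.diagonal_apply_ne _ hij, mul_zero]

theorem exists_isTraceInvSum (M : Model L nt nr pt pr) (hns : IsNonsingularSum M.fimD M.fimP) :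
    ∃ c : ℝ, IsTraceInvSum M.fimD M.fimP c ∧
      ∀ est : Obs pt pr → Param L → ℝ, M.IsUnbiased est → ENNReal.ofReal c ≤ M.mse est := by
  have hev : ∀ᶠ t : ℝ in atTop,
      cappedSum M.fimD M.fimP t = M.fimD + t • Matrix.diagonal (gainIndicator L) :=
    (eventually_ge_atTop 0).mono fun t ht => M.cappedSum_fim ht
  obtain ⟨Z, hlim, hZ⟩ := exists_tendsto_trace_inv M.posSemidef_fimD (e := gainIndicator L)
    (fun i => by rcases i with l | l | l <;> simp [gainIndicator])
    ((eventually_congr (hev.mono fun t ht => by rw [ht])).1 hns)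
  refine ⟨Z.trace, hlim.congr' (hev.mono fun t ht => by simp only [ht]), fun est hest => ?_⟩
  -- Diagonal of ZᵀJ_D Z = Zᵀ: each summand 2Zₖₖ - zₖᵀJ_D zₖ of the lower bound, zₖ being column k,
  -- collapses to Zₖₖ, nonnegative by semidefiniteness.
  have hdiag : ∀ k, (fun i => Z i k) ⬝ᵥ M.fimD *ᵥ (fun i => Z i k) = Z k k := by
    intro k
    have := congrFun (congrFun hZ k) k
    rw [mul_assoc, Matrix.transpose_apply] at this
    rw [← this]
    rfl
  have hnn : ∀ k, 0 ≤ Z k k := fun k => by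
    rw [← hdiag k]
    simpa using M.posSemidef_fimD.dotProduct_mulVec_nonneg fun i => Z i k
  refine le_trans (le_of_eq ?_) (M.le_mse hest Z)
  simp only [Matrix.trace, Matrix.diag_apply]
  rw [ENNReal.ofReal_sum_of_nonneg fun k _ => hnn k]
  refine Finset.sum_congr rfl fun k _ => ?_
  rw [hdiag]
  congr 1
  ring

theorem measurePreserving_gain (M : Model L nt nr pt pr) (l : Fin L) :
    MeasurePreserving (fun θ : Param L → ℝ => θ (gain l)) M.prior
      (riceLaw (M.riceK l) (M.Ω l)) :=
  M.measurePreserving_eval_prior (gain l)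

theorem integrable_gain (M : Model L nt nr pt pr) (l : Fin L) :
    Integrable (fun θ : Param L → ℝ => θ (gain l)) M.prior :=
  (M.measurePreserving_gain l).integrable_comp_of_integrable (g := fun a : ℝ => a)
    (integrable_id_riceLaw (M.riceK_nonneg l) (M.Ω_pos l))

theorem integrable_gain_sq (M : Model L nt nr pt pr) (l : Fin L) :
    Integrable (fun θ : Param L → ℝ => θ (gain l) ^ 2) M.prior :=
  (M.measurePreserving_gain l).integrable_comp_of_integrable (g := fun a : ℝ => a ^ 2)
    (integrable_sq_riceLaw (M.riceK_nonneg l) (M.Ω_pos l))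

end Model

end

end MmWave

open MmWave in
theorem proposition1 {L nt nr pt pr : ℕ} (M : Model L nt nr pt pr) :
    -- the data part: it is well defined and it is the prior average of the non-random matrix
    (∀ i j,
      Integrable (fun x : (Param L → ℝ) × Obs pt pr => pderiv₂ i j (M.logLik x.2) x.1) M.joint ∧
      Integrable (fun θ => M.fimNR θ i j) M.prior ∧
      M.fimD i j = ∫ θ, M.fimNR θ i j ∂M.prior) ∧
    (∀ l, Integrable (fun θ : Param L → ℝ => θ (gain l)) M.prior ∧
      Integrable (fun θ : Param L → ℝ => θ (gain l) ^ 2) M.prior) ∧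
    -- the entries of the data part
    M.fimD.IsSymm ∧
    (∀ l, (M.fimD (aod l) (aod l) : ℂ) =
      2 * Real.pi ^ 2 * M.gainMoment 2 l / M.σ ^ 2 * M.trK (P₁ nt) (Q₁ nr)) ∧
    (∀ l, M.fimD (aod l) (gain l) =
      -2 * Real.pi * M.gainMoment 1 l / M.σ ^ 2 * (M.trK (P₂ nt) (Q₁ nr)).im) ∧
    (∀ l, M.fimD (aod l) (aoa l) =
      -2 * Real.pi ^ 2 * M.gainMoment 2 l / M.σ ^ 2 * (M.trK (P₃ nt) (Q₂ nr)).re) ∧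
    (∀ l, M.fimD (aoa l) (gain l) =
      2 * Real.pi * M.gainMoment 1 l / M.σ ^ 2 * (M.trK (P₄ nt) (Q₂ nr)).im) ∧
    (∀ l m, l ≠ m → M.fimD (aod l) (gain m) =
      -2 * Real.pi * M.gainMoment 1 l / M.σ ^ 2 * (M.trK (P₅ nt) (Q₃ nr)).im) ∧
    (∀ l m, l ≠ m → M.fimD (aoa l) (gain m) =
      2 * Real.pi * M.gainMoment 1 l / M.σ ^ 2 * (M.trK (P₆ nt) (Q₄ nr)).im) ∧
    (∀ l m, l ≠ m → M.fimD (aod l) (aod m) =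
      2 * Real.pi ^ 2 * M.gainMoment 1 l * M.gainMoment 1 m / M.σ ^ 2 *
        (M.trK (P₇ nt) (Q₃ nr)).re) ∧
    (∀ l m, l ≠ m → M.fimD (aoa l) (aoa m) =
      2 * Real.pi ^ 2 * M.gainMoment 1 l * M.gainMoment 1 m / M.σ ^ 2 *
        (M.trK (P₈ nt) (Q₅ nr)).re) ∧
    (∀ l, (M.fimD (aoa l) (aoa l) : ℂ) =
      2 * Real.pi ^ 2 * M.gainMoment 2 l / M.σ ^ 2 * M.trK (P₄ nt) (Q₆ nr)) ∧
    (∀ l m, l ≠ m → M.fimD (aod l) (aoa m) =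
      -2 * Real.pi ^ 2 * M.gainMoment 1 l * M.gainMoment 1 m / M.σ ^ 2 *
        (M.trK (P₉ nt) (Q₇ nr)).re) ∧
    (∀ l, (M.fimD (gain l) (gain l) : ℂ) = 2 / M.σ ^ 2 * M.trK (P₄ nt) (Q₁ nr)) ∧
    (∀ l m, l ≠ m → M.fimD (gain l) (gain m) =
      2 / M.σ ^ 2 * (M.trK (P₆ nt) (Q₃ nr)).re) ∧
    -- the entries of the prior part: only the diagonal gain entries do not vanish
    (∀ i j, (¬ ∃ l, i = gain l ∧ j = gain l) → M.fimP i j = 0) ∧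
    (∀ l, ∀ᵐ θ ∂M.prior,
      (pderiv₂ (gain l) (gain l) (fun η => Real.log (M.priorPdf η)) θ : ℂ) =
        riceLogDeriv₂ (M.riceK l) (M.Ω l) (θ (gain l))) ∧
    (∀ l, (∫⁻ a, ENNReal.ofReal (riceLogDeriv₂ (M.riceK l) (M.Ω l) a).re
        ∂(riceLaw (M.riceK l) (M.Ω l))) ≠ ⊤ ∧
      M.fimP (gain l) (gain l) =
        extExpectation (riceLaw (M.riceK l) (M.Ω l))
          fun a => -(riceLogDeriv₂ (M.riceK l) (M.Ω l) a).re) ∧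
    -- the Bayesian Cramér-Rao lower bound is the trace of the inverse of the sum
    (IsNonsingularSum M.fimD M.fimP →
      ∃ c : ℝ, IsTraceInvSum M.fimD M.fimP c ∧
        ∀ est : Obs pt pr → Param L → ℝ, M.IsUnbiased est → ENNReal.ofReal c ≤ M.mse est) := by
  refine ⟨fun i j => ⟨M.integrable_pderiv₂_logLik i j, M.integrable_fimNR i j,
      M.fimD_eq_integral i j⟩, fun l => ⟨M.integrable_gain l, M.integrable_gain_sq l⟩,
    M.fimD_isSymm, M.fimD_aod_aod_self,
    M.fimD_aod_gain_self, M.fimD_aod_aoa_self, M.fimD_aoa_gain_self, fun l m h => ?_,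
    fun l m h => ?_, fun l m h => ?_, fun l m h => ?_, M.fimD_aoa_aoa_self, fun l m h => ?_,
    M.fimD_gain_gain_self, fun l m h => M.fimD_gain_gain_of_ne h, fun i j h => M.fimP_eq_zero h,
    fun l => ?_, fun l => ⟨?_, ?_⟩, M.exists_isTraceInvSum⟩
  -- In this and the next four entries both sides are zero: the left by a vanishing angular first
  -- moment, the right because one Kronecker factor vanishes identically.
  · rw [M.fimD_eq_zero_of_firstMoment (i := aod l) (j := gain m) h (M.firstMoment_aod l),
      P₅_eq_zero, M.trK_zero_left, Complex.zero_im, mul_zero]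
  · rw [M.fimD_eq_zero_of_firstMoment (i := aoa l) (j := gain m) h (M.firstMoment_aoa l),
      Q₄_eq_zero, M.trK_zero_right, Complex.zero_im, mul_zero]
  · rw [M.fimD_eq_zero_of_firstMoment (i := aod l) (j := aod m) h (M.firstMoment_aod l),
      P₇_eq_zero, M.trK_zero_left, Complex.zero_re, mul_zero]
  · rw [M.fimD_eq_zero_of_firstMoment (i := aoa l) (j := aoa m) h (M.firstMoment_aoa l),
      Q₅_eq_zero, M.trK_zero_right, Complex.zero_re, mul_zero]
  · rw [M.fimD_eq_zero_of_firstMoment (i := aod l) (j := aoa m) h (M.firstMoment_aod l),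
      P₉_eq_zero, M.trK_zero_left, Complex.zero_re, mul_zero]
  · filter_upwards [M.ae_mem_paramInterior] with θ hθ
    rw [riceLogDeriv₂_eq (M.riceK_nonneg l) (M.Ω_pos l), M.pderiv₂_log_priorPdf_gain hθ]
  · simp_rw [riceLogDeriv₂_eq (M.riceK_nonneg l) (M.Ω_pos l), Complex.ofReal_re]
    exact lintegral_riceCurv_ne_top (M.riceK_nonneg l) (M.Ω_pos l)
  · simp_rw [riceLogDeriv₂_eq (M.riceK_nonneg l) (M.Ω_pos l), Complex.ofReal_re]
    exact M.fimP_gain l
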